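/- **Definitions.** Let $V$ be a finite-dimensional real vector space and $\mathcal A\subset V^*$ a finite set of covectors spanning $V^*$. Put $G(x,y)=\sum_{\alpha\in\mathcal A}\alpha(x)\alpha(y)$, let $\varphi:V\to V^*$ be the induced isomorphism and write $f^\vee=\varphi^{-1}(f)$ for $f\in V^*$. $\mathcal A$ is a *$\vee$-system* if for every two-dimensional subspace $\Pi\subset V^*$ and every $\alpha\in\Pi\cap\mathcal A$ there is $\nu\in\mathbb R$ with $\sum_{\beta\in\Pi\cap\mathcal A}\beta(\alpha^\vee)\beta^\vee=\nu\,\alpha^\vee$. A *deformation* of class $C^k$ of a $\vee$-system $\mathcal A$ (where $0\le k\le\infty$ or $k=\omega$) is a family of covectors $\alpha_t\in V^*$ ($\alpha\in\mathcal A$, $|t|<\varepsilon$) of class $C^k$ in $t$, with $\alpha_0=\alpha$, such that for every $t$ the $\alpha_t$ are pairwise distinct, $\mathcal A(t)=\{\alpha_t\}$ is a $\vee$-system, and $\mathcal A(t)$ has the same matroid as $\mathcal A$ (for every $S\subset\mathcal A$, the family $(\alpha_t)_{\alpha\in S}$ is linearly independent if and only if $S$ is). It is *trivial* if $\alpha_t=g_t(\alpha)$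 for all $\alpha\in\mathcal A$ and $|t|<\varepsilon$, with $g_t\in GL(V^*)$ of class $C^k$ in $t$. The *linearised $\vee$-conditions* on $\xi=(\xi_\alpha)_{\alpha\in\mathcal A}\in\mathbb R^{\mathcal A}$, which are the linearisation at $\mu=1$ of the $\vee$-conditions for $\{\mu_\alpha\alpha\}$, are as follows, where $X=\sum_{\alpha\in\mathcal A}\xi_\alpha\,\alpha\otimes\alpha$, $X^\Pi=\sum_{\alpha\in\Pi\cap\mathcal A}\xi_\alpha\,\alpha\otimes\alpha$ and $G^\Pi=\sum_{\alpha\in\Pi\cap\mathcal A}\alpha\otimes\alpha$: $X(\alpha^\vee,\beta^\vee)=0$ whenever $\alpha\neq\beta$ are the only two covectors of $\mathcal A$ in a two-dimensional subspace; and, for every two-dimensional subspace $\Pi$ containing more than two covectors of $\mathcal A$, the restriction of $X^\Pi-\nu X$ to $\Pi^\vee=\varphi^{-1}(\Pi)$ is proportional to $G|_{\Pi^\vee}$, where $\nu$ is the number with $G^\Pi(\alpha^\vee,v)=\nu\, G(\alpha^\vee,v)$ for all $\alpha\in\Pi\cap\mathcal A$, $v\in V$. For a finite Coxeter group $G$ of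 type $E_7$, $E_8$, $H_3$ or $H_4$, its *Coxeter configuration* consists of the positive roots (all of the same length), regarded as covectors. For a parabolic subgroup $H$, the set $(G,H)$ is obtained by restricting these covectors to the subspace fixed by $H$, discarding the zero ones, and merging proportional ones: on each line spanned by a non-zero restriction there is exactly one covector $\alpha$, determined up to sign by $\alpha\otimes\alpha=\sum\beta\otimes\beta$, the sum being over all the restrictions $\beta$, counted with multiplicity, that lie on the line. In the cases below the type of $H$ determines $H$ up to conjugation. **Theorem.** Each of $(E_7,A_1^2\times A_2)$, $(E_8,A_2\times A_3)$, $(E_8,A_2^2\times A_1)$, $(E_8,A_1^3\times A_2)$, $(E_8,A_1^2\times A_3)$, $(E_8,A_1\times A_4)$, $(H_4,A_1)$ and $H_3$ is a $\vee$-system (in dimension three) that admits no non-trivial deformations: every deformation of it, of any class $C^k$, is trivial. Moreover, none of them has a non-trivial infinitesimal scaling deformation: every solution $\xi$ of the linearised $\vee$-conditions is constant, $\xi_\alpha=c$ for all $\alpha\in\mathcal A$ (uniform scaling). -/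

import Mathlib

open scoped Classical

noncomputable section

namespace VeeSystem

open Module

/-! ### Vee-systems

A finite set of covectors is handled as a family `α : ι → Dual ℝ V` over a finite index type, so that
deformations can be followed covector by covector. -/

section Basic

variable {V ι : Type*} [AddCommGroup V] [Module ℝ V] [Fintype ι]

/-- The map `φ : V → V*` given by the canonical form:
`canonicalMap α x y = G(x, y) = ∑ i, α i x * α i y`. -/
def canonicalMap (α : ι → Dual ℝ V) : V →ₗ[ℝ] Dual ℝ V :=
  ∑ i, (α i).smulRight (α i)

/-- The vector `f^∨ = φ⁻¹ f` (`φ` is bijective as soon as the covectors span `V*`). -/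
def vee (α : ι → Dual ℝ V) (f : Dual ℝ V) : V :=
  Function.invFun (canonicalMap α) f

/-- The form `∑ ξ i * α i x * α i y`, the sum being over the covectors that lie in `P`. -/
def weightedForm (α : ι → Dual ℝ V) (ξ : ι → ℝ) (P : Submodule ℝ (Dual ℝ V)) (x y : V) : ℝ :=
  ∑ i with α i ∈ P, ξ i * α i x * α i y

/-- The vee-conditions, for a finite set of covectors (an injective family) spanning `V*`. -/
structure IsVeeSystem (α : ι → Dual ℝ V) : Prop where
  injective : Function.Injective α
  span_eq_top : Submodule.span ℝ (Set.range α) = ⊤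
  vee_condition : ∀ P : Submodule ℝ (Dual ℝ V), finrank ℝ P = 2 → ∀ i, α i ∈ P →
    ∃ ν : ℝ, ∑ j with α j ∈ P, α j (vee α (α i)) • vee α (α j) = ν • vee α (α i)

/-- `A t`, for `t` in the interval `(-ε, ε)`, is a deformation of class `C^k` of `α`: it passes
through `α` at `t = 0` and consists of vee-systems that realise the same (labelled) matroid as `α`. -/
structure IsDeformation (k : WithTop ℕ∞) (ε : ℝ) (α : ι → Dual ℝ V)
    (A : ℝ → ι → Dual ℝ V) : Prop where
  zero : A 0 = α
  contDiffOn : ∀ (i : ι) (x : V), ContDiffOn ℝ k (fun t => A t i x) (Set.Ioo (-ε) ε)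
  isVeeSystem : ∀ t ∈ Set.Ioo (-ε) ε, IsVeeSystem (A t)
  matroid_eq : ∀ t ∈ Set.Ioo (-ε) ε, ∀ S : Set ι,
    LinearIndepOn ℝ (A t) S ↔ LinearIndepOn ℝ α S

/-- The deformation comes from a `C^k` family of linear automorphisms of `V*`. -/
def IsTrivialDeformation (k : WithTop ℕ∞) (ε : ℝ) (α : ι → Dual ℝ V)
    (A : ℝ → ι → Dual ℝ V) : Prop :=
  ∃ g : ℝ → (Dual ℝ V ≃ₗ[ℝ] Dual ℝ V),
    (∀ (f : Dual ℝ V) (x : V), ContDiffOn ℝ k (fun t => g t f x) (Set.Ioo (-ε) ε)) ∧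
    ∀ t ∈ Set.Ioo (-ε) ε, ∀ i, A t i = g t (α i)

/-- The linearised vee-conditions on the derivatives `ξ i = μ̇ i (0)` of a scaling deformation
`A t i = μ i (t) • α i`, `μ i (0) = 1`. Here `X = weightedForm α ξ ⊤`, `X^P = weightedForm α ξ P`,
`G = weightedForm α 1 ⊤` and `G^P = weightedForm α 1 P`. -/
structure LinearisedVeeConditions (α : ι → Dual ℝ V) (ξ : ι → ℝ) : Prop where
  /-- `X(α i^∨, α j^∨) = 0` if `α i`, `α j` are the only two covectors in a plane. -/
  two : ∀ P : Submodule ℝ (Dual ℝ V), finrank ℝ P = 2 →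
    ∀ i j, i ≠ j → (∀ k, α k ∈ P ↔ k = i ∨ k = j) →
      weightedForm α ξ ⊤ (vee α (α i)) (vee α (α j)) = 0
  /-- `X^P - ν X` is proportional to `G` on `P^∨` if the plane `P` has more than two covectors,
  where `ν = ν(P)` is the coefficient in `G^P(α i^∨, v) = ν G(α i^∨, v)`. -/
  many : ∀ P : Submodule ℝ (Dual ℝ V), finrank ℝ P = 2 → 2 < {k | α k ∈ P}.ncard →
    ∃ ν : ℝ,
      (∀ i, α i ∈ P → ∀ v : V, weightedForm α 1 P (vee α (α i)) v
        = ν * weightedForm α 1 ⊤ (vee α (α i)) v) ∧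
      ∃ c : ℝ, ∀ f ∈ P, ∀ h ∈ P,
        weightedForm α ξ P (vee α f) (vee α h) - ν * weightedForm α ξ ⊤ (vee α f) (vee α h)
          = c * weightedForm α 1 ⊤ (vee α f) (vee α h)

/-- The set `S` of covectors is a (finite) vee-system without non-trivial deformations, neither
actual ones of any class `C^k` (continuous, smooth, analytic), nor infinitesimal ones: the linearised
vee-conditions only have the solutions that correspond to uniform scaling. -/
def IsRigidVeeSystem (S : Set (Dual ℝ V)) : Prop :=
  ∃ F : Finset (Dual ℝ V), (F : Set (Dual ℝ V)) = S ∧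
    IsVeeSystem (fun α : F => (α : Dual ℝ V)) ∧
    (∀ (k : WithTop ℕ∞) (ε : ℝ), 0 < ε → ∀ A : ℝ → F → Dual ℝ V,
      IsDeformation k ε (fun α : F => (α : Dual ℝ V)) A →
        IsTrivialDeformation k ε (fun α : F => (α : Dual ℝ V)) A) ∧
    ∀ ξ : F → ℝ, LinearisedVeeConditions (fun α : F => (α : Dual ℝ V)) ξ → ∃ c : ℝ, ∀ i, ξ i = c

end Basic

/-! ### Coxeter configurations and their restrictions

The space `V = ℝⁿ` is coordinatised by the simple roots: the `i`-th coordinate of `x` is the value at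
`x` of the `i`-th simple root. Roots are described by their coefficients in the simple roots. -/

section Coxeter

variable {n : ℕ}

/-- The bilinear form on the span of the simple roots with `⟨a_i, a_j⟩ = - cos (π / m_ij)`. -/
def coxeterForm (M : CoxeterMatrix (Fin n)) (x y : Fin n → ℝ) : ℝ :=
  ∑ i, ∑ j, x i * y j * -Real.cos (Real.pi / M i j)

/-- The simple reflection `x ↦ x - 2 ⟨x, a_i⟩ a_i` (the `a_i` are unit vectors). -/
def simpleReflection (M : CoxeterMatrix (Fin n)) (i : Fin n) (x : Fin n → ℝ) : Fin n → ℝ :=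
  x - (2 * coxeterForm M x (Pi.single i 1)) • Pi.single i 1

/-- The roots: the images of the simple roots under the group generated by the simple
reflections. -/
inductive IsRoot (M : CoxeterMatrix (Fin n)) : (Fin n → ℝ) → Prop
  | simple (i : Fin n) : IsRoot M (Pi.single i 1)
  | reflect (i : Fin n) (x : Fin n → ℝ) : IsRoot M x → IsRoot M (simpleReflection M i x)

/-- The positive roots, one for each reflection of the Coxeter group. -/
def positiveRoots (M : CoxeterMatrix (Fin n)) : Set (Fin n → ℝ) :=
  {x | IsRoot M x ∧ 0 ≤ x}

/-- The subspace of `V` fixed by the parabolic subgroup generated by the simple reflections in `J`,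
that is, the common zeros of the simple roots in `J`. -/
def fixedSpace (J : Finset (Fin n)) : Submodule ℝ (Fin n → ℝ) where
  carrier := {x | ∀ j ∈ J, x j = 0}
  add_mem' := fun {a b} ha hb j hj => by simp [ha j hj, hb j hj]
  zero_mem' := fun _ _ => rfl
  smul_mem' := fun c a ha j hj => by simp [ha j hj]

/-- The restriction to `fixedSpace J` of the covector with coefficients `a` in the simple roots. -/
def restrictRoot (J : Finset (Fin n)) (a : Fin n → ℝ) : Dual ℝ (fixedSpace J) :=
  (∑ i, a i • (LinearMap.proj i : (Fin n → ℝ) →ₗ[ℝ] ℝ)).domRestrict (fixedSpace J)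

/-- The restriction `(G, H)` of the Coxeter configuration of `G` (the finite Coxeter group with Coxeter
matrix `M`) to the fixed space of its parabolic subgroup `H` (generated by `J`), with proportional
covectors merged into one: each line spanned by a non-zero restriction of a positive root carries
exactly one covector `α`, a positive multiple of that restriction, normalised by
`α ⊗ α = ∑ β ⊗ β`, where `β` runs over the restrictions (with repetitions) of all the positive roots
whose restriction lies on that line. -/
def coxeterRestriction (M : CoxeterMatrix (Fin n)) (J : Finset (Fin n)) :
    Set (Dual ℝ (fixedSpace J)) :=
  {α | α ≠ 0 ∧ (∃ a ∈ positiveRoots M, ∃ c : ℝ, 0 < c ∧ α = c • restrictRoot J a) ∧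
    ∀ u v : fixedSpace J, α u * α v =
      ∑ᶠ b ∈ {b | b ∈ positiveRoots M ∧ restrictRoot J b ∈ Submodule.span ℝ {α}},
        restrictRoot J b u * restrictRoot J b v}

/-! The eight systems. The nodes of `E₇`, `E₈` are labelled from `0`, with edges
`0-2, 2-3, 1-3, 3-4, 4-5, 5-6` and also `6-7` for `E₈`; those of `H₃`, `H₄` are labelled along the
path, whose last edge has label `5`. The type of the parabolic subgroup determines it up to
conjugation in each case. -/

/-- `(E₇, A₁² × A₂)`: the components of the parabolic subgroup are `{0}`, `{1}`, `{4, 5}`. -/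
def E₇A₁A₁A₂ := coxeterRestriction CoxeterMatrix.E₇ {0, 1, 4, 5}

/-- `(E₈, A₂ × A₃)`: components `{0, 2}`, `{4, 5, 6}`. -/
def E₈A₂A₃ := coxeterRestriction CoxeterMatrix.E₈ {0, 2, 4, 5, 6}

/-- `(E₈, A₂² × A₁)`: components `{0, 2}`, `{4, 5}`, `{7}`. -/
def E₈A₂A₂A₁ := coxeterRestriction CoxeterMatrix.E₈ {0, 2, 4, 5, 7}

/-- `(E₈, A₁³ × A₂)`: components `{0}`, `{1}`, `{7}`, `{4, 5}`. -/
def E₈A₁A₁A₁A₂ := coxeterRestriction CoxeterMatrix.E₈ {0, 1, 4, 5, 7}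

/-- `(E₈, A₁² × A₃)`: components `{0}`, `{1}`, `{4, 5, 6}`. -/
def E₈A₁A₁A₃ := coxeterRestriction CoxeterMatrix.E₈ {0, 1, 4, 5, 6}

/-- `(E₈, A₁ × A₄)`: components `{0}`, `{4, 5, 6, 7}`. -/
def E₈A₁A₄ := coxeterRestriction CoxeterMatrix.E₈ {0, 4, 5, 6, 7}

/-- `(H₄, A₁)`. -/
def H₄A₁ := coxeterRestriction CoxeterMatrix.H₄ {0}

/-- The Coxeter system `H₃` (nothing is restricted). -/
def H₃ := coxeterRestriction CoxeterMatrix.H₃ ∅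

end Coxeter

end VeeSystem

end

/-!
The space of each of the eight systems is three-dimensional, so that, up to scaling, the covectors
are points of a projective plane. Rigidity is the conjunction of two facts, one about scaling, one
about the points.

*Scaling.* Suppose that the linearised vee-conditions have only the constant solutions. If `α` and
the rescaled system `ρ α` are both vee-systems, then `ρ² - 1` satisfies the linearised
vee-conditions with one of the two isomorphisms `V* → V` replaced by that of `ρ α`
(`weighted_sub_one_eq`). Non-trivial `ρ` arbitrarily close to `1` with one entry kept equal to `1`
would therefore, by compactness of the unit sphere, accumulate at a non-constant solution of the
linearised conditions themselves: `ρ = 1` is isolated (`eventually_eq_one_of_isVeeSystem`), and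
along an interval the set of parameters with `ρ = 1` is clopen (`eq_one_of_continuousOn`). Only
continuity is needed, so all classes `C^k` are covered.

*Points.* A deformation keeps the matroid. Relative to four of its own covectors in general
position, which serve as a projective frame, every other point is obtained by intersecting lines
through points already known, hence it does not move (`par_of_stepsCheck`). For `H₃` and `(H₄, A₁)`
a further point is needed to start with; incidences force its coordinate to satisfy a quadratic
equation with two real roots, and it cannot jump between them
(`IsFramedMotion.par_of_isGoldenConfiguration`). Consequently a deformation is, up to a linear
automorphism depending on `t`, a scaling deformation, hence trivial; the automorphisms are as
regular as the three covectors which determine them (`isTrivialDeformation_of_rigid`).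

*Finite computations.* It remains to describe the eight systems and to verify their vee-conditions,
the rank of their linearised vee-conditions and the incidences. With the covectors written as
`√w p`, only the weights `w` and the points `p` matter, and these have entries in the ring `ℤ[φ]`
of the golden ratio, where everything is decided exactly. For the rank it suffices that a square
subsystem is invertible modulo a prime at which `φ` has a residue
(`eq_zero_of_eliminate_reduceMod`). The positive roots are enumerated: a list that is reached from
the simple roots and is closed, up to sign, under the simple reflections is complete
(`positiveRoots_eq_of_rootsCheck`), and its merged restrictions are compared with the list of
weighted points (`coxeterRestriction_eq_listSystem`).
-/

open scoped Classical

noncomputable section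

namespace VeeSystem

open Module Filter Topology

/-! ### The canonical form and the vee-conditions -/

section Basic

variable {V ι : Type*} [AddCommGroup V] [Module ℝ V]

lemma eq_zero_of_forall_apply_eq_zero {κ : Type*} {α : κ → Dual ℝ V}
    (h : Submodule.span ℝ (Set.range α) = ⊤) {x : V} (hx : ∀ i, α i x = 0) : x = 0 := by
  rw [← Module.forall_dual_apply_eq_zero_iff ℝ]
  intro f
  have hf : f ∈ Submodule.span ℝ (Set.range α) := h ▸ Submodule.mem_top
  induction hf using Submodule.span_induction with
  | mem f hf => obtain ⟨i, rfl⟩ := hf; exact hx i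
  | zero => simp
  | add f g _ _ hf hg => simp [hf, hg]
  | smul c f _ hf => simp [hf]

variable [Fintype ι]

lemma canonicalMap_apply (α : ι → Dual ℝ V) (x : V) :
    canonicalMap α x = ∑ i, α i x • α i := by
  simp [canonicalMap, LinearMap.sum_apply]

lemma canonicalMap_apply_apply (α : ι → Dual ℝ V) (x y : V) :
    canonicalMap α x y = ∑ i, α i x * α i y := by
  simp [canonicalMap_apply, LinearMap.sum_apply]

lemma canonicalMap_symm (α : ι → Dual ℝ V) (x y : V) :
    canonicalMap α x y = canonicalMap α y x := by
  simp [canonicalMap_apply_apply, mul_comm]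

lemma canonicalMap_injective {α : ι → Dual ℝ V}
    (h : Submodule.span ℝ (Set.range α) = ⊤) : Function.Injective (canonicalMap α) := by
  rw [injective_iff_map_eq_zero]
  intro x hx
  have h0 : ∑ i, α i x * α i x = 0 := by
    rw [← canonicalMap_apply_apply, hx]; rfl
  rw [Finset.sum_eq_zero_iff_of_nonneg fun i _ => mul_self_nonneg _] at h0
  exact eq_zero_of_forall_apply_eq_zero h fun i => mul_self_eq_zero.1 (h0 i (Finset.mem_univ i))

lemma weightedForm_top (α : ι → Dual ℝ V) (ξ : ι → ℝ) (x y : V) :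
    weightedForm α ξ ⊤ x y = ∑ i, ξ i * α i x * α i y := by
  simp [weightedForm]

lemma weightedForm_eq_sum_ite (α : ι → Dual ℝ V) (ξ : ι → ℝ) (P : Submodule ℝ (Dual ℝ V))
    (x y : V) :
    weightedForm α ξ P x y = ∑ i, if α i ∈ P then ξ i * α i x * α i y else 0 := by
  rw [weightedForm, Finset.sum_filter]

variable [FiniteDimensional ℝ V]

lemma canonicalMap_bijective {α : ι → Dual ℝ V}
    (h : Submodule.span ℝ (Set.range α) = ⊤) : Function.Bijective (canonicalMap α) :=
  ⟨canonicalMap_injective h, (LinearMap.injective_iff_surjective_of_finrank_eq_finrank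
    (Subspace.dual_finrank_eq).symm).1 (canonicalMap_injective h)⟩

lemma canonicalMap_vee {α : ι → Dual ℝ V} (h : Submodule.span ℝ (Set.range α) = ⊤)
    (f : Dual ℝ V) : canonicalMap α (vee α f) = f :=
  Function.rightInverse_invFun (canonicalMap_bijective h).2 f

lemma vee_eq_of_canonicalMap_eq {α : ι → Dual ℝ V} (h : Submodule.span ℝ (Set.range α) = ⊤)
    {f : Dual ℝ V} {x : V} (hx : canonicalMap α x = f) : vee α f = x :=
  canonicalMap_injective h (by rw [canonicalMap_vee h, hx])

lemma vee_add {α : ι → Dual ℝ V} (h : Submodule.span ℝ (Set.range α) = ⊤) (f g : Dual ℝ V) :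
    vee α (f + g) = vee α f + vee α g :=
  vee_eq_of_canonicalMap_eq h (by simp [canonicalMap_vee h])

lemma vee_smul {α : ι → Dual ℝ V} (h : Submodule.span ℝ (Set.range α) = ⊤) (c : ℝ)
    (f : Dual ℝ V) : vee α (c • f) = c • vee α f :=
  vee_eq_of_canonicalMap_eq h (by simp [canonicalMap_vee h])

lemma sum_apply_vee_mul {α : ι → Dual ℝ V} (h : Submodule.span ℝ (Set.range α) = ⊤)
    (f : Dual ℝ V) (x : V) : ∑ i, α i (vee α f) * α i x = f x := by
  rw [← canonicalMap_apply_apply, canonicalMap_vee h]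

lemma apply_vee_comm {α : ι → Dual ℝ V} (h : Submodule.span ℝ (Set.range α) = ⊤)
    (f g : Dual ℝ V) : f (vee α g) = g (vee α f) := by
  conv_lhs => rw [← canonicalMap_vee h f]
  rw [canonicalMap_symm, canonicalMap_vee h]

lemma apply_vee_self_pos {α : ι → Dual ℝ V} (h : Submodule.span ℝ (Set.range α) = ⊤)
    {f : Dual ℝ V} (hf : f ≠ 0) : 0 < f (vee α f) := by
  rw [← sum_apply_vee_mul h f (vee α f)]
  refine lt_of_le_of_ne (Finset.sum_nonneg fun i _ => mul_self_nonneg _) fun h0 => hf ?_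
  rw [eq_comm, Finset.sum_eq_zero_iff_of_nonneg fun i _ => mul_self_nonneg _] at h0
  have := eq_zero_of_forall_apply_eq_zero h
    fun i => mul_self_eq_zero.1 (h0 i (Finset.mem_univ i))
  rw [← canonicalMap_vee h f, this, map_zero]

/-- The vee-condition, moved from `V` to `V*` by means of the isomorphism `φ`. -/
lemma sum_smul_vee_eq_iff {α : ι → Dual ℝ V} (h : Submodule.span ℝ (Set.range α) = ⊤)
    (P : Submodule ℝ (Dual ℝ V)) (f : Dual ℝ V) (ν : ℝ) :
    ∑ j with α j ∈ P, α j (vee α f) • vee α (α j) = ν • vee α f ↔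
      ∑ j with α j ∈ P, α j (vee α f) • α j = ν • f := by
  rw [← (canonicalMap_injective h).eq_iff]
  simp [canonicalMap_vee h]

/-- Vee-systems are preserved by linear automorphisms of `V*`. -/
lemma IsVeeSystem.map {α : ι → Dual ℝ V} (hα : IsVeeSystem α) (g : Dual ℝ V ≃ₗ[ℝ] Dual ℝ V) :
    IsVeeSystem fun i => g (α i) := by
  have hs : Submodule.span ℝ (Set.range fun i => g (α i)) = ⊤ := by
    have : Set.range (fun i => g (α i)) = (g : Dual ℝ V →ₗ[ℝ] Dual ℝ V) '' Set.range α := by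
      rw [← Set.range_comp]; rfl
    rw [this, Submodule.span_image, hα.span_eq_top, Submodule.map_top, LinearEquiv.range]
  -- the transpose of `g`, as an automorphism of `V`
  let g' : V ≃ₗ[ℝ] V := (evalEquiv ℝ V).trans (g.dualMap.trans (evalEquiv ℝ V).symm)
  have hg' : ∀ (f : Dual ℝ V) (x : V), f (g' x) = g f x := by
    intro f x
    have : evalEquiv ℝ V (g' x) = g.dualMap (evalEquiv ℝ V x) := by simp [g']
    have h2 := LinearMap.congr_fun this f
    simpa using h2
  have hvee : ∀ f, vee (fun i => g (α i)) (g f) = g'.symm (vee α f) := by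
    intro f
    apply vee_eq_of_canonicalMap_eq hs
    rw [canonicalMap_apply]
    simp_rw [← hg', LinearEquiv.apply_symm_apply]
    simp_rw [← map_smul, ← map_sum]
    rw [← canonicalMap_apply, canonicalMap_vee hα.span_eq_top]
  refine ⟨g.injective.comp hα.injective, hs, fun P hP i hi => ?_⟩
  have hPg : ∀ f, g f ∈ P ↔ f ∈ P.comap (g : Dual ℝ V →ₗ[ℝ] Dual ℝ V) := fun f => Iff.rfl
  obtain ⟨ν, hν⟩ := hα.vee_condition (P.comap (g : Dual ℝ V →ₗ[ℝ] Dual ℝ V))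
    (by
      rw [← hP]
      have := LinearEquiv.finrank_eq (g.submoduleMap (P.comap (g : Dual ℝ V →ₗ[ℝ] Dual ℝ V)))
      rw [this, Submodule.map_comap_eq_of_surjective g.surjective]) i hi
  refine ⟨ν, ?_⟩
  simp_rw [hvee, ← hg', LinearEquiv.apply_symm_apply, hPg, ← map_smul, ← map_sum, hν]

end Basic

/-! ### Infinitesimal rigidity under scaling implies local rigidity -/

section Scaling

variable {V ι : Type*} [AddCommGroup V] [Module ℝ V] [Fintype ι] [FiniteDimensional ℝ V]

/-- In a plane with more than two covectors, no two of them proportional, the coefficients `ν` of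
the vee-conditions agree: `f ↦ ∑ α j (f^∨) α j` is a scalar operator on the plane. -/
lemma IsVeeSystem.exists_scalar {α : ι → Dual ℝ V} (hα : IsVeeSystem α)
    (hli : ∀ i j, i ≠ j → LinearIndependent ℝ ![α i, α j])
    {P : Submodule ℝ (Dual ℝ V)} (hP : finrank ℝ P = 2) (hc : 2 < {k | α k ∈ P}.ncard) :
    ∃ ν : ℝ, ∀ f ∈ P, ∑ j with α j ∈ P, α j (vee α f) • α j = ν • f := by
  have hs := hα.span_eq_top
  obtain ⟨i, j, k, hi, hj, hk, hij, hik, hjk⟩ := (Set.two_lt_ncard_iff (Set.toFinite _)).1 hc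
  simp only [Set.mem_ofPred_eq] at hi hj hk
  have hcond : ∀ l, α l ∈ P → ∃ ν : ℝ, ∑ j with α j ∈ P, α j (vee α (α l)) • α j = ν • α l :=
    fun l hl => (hα.vee_condition P hP l hl).imp fun ν hν => (sum_smul_vee_eq_iff hs P _ ν).1 hν
  obtain ⟨νi, hνi⟩ := hcond i hi
  obtain ⟨νj, hνj⟩ := hcond j hj
  obtain ⟨νk, hνk⟩ := hcond k hk
  -- `α i`, `α j` span the plane
  have hspan : Submodule.span ℝ {α i, α j} = P := by
    have hle : Submodule.span ℝ {α i, α j} ≤ P := by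
      rw [Submodule.span_le]; rintro x (rfl | rfl) <;> assumption
    refine Submodule.eq_of_le_of_finrank_eq hle ?_
    have := finrank_span_eq_card (hli i j hij)
    have hr : Set.range ![α i, α j] = {α i, α j} := by
      ext x; simp [or_comm]
    rw [hP, ← hr]
    simpa using this
  have key : ∀ a b : ℝ, ∑ l with α l ∈ P, α l (vee α (a • α i + b • α j)) • α l
      = (a * νi) • α i + (b * νj) • α j := by
    intro a b
    simp only [vee_add hs, vee_smul hs, map_add, map_smul, smul_eq_mul, add_smul,
      Finset.sum_add_distrib, mul_smul, ← Finset.smul_sum, hνi, hνj]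
  obtain ⟨a, b, hab⟩ := Submodule.mem_span_pair.1 (hspan ▸ hk)
  have hlij := LinearIndependent.pair_iff.1 (hli i j hij)
  have ha : a ≠ 0 := by
    rintro rfl
    have := (LinearIndependent.pair_iff.1 (hli j k hjk)) b (-1) (by rw [← hab]; module)
    norm_num at this
  have hb : b ≠ 0 := by
    rintro rfl
    have := (LinearIndependent.pair_iff.1 (hli i k hik)) a (-1) (by rw [← hab]; module)
    norm_num at this
  have hk' := key a b
  rw [hab, hνk, ← hab] at hk'
  have := hlij (a * (νi - νk)) (b * (νj - νk))
    (by linear_combination (norm := module) (-1 : ℝ) • hk')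
  have h1 : νi = νk := by
    have := (mul_eq_zero.1 this.1).resolve_left ha; linarith
  have h2 : νj = νk := by
    have := (mul_eq_zero.1 this.2).resolve_left hb; linarith
  refine ⟨νk, fun f hf => ?_⟩
  obtain ⟨c, d, rfl⟩ := Submodule.mem_span_pair.1 (hspan ▸ hf)
  rw [key, h1, h2]; module

/-- If a plane contains just two covectors of a vee-system, then they are orthogonal. -/
lemma IsVeeSystem.apply_vee_eq_zero {α : ι → Dual ℝ V} (hα : IsVeeSystem α)
    {i j : ι} (hli : LinearIndependent ℝ ![α i, α j])
    {P : Submodule ℝ (Dual ℝ V)} (hP : finrank ℝ P = 2)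
    (hij : i ≠ j) (hc : ∀ k, α k ∈ P ↔ k = i ∨ k = j) : α j (vee α (α i)) = 0 := by
  obtain ⟨ν, hν⟩ := hα.vee_condition P hP i ((hc i).2 (Or.inl rfl))
  rw [sum_smul_vee_eq_iff hα.span_eq_top] at hν
  have : (Finset.univ.filter fun k => α k ∈ P) = {i, j} := by
    ext k; simp [hc]
  rw [this, Finset.sum_pair hij] at hν
  exact (LinearIndependent.pair_iff.1 hli (α i (vee α (α i)) - ν) _
    (by linear_combination (norm := module) (1 : ℝ) • hν)).2

lemma sum_sub_one_mul {α : ι → Dual ℝ V} {ρ : ι → ℝ}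
    (hα : Submodule.span ℝ (Set.range α) = ⊤)
    (hβ : Submodule.span ℝ (Set.range fun i => ρ i • α i) = ⊤) (f h : Dual ℝ V) :
    ∑ k, (ρ k ^ 2 - 1) * α k (vee (fun i => ρ i • α i) f) * α k (vee α h)
      = f (vee α h) - h (vee (fun i => ρ i • α i) f) := by
  have h1 := sum_apply_vee_mul hβ f (vee α h)
  have h2 := sum_apply_vee_mul hα h (vee (fun i => ρ i • α i) f)
  rw [← h1, ← h2, ← Finset.sum_sub_distrib]
  refine Finset.sum_congr rfl fun k _ => ?_
  simp only [LinearMap.smul_apply, smul_eq_mul]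
  ring

/-- If both `α` and `ρ α` are vee-systems, then `ρ² - 1` satisfies exactly a perturbed form of the
linearised vee-conditions, in which one of the two isomorphisms `V* → V` is that of `ρ α`. -/
lemma weighted_sub_one_eq {α : ι → Dual ℝ V} {ρ : ι → ℝ}
    (hα : Submodule.span ℝ (Set.range α) = ⊤)
    (hβ : Submodule.span ℝ (Set.range fun i => ρ i • α i) = ⊤) (hρ : ∀ i, ρ i ≠ 0)
    {P : Submodule ℝ (Dual ℝ V)} {ν ν' : ℝ} {f h : Dual ℝ V}
    (hν : ∑ j with α j ∈ P, α j (vee α h) • α j = ν • h)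
    (hν' : ∑ j with ρ j • α j ∈ P, (ρ j • α j) (vee (fun i => ρ i • α i) f) • (ρ j • α j)
      = ν' • f) :
    weightedForm α (fun k => ρ k ^ 2 - 1) P (vee (fun i => ρ i • α i) f) (vee α h)
      - ν * weightedForm α (fun k => ρ k ^ 2 - 1) ⊤ (vee (fun i => ρ i • α i) f) (vee α h)
      = (ν' - ν) * f (vee α h) := by
  rw [weightedForm_top, sum_sub_one_mul hα hβ]
  have h1 := LinearMap.congr_fun hν (vee (fun i => ρ i • α i) f)
  have h2 := LinearMap.congr_fun hν' (vee α h)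
  have hm : ∀ j, ρ j • α j ∈ P ↔ α j ∈ P := fun j => P.smul_mem_iff (hρ j)
  simp only [hm, LinearMap.sum_apply, LinearMap.smul_apply, smul_eq_mul] at h1 h2
  have h3 : weightedForm α (fun k => ρ k ^ 2 - 1) P (vee (fun i => ρ i • α i) f) (vee α h)
      = ν' * f (vee α h) - ν * h (vee (fun i => ρ i • α i) f) := by
    rw [← h1, ← h2, ← Finset.sum_sub_distrib, weightedForm]
    refine Finset.sum_congr rfl fun k _ => ?_
    ring
  rw [h3]; ring

/-- The isomorphism `f ↦ f^∨` of `ρ α` depends continuously on the scaling factors `ρ`. -/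
lemma tendsto_apply_vee_smul {α : ι → Dual ℝ V} (hα : Submodule.span ℝ (Set.range α) = ⊤)
    {u : ℕ → ι → ℝ} (hu : Tendsto u atTop (𝓝 1))
    (hβ : ∀ n, Submodule.span ℝ (Set.range fun i => u n i • α i) = ⊤) (f ψ : Dual ℝ V) :
    Tendsto (fun n => ψ (vee (fun i => u n i • α i) f)) atTop (𝓝 (ψ (vee α f))) := by
  let b := Module.finBasis ℝ V
  let M : (ι → ℝ) → Matrix _ _ ℝ := fun ρ => LinearMap.toMatrix b b.dualBasis
    (canonicalMap fun i => ρ i • α i)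
  have hM : Continuous M := by
    refine continuous_matrix fun k l => ?_
    simp only [M, LinearMap.toMatrix_apply, Basis.dualBasis_repr, canonicalMap_apply_apply,
      LinearMap.smul_apply]
    fun_prop
  have h1 : (fun i => (1 : ι → ℝ) i • α i) = α := by simp
  -- Cramer's rule for the matrix of the canonical form
  have hC : ∀ ρ : ι → ℝ, Submodule.span ℝ (Set.range fun i => ρ i • α i) = ⊤ →
      (M ρ).det ≠ 0 ∧ ψ (vee (fun i => ρ i • α i) f) = ((M ρ).det)⁻¹ *
        ∑ k, ψ (b k) * ((M ρ).adjugate.mulVec (b.dualBasis.repr f) k) := by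
    intro ρ hρ
    have hdet : (M ρ).det ≠ 0 := by
      let e := LinearEquiv.ofBijective _ (canonicalMap_bijective hρ)
      have := LinearEquiv.isUnit_det e b b.dualBasis
      exact this.ne_zero
    refine ⟨hdet, ?_⟩
    have hx : (M ρ).mulVec (b.repr (vee (fun i => ρ i • α i) f)) = b.dualBasis.repr f := by
      rw [LinearMap.toMatrix_mulVec_repr, canonicalMap_vee hρ]
    have hψ : ∀ x, ψ x = ∑ k, ψ (b k) * b.repr x k := by
      intro x
      conv_lhs => rw [← b.sum_repr x]
      simp only [map_sum, map_smul, smul_eq_mul, mul_comm]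
    rw [hψ, ← hx, Matrix.mulVec_mulVec, Matrix.adjugate_mul, Matrix.smul_mulVec,
      Matrix.one_mulVec, Finset.mul_sum]
    refine Finset.sum_congr rfl fun k _ => ?_
    simp only [Pi.smul_apply, smul_eq_mul]
    field_simp
  have h10 := hC 1 (by rw [h1]; exact hα)
  rw [h1] at h10
  rw [h10.2]
  simp_rw [fun n => (hC (u n) (hβ n)).2]
  refine Tendsto.mul (Tendsto.inv₀ ?_ h10.1) ?_
  · exact (hM.matrix_det.tendsto 1).comp hu
  · have : Continuous fun ρ => ∑ k, ψ (b k) * ((M ρ).adjugate.mulVec (b.dualBasis.repr f) k) := by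
      have := hM.matrix_adjugate
      simp only [Matrix.mulVec, dotProduct]
      fun_prop
    exact (this.tendsto 1).comp hu

/-- A vee-system whose linearised vee-conditions have only the constant solutions is locally rigid
under scaling. If not, there would be vee-systems `ρ α` with `ρ → 1`, `ρ ≠ 1`, and `ρ² - 1`,
rescaled to norm one, would accumulate at a non-constant solution of the linearised vee-conditions.
-/
lemma eventually_eq_one_of_isVeeSystem {α : ι → Dual ℝ V} (hα : IsVeeSystem α)
    (hli : ∀ i j, i ≠ j → LinearIndependent ℝ ![α i, α j])
    (hlin : ∀ ξ : ι → ℝ, LinearisedVeeConditions α ξ → ∃ c : ℝ, ∀ i, ξ i = c) (i₀ : ι) :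
    ∀ᶠ ρ : ι → ℝ in 𝓝 1, ρ i₀ = 1 → IsVeeSystem (fun i => ρ i • α i) → ρ = 1 := by
  by_contra hcon
  have hs := hα.span_eq_top
  have hpos : ∀ᶠ ρ : ι → ℝ in 𝓝 1, ∀ i, 0 < ρ i := by
    rw [Filter.eventually_all]
    intro i
    exact (continuous_apply i).continuousAt.eventually (lt_mem_nhds (by simp))
  obtain ⟨u, hu, hu'⟩ := Filter.exists_seq_forall_of_frequently
    ((Filter.not_eventually.1 hcon).and_eventually hpos)
  simp only [Classical.not_imp] at hu'
  have hu0 : ∀ n i, 0 < u n i := fun n => (hu' n).2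
  have hβ : ∀ n, IsVeeSystem fun i => u n i • α i := fun n => (hu' n).1.2.1
  have hβs := fun n => (hβ n).span_eq_top
  have hβli : ∀ n i j, i ≠ j → LinearIndependent ℝ ![u n i • α i, u n j • α j] := by
    intro n i j hij
    have := (hli i j hij).units_smul ![Units.mk0 _ (hu0 n i).ne', Units.mk0 _ (hu0 n j).ne']
    convert this using 1
    ext k; fin_cases k <;> rfl
  -- the perturbations `ρ² - 1` and their normalisations
  let ξ : ℕ → ι → ℝ := fun n k => u n k ^ 2 - 1
  have hξ : ∀ n, ξ n ≠ 0 := by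
    intro n h0
    refine (hu' n).1.2.2 (funext fun i => ?_)
    have : u n i ^ 2 - 1 = 0 := congrFun h0 i
    have h2 : (u n i - 1) * (u n i + 1) = 0 := by linarith
    have := (mul_eq_zero.1 h2).resolve_right (by linarith [hu0 n i])
    simpa using sub_eq_zero.1 this
  have hnorm : ∀ n, 0 < ‖ξ n‖ := fun n => norm_pos_iff.2 (hξ n)
  let ζ : ℕ → ι → ℝ := fun n => ‖ξ n‖⁻¹ • ξ n
  obtain ⟨z, hz, φ, hφ, hlim⟩ := (isCompact_sphere (0 : ι → ℝ) 1).tendsto_subseq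
    (x := ζ) (fun n => by
      simp [ζ, norm_smul, (hnorm n).ne'])
  have hlimk : ∀ k, Tendsto (fun n => ζ (φ n) k) atTop (𝓝 (z k)) :=
    fun k => ((continuous_apply k).tendsto z).comp hlim
  have hvee : ∀ f ψ : Dual ℝ V, Tendsto (fun n => ψ (vee (fun i => u (φ n) i • α i) f)) atTop
      (𝓝 (ψ (vee α f))) := fun f ψ =>
    tendsto_apply_vee_smul hs (hu.comp hφ.tendsto_atTop) (fun n => hβs (φ n)) f ψ
  have hW : ∀ (P : Submodule ℝ (Dual ℝ V)) (f h : Dual ℝ V), Tendsto (fun n =>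
      weightedForm α (ζ (φ n)) P (vee (fun i => u (φ n) i • α i) f) (vee α h)) atTop
      (𝓝 (weightedForm α z P (vee α f) (vee α h))) := by
    intro P f h
    unfold weightedForm
    exact tendsto_finsetSum _ fun k _ => ((hlimk k).mul (hvee f (α k))).mul_const _
  have hζ : ∀ (P : Submodule ℝ (Dual ℝ V)) n (x y : V),
      weightedForm α (ζ n) P x y = ‖ξ n‖⁻¹ * weightedForm α (ξ n) P x y := by
    intro P n x y
    simp only [weightedForm, ζ, Finset.mul_sum, Pi.smul_apply, smul_eq_mul, mul_assoc]
  have hmem : ∀ n (P : Submodule ℝ (Dual ℝ V)) j, u n j • α j ∈ P ↔ α j ∈ P :=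
    fun n P j => P.smul_mem_iff (hu0 n j).ne'
  have hzlin : LinearisedVeeConditions α z := by
    constructor
    · intro P hP i j hij hc
      refine tendsto_nhds_unique (hW ⊤ (α i) (α j)) ?_
      have h0 : ∀ n, weightedForm α (ζ (φ n)) ⊤
          (vee (fun i => u (φ n) i • α i) (α i)) (vee α (α j)) = 0 := by
        intro n
        rw [hζ, weightedForm_top]
        have h1 := sum_sub_one_mul hs (hβs (φ n)) (α i) (α j)
        have h2 := hα.apply_vee_eq_zero (hli i j hij) hP hij hc
        have h3 := (hβ (φ n)).apply_vee_eq_zero (hβli (φ n) i j hij) hP hij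
          (fun k => by rw [hmem]; exact hc k)
        rw [vee_smul (hβs (φ n))] at h3
        simp only [LinearMap.smul_apply, map_smul, smul_eq_mul] at h3
        rw [apply_vee_comm hs] at h2
        have h4 : α j (vee (fun i => u (φ n) i • α i) (α i)) = 0 := by
          have := (hu0 (φ n) i).ne'
          have := (hu0 (φ n) j).ne'
          simp_all
        rw [h2, h4, sub_zero] at h1
        have h1' : ∑ k, ξ (φ n) k * α k (vee (fun i => u (φ n) i • α i) (α i)) *
            α k (vee α (α j)) = 0 := h1
        rw [h1', mul_zero]
      simp only [h0]
      exact tendsto_const_nhds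
    · intro P hP hc
      obtain ⟨ν, hν⟩ := hα.exists_scalar hli hP hc
      refine ⟨ν, fun i hi v => ?_, ?_⟩
      · have h1 := LinearMap.congr_fun (hν _ hi) v
        rw [weightedForm_top]
        simp only [weightedForm, Pi.one_apply, one_mul]
        rw [sum_apply_vee_mul hs]
        simpa [LinearMap.sum_apply] using h1
      · have hν' : ∀ n, ∃ ν' : ℝ, ∀ f ∈ P, ∑ j with u n j • α j ∈ P,
            (u n j • α j) (vee (fun i => u n i • α i) f) • (u n j • α j) = ν' • f := fun n =>
          (hβ n).exists_scalar (hβli n) hP (by simpa only [hmem] using hc)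
        choose ν' hν' using hν'
        have heq : ∀ n, ∀ f ∈ P, ∀ h ∈ P,
            weightedForm α (ζ n) P (vee (fun i => u n i • α i) f) (vee α h)
            - ν * weightedForm α (ζ n) ⊤ (vee (fun i => u n i • α i) f) (vee α h)
            = (‖ξ n‖⁻¹ * (ν' n - ν)) * f (vee α h) := by
          intro n f hf h hh
          have := weighted_sub_one_eq hs (hβs n) (fun i => (hu0 n i).ne') (hν h hh) (hν' n f hf)
          rw [hζ, hζ, mul_assoc, ← this]
          ring
        -- the factors of proportionality converge, as is seen at one covector of the plane
        obtain ⟨i, hi⟩ : {k | α k ∈ P}.Nonempty := by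
          rw [← Set.ncard_pos (Set.toFinite _)]; omega
        have hne : α i ≠ 0 := by
          obtain ⟨j, hj⟩ : ∃ j, j ≠ i := by
            obtain ⟨a, b, _, _, _, _, hab, _, _⟩ := (Set.two_lt_ncard_iff (Set.toFinite _)).1 hc
            by_cases h : a = i
            · exact ⟨b, fun h' => hab (h.trans h'.symm)⟩
            · exact ⟨a, h⟩
          exact (hli i j hj.symm).ne_zero 0
        have hpos := apply_vee_self_pos hs hne
        refine ⟨(weightedForm α z P (vee α (α i)) (vee α (α i))
          - ν * weightedForm α z ⊤ (vee α (α i)) (vee α (α i))) / α i (vee α (α i)), ?_⟩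
        intro f hf h hh
        have hG : weightedForm α 1 ⊤ (vee α f) (vee α h) = f (vee α h) := by
          rw [weightedForm_top]; simp [sum_apply_vee_mul hs]
        rw [hG]
        have hc' : Tendsto (fun n => ‖ξ (φ n)‖⁻¹ * (ν' (φ n) - ν)) atTop
            (𝓝 ((weightedForm α z P (vee α (α i)) (vee α (α i))
          - ν * weightedForm α z ⊤ (vee α (α i)) (vee α (α i))) / α i (vee α (α i)))) := by
          have := ((hW P (α i) (α i)).sub ((hW ⊤ (α i) (α i)).const_mul ν)).div_const
            (α i (vee α (α i)))
          refine this.congr fun n => ?_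
          rw [heq (φ n) _ hi _ hi, mul_div_cancel_right₀ _ hpos.ne']
        refine tendsto_nhds_unique ((hW P f h).sub ((hW ⊤ f h).const_mul ν)) ?_
        refine (hc'.mul_const (f (vee α h))).congr fun n => ?_
        rw [heq (φ n) f hf h hh]
  obtain ⟨c, hc⟩ := hlin z hzlin
  have hz0 : z i₀ = 0 := by
    refine tendsto_nhds_unique (hlimk i₀) ?_
    have : ∀ n, ζ (φ n) i₀ = 0 := fun n => by simp [ζ, ξ, (hu' (φ n)).1.1]
    simp only [this]
    exact tendsto_const_nhds
  have : z = 0 := funext fun i => by rw [hc i, ← hc i₀, hz0]; rfl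
  simp [this] at hz

end Scaling

section Interval

variable {V ι : Type*} [AddCommGroup V] [Module ℝ V] [Fintype ι] [FiniteDimensional ℝ V]

/-- Along an interval, local rigidity under scaling becomes global: the parameters at which all
scaling factors are one form a clopen set. -/
lemma eq_one_of_continuousOn {α : ι → Dual ℝ V} (hα : IsVeeSystem α)
    (hli : ∀ i j, i ≠ j → LinearIndependent ℝ ![α i, α j])
    (hlin : ∀ ξ : ι → ℝ, LinearisedVeeConditions α ξ → ∃ c : ℝ, ∀ i, ξ i = c) (i₀ : ι)
    {I : Set ℝ} (hI : IsPreconnected I) {t₀ : ℝ} (ht₀ : t₀ ∈ I) {ρ : ℝ → ι → ℝ}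
    (hρ : ∀ i, ContinuousOn (fun t => ρ t i) I) (h0 : ρ t₀ = 1) (hi₀ : ∀ t ∈ I, ρ t i₀ = 1)
    (hv : ∀ t ∈ I, IsVeeSystem fun i => ρ t i • α i) : ∀ t ∈ I, ρ t = 1 := by
  have : PreconnectedSpace I := Subtype.preconnectedSpace hI
  let f : I → ι → ℝ := fun t => ρ t
  have hf : Continuous f := by
    have : ContinuousOn ρ I := continuousOn_pi.2 hρ
    exact continuousOn_iff_continuous_domRestrict.1 this
  have hclosed : IsClosed (f ⁻¹' {1}) := isClosed_singleton.preimage hf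
  have hopen : IsOpen (f ⁻¹' {1}) := by
    rw [isOpen_iff_mem_nhds]
    intro t ht
    have h1 : f t = 1 := ht
    have := (h1 ▸ hf.tendsto t).eventually (eventually_eq_one_of_isVeeSystem hα hli hlin i₀)
    filter_upwards [this] with s hs
    exact hs (hi₀ s s.2) (hv s s.2)
  have huniv := IsClopen.eq_univ ⟨hclosed, hopen⟩ ⟨⟨t₀, ht₀⟩, h0⟩
  intro t ht
  have : (⟨t, ht⟩ : I) ∈ f ⁻¹' {1} := huniv ▸ Set.mem_univ _
  exact this

end Interval

/-! ### Triples of coordinates -/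

/-- Coordinates in a three-dimensional space. -/
@[ext] structure Triple (R : Type*) where
  /-- The first coordinate. -/
  x : R
  /-- The second coordinate. -/
  y : R
  /-- The third coordinate. -/
  z : R

namespace Triple

variable {R : Type*}

/-- The standard scalar product. -/
def dot [Add R] [Mul R] (u v : Triple R) : R := u.x * v.x + u.y * v.y + u.z * v.z

/-- The cross product. -/
def cross [Sub R] [Mul R] (u v : Triple R) : Triple R :=
  ⟨u.y * v.z - u.z * v.y, u.z * v.x - u.x * v.z, u.x * v.y - u.y * v.x⟩

/-- The determinant of three triples. -/
def det [Add R] [Sub R] [Mul R] (u v w : Triple R) : R := dot (cross u v) w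

/-- Multiplication by a scalar. -/
def smul [Mul R] (s : R) (u : Triple R) : Triple R := ⟨s * u.x, s * u.y, s * u.z⟩

/-- The zero vector. -/
def zero [Zero R] : Triple R := ⟨0, 0, 0⟩

/-- Two vectors span the same line. -/
def Par (u v : Triple ℝ) : Prop := ∃ s : ℝ, s ≠ 0 ∧ u = smul s v

lemma Par.trans {u v w : Triple ℝ} (h : Par u v) (h' : Par v w) : Par u w := by
  obtain ⟨s, hs, rfl⟩ := h
  obtain ⟨s', hs', rfl⟩ := h'
  exact ⟨s * s', mul_ne_zero hs hs', by simp [smul, mul_assoc]⟩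

lemma Par.symm {u v : Triple ℝ} (h : Par u v) : Par v u := by
  obtain ⟨s, hs, rfl⟩ := h
  exact ⟨s⁻¹, inv_ne_zero hs, by simp [smul, hs]⟩

lemma eq_smul_of_cross_eq_zero {u v : Triple ℝ} (hv : v ≠ zero) (h : cross u v = zero) :
    ∃ s : ℝ, u = smul s v := by
  obtain ⟨h1, h2, h3⟩ : u.y * v.z - u.z * v.y = 0 ∧ u.z * v.x - u.x * v.z = 0 ∧
      u.x * v.y - u.y * v.x = 0 := by simpa [cross, zero] using h
  by_cases hx : v.x = 0
  · by_cases hy : v.y = 0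
    · have hz : v.z ≠ 0 := fun hz => hv (Triple.ext hx hy hz)
      refine ⟨u.z / v.z, Triple.ext ?_ ?_ ?_⟩ <;> simp only [smul] <;> field_simp <;> linarith
    · refine ⟨u.y / v.y, Triple.ext ?_ ?_ ?_⟩ <;> simp only [smul] <;> field_simp <;> linarith
  · refine ⟨u.x / v.x, Triple.ext ?_ ?_ ?_⟩ <;> simp only [smul] <;> field_simp <;> linarith

lemma par_of_cross_eq_zero {u v : Triple ℝ} (hu : u ≠ zero) (hv : v ≠ zero)
    (h : cross u v = zero) : Par u v := by
  obtain ⟨s, hs⟩ := eq_smul_of_cross_eq_zero hv h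
  refine ⟨s, fun h0 => hu ?_, hs⟩
  rw [hs, h0]; simp [smul, zero]

lemma cross_eq_zero_of_eq_smul {s : ℝ} {u v : Triple ℝ} (h : u = smul s v) :
    cross u v = zero := by
  subst h
  ext <;> simp only [cross, smul, zero] <;> ring

/-- The planes with normal vectors `m` and `n`, if distinct, have only one line in common. -/
lemma par_of_dot_eq_zero {m n u v : Triple ℝ} (hmn : cross m n ≠ zero) (hu : u ≠ zero)
    (hv : v ≠ zero) (hmu : dot m u = 0) (hnu : dot n u = 0) (hmv : dot m v = 0)
    (hnv : dot n v = 0) : Par u v := by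
  have key : ∀ w, w ≠ zero → dot m w = 0 → dot n w = 0 → Par w (cross m n) := by
    intro w hw h1 h2
    refine par_of_cross_eq_zero hw hmn ?_
    simp only [dot] at h1 h2
    ext <;> simp only [cross, zero]
    · linear_combination m.x * h2 - n.x * h1
    · linear_combination m.y * h2 - n.y * h1
    · linear_combination m.z * h2 - n.z * h1
  exact (key u hu hmu hnu).trans (key v hv hmv hnv).symm

lemma det_smul (r s t : ℝ) (u v w : Triple ℝ) :
    det (smul r u) (smul s v) (smul t w) = r * s * t * det u v w := by
  simp only [det, dot, cross, smul]; ring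

lemma dot_self_pos {u : Triple ℝ} (hu : u ≠ zero) : 0 < dot u u := by
  refine lt_of_le_of_ne (add_nonneg (add_nonneg
    (mul_self_nonneg _) (mul_self_nonneg _)) (mul_self_nonneg _)) fun h => hu ?_
  simp only [dot] at h
  have h1 := mul_self_nonneg u.x
  have h2 := mul_self_nonneg u.y
  have h3 := mul_self_nonneg u.z
  exact Triple.ext (mul_self_eq_zero.1 (by linarith)) (mul_self_eq_zero.1 (by linarith))
    (mul_self_eq_zero.1 (by linarith))

/-- Cramer's rule. -/
lemma cramer {u v w : Triple ℝ} (h : det u v w ≠ 0) (q : Triple ℝ) :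
    q.x = det q v w / det u v w * u.x + det u q w / det u v w * v.x
      + det u v q / det u v w * w.x ∧
    q.y = det q v w / det u v w * u.y + det u q w / det u v w * v.y
      + det u v q / det u v w * w.y ∧
    q.z = det q v w / det u v w * u.z + det u q w / det u v w * v.z
      + det u v q / det u v w * w.z := by
  refine ⟨?_, ?_, ?_⟩ <;> field_simp <;> simp only [det, dot, cross] <;> ring

end Triple

/-! ### Covectors in a three-dimensional space -/

section Coordinates

variable {V : Type*} [AddCommGroup V] [Module ℝ V] (b : Basis (Fin 3) ℝ V)

/-- The coordinates of a covector: its values on the basis vectors. -/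
def coords (f : Dual ℝ V) : Triple ℝ := ⟨f (b 0), f (b 1), f (b 2)⟩

/-- The covector with given coordinates. -/
def covec (p : Triple ℝ) : Dual ℝ V := p.x • b.coord 0 + p.y • b.coord 1 + p.z • b.coord 2

lemma covec_apply_zero (p : Triple ℝ) : covec b p (b 0) = p.x := by simp [covec]
lemma covec_apply_one (p : Triple ℝ) : covec b p (b 1) = p.y := by simp [covec]
lemma covec_apply_two (p : Triple ℝ) : covec b p (b 2) = p.z := by simp [covec]

@[simp] lemma coords_covec (p : Triple ℝ) : coords b (covec b p) = p := by
  simp [coords, covec]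

lemma coords_injective : Function.Injective (coords b) := by
  intro f g h
  simp only [coords, Triple.mk.injEq] at h
  refine b.ext fun i => ?_
  fin_cases i
  exacts [h.1, h.2.1, h.2.2]

lemma coords_smul (c : ℝ) (f : Dual ℝ V) : coords b (c • f) = (coords b f).smul c := rfl

lemma covec_smul (c : ℝ) (p : Triple ℝ) : covec b (p.smul c) = c • covec b p :=
  coords_injective b (by rw [coords_smul]; simp)

lemma covec_eq_zero_iff {p : Triple ℝ} : covec b p = 0 ↔ p = Triple.zero := by
  rw [← (coords_injective b).eq_iff, coords_covec]
  rfl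

lemma linearIndependent_iff_det_ne_zero (f g h : Dual ℝ V) :
    LinearIndependent ℝ ![f, g, h] ↔ Triple.det (coords b f) (coords b g) (coords b h) ≠ 0 := by
  rw [← LinearMap.linearIndependent_iff (b.dualBasis.equivFun : Dual ℝ V →ₗ[ℝ] Fin 3 → ℝ)
    (LinearEquiv.ker _)]
  have : (b.dualBasis.equivFun : Dual ℝ V →ₗ[ℝ] Fin 3 → ℝ) ∘ ![f, g, h]
      = (Matrix.of ![![f (b 0), f (b 1), f (b 2)], ![g (b 0), g (b 1), g (b 2)],
        ![h (b 0), h (b 1), h (b 2)]]).row := by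
    ext i j
    fin_cases i <;> fin_cases j <;> simp
  rw [this, Matrix.linearIndependent_rows_iff_isUnit, Matrix.isUnit_iff_isUnit_det,
    isUnit_iff_ne_zero, Matrix.det_fin_three]
  simp only [Triple.det, Triple.dot, Triple.cross, coords, Matrix.of_apply, Matrix.cons_val_zero,
    Matrix.cons_val_one, Matrix.cons_val]
  ring_nf

lemma linearIndependent_pair_covec {p q : Triple ℝ} (h : p.cross q ≠ Triple.zero) :
    LinearIndependent ℝ ![covec b p, covec b q] := by
  rw [LinearIndependent.pair_iff]
  intro s t hst
  have e0 := LinearMap.congr_fun hst (b 0)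
  have e1 := LinearMap.congr_fun hst (b 1)
  have e2 := LinearMap.congr_fun hst (b 2)
  simp only [LinearMap.add_apply, LinearMap.smul_apply, smul_eq_mul, covec_apply_zero,
    covec_apply_one, covec_apply_two, LinearMap.zero_apply] at e0 e1 e2
  have key : ∀ s : ℝ, s * (p.y * q.z - p.z * q.y) = 0 → s * (p.z * q.x - p.x * q.z) = 0 →
      s * (p.x * q.y - p.y * q.x) = 0 → s = 0 := by
    intro s h1 h2 h3
    by_contra hs
    refine h (Triple.ext ?_ ?_ ?_)
    · exact (mul_eq_zero.1 h1).resolve_left hs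
    · exact (mul_eq_zero.1 h2).resolve_left hs
    · exact (mul_eq_zero.1 h3).resolve_left hs
  constructor
  · exact key s (by linear_combination q.z * e1 - q.y * e2)
      (by linear_combination q.x * e2 - q.z * e0) (by linear_combination q.y * e0 - q.x * e1)
  · exact key t (by linear_combination p.y * e2 - p.z * e1)
      (by linear_combination p.z * e0 - p.x * e2) (by linear_combination p.x * e1 - p.y * e0)

lemma det_eq_zero_iff_of_linearIndepOn_iff {ι : Type*} {α β : ι → Dual ℝ V}
    (h : ∀ S : Set ι, LinearIndepOn ℝ α S ↔ LinearIndepOn ℝ β S) (i j k : ι) :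
    Triple.det (coords b (α i)) (coords b (α j)) (coords b (α k)) = 0 ↔
      Triple.det (coords b (β i)) (coords b (β j)) (coords b (β k)) = 0 := by
  by_cases hinj : Function.Injective ![i, j, k]
  · have key : ∀ γ : ι → Dual ℝ V, LinearIndepOn ℝ γ (Set.range ![i, j, k]) ↔
        Triple.det (coords b (γ i)) (coords b (γ j)) (coords b (γ k)) ≠ 0 := by
      intro γ
      rw [linearIndepOn_range_iff hinj, ← linearIndependent_iff_det_ne_zero]
      have : γ ∘ ![i, j, k] = ![γ i, γ j, γ k] := by
        ext l : 1; fin_cases l <;> rfl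
      rw [this]
    have := h (Set.range ![i, j, k])
    rw [key, key] at this
    exact not_iff_not.1 this
  · have key : ∀ γ : ι → Dual ℝ V,
        Triple.det (coords b (γ i)) (coords b (γ j)) (coords b (γ k)) = 0 := by
      intro γ
      have : i = j ∨ i = k ∨ j = k := by
        by_contra hc
        push Not at hc
        apply hinj
        intro l m hlm
        fin_cases l <;> fin_cases m <;> simp_all
      rcases this with rfl | rfl | rfl <;> simp only [Triple.det, Triple.dot, Triple.cross] <;> ring
    simp [key]

end Coordinates

/-! ### Projective rigidity -/

section Projective

variable {ι : Type*}

/-- A continuous motion of vectors `q t i`, starting at the lines of the vectors `p i`, which keeps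
the linear matroid and the lines of the four vectors with indices `i₀, i₁, i₂, i₃`. Of the
coordinates, only `x` and `y` are required to be continuous. -/
structure IsFramedMotion (p : ι → Triple ℝ) (i₀ i₁ i₂ i₃ : ι) (I : Set ℝ)
    (q : ℝ → ι → Triple ℝ) : Prop where
  continuousOn_x : ∀ i, ContinuousOn (fun t => (q t i).x) I
  continuousOn_y : ∀ i, ContinuousOn (fun t => (q t i).y) I
  ne_zero : ∀ t ∈ I, ∀ i, q t i ≠ Triple.zero
  det_eq_zero_iff : ∀ t ∈ I, ∀ i j k,
    Triple.det (q t i) (q t j) (q t k) = 0 ↔ Triple.det (p i) (p j) (p k) = 0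
  frame : ∀ t ∈ I, (q t i₀).Par (p i₀) ∧ (q t i₁).Par (p i₁) ∧ (q t i₂).Par (p i₂) ∧
    (q t i₃).Par (p i₃)
  initial : ∀ i, (q 0 i).Par (p i)

/-- The lines spanned by the vectors `p i` cannot be moved without changing the linear matroid, if
the lines of the projective frame `i₀, i₁, i₂, i₃` are kept. -/
def IsProjectivelyRigid (p : ι → Triple ℝ) (i₀ i₁ i₂ i₃ : ι) : Prop :=
  ∀ ε : ℝ, 0 < ε → ∀ q, IsFramedMotion p i₀ i₁ i₂ i₃ (Set.Ioo (-ε) ε) q →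
    ∀ t ∈ Set.Ioo (-ε) ε, ∀ i, (q t i).Par (p i)

lemma Triple.Par.ne_zero {u v : Triple ℝ} (h : u.Par v) (hv : v ≠ Triple.zero) :
    u ≠ Triple.zero := by
  obtain ⟨s, hs, rfl⟩ := h
  intro h0
  simp only [smul, zero, Triple.mk.injEq, mul_eq_zero, hs, false_or] at h0
  exact hv (Triple.ext h0.1 h0.2.1 h0.2.2)

end Projective

section Deformation

variable {V ι : Type*} [AddCommGroup V] [Module ℝ V] [Fintype ι]

/-- The coefficients of `q` with respect to `u, v, w`, divided by those of `e`: the homogeneous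
coordinates of `q` in the projective frame `u, v, w, e`. -/
def frameCoords (u v w e q : Triple ℝ) : Triple ℝ :=
  ⟨Triple.det q v w / Triple.det e v w, Triple.det u q w / Triple.det u e w,
    Triple.det u v q / Triple.det u v e⟩

lemma det_frameCoords {u v w e : Triple ℝ} (h : Triple.det u v w ≠ 0) (hx : Triple.det e v w ≠ 0)
    (hy : Triple.det u e w ≠ 0) (hz : Triple.det u v e ≠ 0) (q r s : Triple ℝ) :
    Triple.det (frameCoords u v w e q) (frameCoords u v w e r) (frameCoords u v w e s) = 0 ↔
      Triple.det q r s = 0 := by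
  have key : ∀ a b c : Triple ℝ, Triple.det
      ⟨a.x * u.x + a.y * v.x + a.z * w.x, a.x * u.y + a.y * v.y + a.z * w.y,
        a.x * u.z + a.y * v.z + a.z * w.z⟩
      ⟨b.x * u.x + b.y * v.x + b.z * w.x, b.x * u.y + b.y * v.y + b.z * w.y,
        b.x * u.z + b.y * v.z + b.z * w.z⟩
      ⟨c.x * u.x + c.y * v.x + c.z * w.x, c.x * u.y + c.y * v.y + c.z * w.y,
        c.x * u.z + c.y * v.z + c.z * w.z⟩ = Triple.det a b c * Triple.det u v w := by
    intro a b c; simp only [Triple.det, Triple.dot, Triple.cross]; ring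
  let C : Triple ℝ → Triple ℝ := fun q =>
    ⟨q.det v w / u.det v w, u.det q w / u.det v w, u.det v q / u.det v w⟩
  have hC : ∀ q, q = (⟨(C q).x * u.x + (C q).y * v.x + (C q).z * w.x,
      (C q).x * u.y + (C q).y * v.y + (C q).z * w.y,
      (C q).x * u.z + (C q).y * v.z + (C q).z * w.z⟩ : Triple ℝ) := by
    intro q
    obtain ⟨h1, h2, h3⟩ := Triple.cramer h q
    exact Triple.ext h1 h2 h3
  have hq : Triple.det q r s = Triple.det (C q) (C r) (C s) * Triple.det u v w := by
    rw [← key, ← hC, ← hC, ← hC]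
  have hF : ∀ q, C q = ⟨(C e).x * (frameCoords u v w e q).x, (C e).y * (frameCoords u v w e q).y,
      (C e).z * (frameCoords u v w e q).z⟩ := by
    intro q
    simp only [C, frameCoords]
    ext <;> simp only <;> field_simp
  have hd : Triple.det (C q) (C r) (C s) = (C e).x * (C e).y * (C e).z *
      Triple.det (frameCoords u v w e q) (frameCoords u v w e r) (frameCoords u v w e s) := by
    rw [hF q, hF r, hF s]
    simp only [Triple.det, Triple.dot, Triple.cross]; ring
  have hne : (C e).x * (C e).y * (C e).z ≠ 0 :=
    mul_ne_zero (mul_ne_zero (div_ne_zero hx h) (div_ne_zero hy h)) (div_ne_zero hz h)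
  rw [hq, hd]
  simp [h, hne]

/-- In coordinates relative to its own first four covectors, a deformation keeps its frame, so that
projective rigidity keeps all its lines; hence it is a scaling deformation up to linear
automorphisms, and infinitesimal rigidity under scaling makes it trivial. -/
theorem isTrivialDeformation_of_rigid (b : Basis (Fin 3) ℝ V) {α : ι → Dual ℝ V}
    (hα : IsVeeSystem α)
    (hlin : ∀ ξ : ι → ℝ, LinearisedVeeConditions α ξ → ∃ c : ℝ, ∀ i, ξ i = c)
    {p : ι → Triple ℝ} {r : ι → ℝ} (hr : ∀ i, 0 < r i) (hαp : ∀ i, α i = r i • covec b (p i))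
    (hcross : ∀ i j, i ≠ j → (p i).cross (p j) ≠ Triple.zero)
    {i₀ i₁ i₂ i₃ : ι} (h₀ : p i₀ = ⟨1, 0, 0⟩) (h₁ : p i₁ = ⟨0, 1, 0⟩) (h₂ : p i₂ = ⟨0, 0, 1⟩)
    {κ : ℝ} (hκ : κ ≠ 0) (h₃ : p i₃ = ⟨κ, κ, κ⟩)
    (hproj : IsProjectivelyRigid p i₀ i₁ i₂ i₃)
    {k : WithTop ℕ∞} {ε : ℝ} (hε : 0 < ε) {A : ℝ → ι → Dual ℝ V} (hA : IsDeformation k ε α A) :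
    IsTrivialDeformation k ε α A := by
  have : FiniteDimensional ℝ V := b.finiteDimensional_of_finite
  set I := Set.Ioo (-ε) ε with hI
  have h0I : (0 : ℝ) ∈ I := ⟨by linarith, hε⟩
  have hli : ∀ i j, i ≠ j → LinearIndependent ℝ ![α i, α j] := by
    intro i j hij
    have := (linearIndependent_pair_covec b (hcross i j hij)).units_smul
      ![Units.mk0 _ (hr i).ne', Units.mk0 _ (hr j).ne']
    convert this using 1
    ext l : 1; fin_cases l <;> simp [hαp, Units.smul_def]
  have hpne : ∀ i, p i ≠ Triple.zero := by
    intro i h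
    have hij : ∃ j, j ≠ i := by
      by_cases hi : i = i₀
      · refine ⟨i₁, fun h' => ?_⟩
        rw [← h', h₁] at h
        simp [Triple.zero] at h
      · exact ⟨i₀, fun h' => hi h'.symm⟩
    obtain ⟨j, hj⟩ := hij
    apply hcross i j hj.symm
    rw [h]; simp [Triple.cross, Triple.zero]
  have hcα : ∀ i, coords b (α i) = (p i).smul (r i) := by
    intro i; rw [hαp, coords_smul, coords_covec]
  let a : ℝ → ι → Triple ℝ := fun t i => coords b (A t i)
  have hcont : ∀ i (x : V), ContinuousOn (fun t => A t i x) I :=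
    fun i x => (hA.contDiffOn i x).continuousOn
  have hadet : ∀ t ∈ I, ∀ i j l, Triple.det (a t i) (a t j) (a t l) = 0 ↔
      Triple.det (p i) (p j) (p l) = 0 := by
    intro t ht i j l
    refine (det_eq_zero_iff_of_linearIndepOn_iff b (hA.matroid_eq t ht) i j l).trans ?_
    rw [hcα, hcα, hcα, Triple.det_smul]
    have := (hr i).ne'
    have := (hr j).ne'
    have := (hr l).ne'
    simp [*]
  have hd : ∀ t ∈ I, Triple.det (a t i₀) (a t i₁) (a t i₂) ≠ 0 := fun t ht => by
    rw [Ne, hadet t ht, h₀, h₁, h₂]; simp [Triple.det, Triple.dot, Triple.cross]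
  have hdx : ∀ t ∈ I, Triple.det (a t i₃) (a t i₁) (a t i₂) ≠ 0 := fun t ht => by
    rw [Ne, hadet t ht, h₃, h₁, h₂]; simp [Triple.det, Triple.dot, Triple.cross, hκ]
  have hdy : ∀ t ∈ I, Triple.det (a t i₀) (a t i₃) (a t i₂) ≠ 0 := fun t ht => by
    rw [Ne, hadet t ht, h₃, h₀, h₂]; simp [Triple.det, Triple.dot, Triple.cross, hκ]
  have hdz : ∀ t ∈ I, Triple.det (a t i₀) (a t i₁) (a t i₃) ≠ 0 := fun t ht => by
    rw [Ne, hadet t ht, h₃, h₀, h₁]; simp [Triple.det, Triple.dot, Triple.cross, hκ]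
  have hcd : ∀ i j l, ContinuousOn (fun t => Triple.det (a t i) (a t j) (a t l)) I := by
    intro i j l
    simp only [Triple.det, Triple.dot, Triple.cross, a, coords]
    have := hcont i
    have := hcont j
    have := hcont l
    fun_prop
  let y : ℝ → ι → Triple ℝ := fun t i =>
    frameCoords (a t i₀) (a t i₁) (a t i₂) (a t i₃) (a t i)
  have hyx : ∀ i, ContinuousOn (fun t => (y t i).x) I := fun i => (hcd _ _ _).div (hcd _ _ _) hdx
  have hyy : ∀ i, ContinuousOn (fun t => (y t i).y) I := fun i => (hcd _ _ _).div (hcd _ _ _) hdy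
  have hyz : ∀ i, ContinuousOn (fun t => (y t i).z) I := fun i => (hcd _ _ _).div (hcd _ _ _) hdz
  -- the automorphism that takes the standard frame to the frame of `A t`
  let H : ℝ → Dual ℝ V →ₗ[ℝ] Dual ℝ V := fun t => b.dualBasis.constr ℝ
    ![((a t i₃).det (a t i₁) (a t i₂) / (a t i₀).det (a t i₁) (a t i₂)) • A t i₀,
      ((a t i₀).det (a t i₃) (a t i₂) / (a t i₀).det (a t i₁) (a t i₂)) • A t i₁,
      ((a t i₀).det (a t i₁) (a t i₃) / (a t i₀).det (a t i₁) (a t i₂)) • A t i₂]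
  have hH : ∀ t q, H t (covec b q) =
      (q.x * ((a t i₃).det (a t i₁) (a t i₂) / (a t i₀).det (a t i₁) (a t i₂))) • A t i₀
      + (q.y * ((a t i₀).det (a t i₃) (a t i₂) / (a t i₀).det (a t i₁) (a t i₂))) • A t i₁
      + (q.z * ((a t i₀).det (a t i₁) (a t i₃) / (a t i₀).det (a t i₁) (a t i₂))) • A t i₂ := by
    intro t q
    have e0 : b.coord 0 = b.dualBasis 0 := by simp
    have e1 : b.coord 1 = b.dualBasis 1 := by simp
    have e2 : b.coord 2 = b.dualBasis 2 := by simp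
    rw [covec, e0, e1, e2, map_add, map_add, map_smul, map_smul, map_smul, Basis.constr_basis,
      Basis.constr_basis, Basis.constr_basis]
    simp [mul_smul]
  have hHy : ∀ t ∈ I, ∀ i, A t i = H t (covec b (y t i)) := by
    intro t ht i
    rw [hH]
    have h0 := hd t ht
    have hx := hdx t ht
    have hy := hdy t ht
    have hz := hdz t ht
    obtain ⟨e1, e2, e3⟩ := Triple.cramer h0 (a t i)
    apply coords_injective b
    simp only [y, frameCoords]
    rw [div_mul_div_cancel₀ hx, div_mul_div_cancel₀ hy, div_mul_div_cancel₀ hz]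
    exact Triple.ext e1 e2 e3
  have hAne : ∀ t ∈ I, ∀ i, A t i ≠ 0 := by
    intro t ht i
    have h1 : LinearIndepOn ℝ α {i} := by
      rw [linearIndepOn_singleton_iff ℝ, hαp]
      exact smul_ne_zero (hr i).ne' (by rw [Ne, covec_eq_zero_iff]; exact hpne i)
    exact (linearIndepOn_singleton_iff ℝ).1 ((hA.matroid_eq t ht _).2 h1)
  have hy0 : ∀ i, y 0 i = (p i).smul (r i / (r i₃ * κ)) := by
    intro i
    have ha : ∀ i, a 0 i = (p i).smul (r i) := fun i => by
      simp only [a, hA.zero]; exact hcα i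
    have := (hr i₀).ne'
    have := (hr i₁).ne'
    have := (hr i₂).ne'
    have := (hr i₃).ne'
    simp only [y, ha, frameCoords, h₀, h₁, h₂, h₃, Triple.det, Triple.dot, Triple.cross,
      Triple.smul]
    ext <;> simp only <;> field_simp <;> ring
  have hmotion : IsFramedMotion p i₀ i₁ i₂ i₃ I y := by
    refine ⟨hyx, hyy, fun t ht i h => hAne t ht i ?_, fun t ht i j l => ?_, fun t ht => ?_,
      fun i => ⟨_, div_ne_zero (hr i).ne' (mul_ne_zero (hr i₃).ne' hκ), hy0 i⟩⟩
    · rw [hHy t ht, h, (covec_eq_zero_iff b).2 rfl, map_zero]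
    · rw [← hadet t ht]
      exact det_frameCoords (hd t ht) (hdx t ht) (hdy t ht) (hdz t ht) _ _ _
    · have z1 : ∀ u v : Triple ℝ, Triple.det u u v = 0 := fun u v => by
        simp only [Triple.det, Triple.dot, Triple.cross]; ring
      have z2 : ∀ u v : Triple ℝ, Triple.det u v u = 0 := fun u v => by
        simp only [Triple.det, Triple.dot, Triple.cross]; ring
      have z3 : ∀ u v : Triple ℝ, Triple.det v u u = 0 := fun u v => by
        simp only [Triple.det, Triple.dot, Triple.cross]; ring
      refine ⟨?_, ?_, ?_, ?_⟩
      · refine ⟨_, div_ne_zero (hd t ht) (hdx t ht), ?_⟩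
        simp [y, frameCoords, h₀, Triple.smul, z1, z2]
      · refine ⟨_, div_ne_zero (hd t ht) (hdy t ht), ?_⟩
        simp [y, frameCoords, h₁, Triple.smul, z1, z3]
      · refine ⟨_, div_ne_zero (hd t ht) (hdz t ht), ?_⟩
        simp [y, frameCoords, h₂, Triple.smul, z2, z3]
      · refine ⟨κ⁻¹, inv_ne_zero hκ, ?_⟩
        simp [y, frameCoords, h₃, Triple.smul, hκ, hdx t ht, hdy t ht, hdz t ht]
  have hpar := hproj ε hε y hmotion
  -- the factors between the moving vectors and the initial ones
  let l : ℝ → ι → ℝ := fun t i => (y t i).dot (p i) / (p i).dot (p i)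
  have hl : ∀ t ∈ I, ∀ i, l t i ≠ 0 ∧ y t i = (p i).smul (l t i) := by
    intro t ht i
    obtain ⟨s, hs, h⟩ := hpar t ht i
    have : l t i = s := by
      have := (Triple.dot_self_pos (hpne i)).ne'
      simp only [l]
      rw [h, div_eq_iff this]
      simp only [Triple.dot, Triple.smul]; ring
    rw [this]; exact ⟨hs, h⟩
  have hlc : ∀ i, ContinuousOn (fun t => l t i) I := by
    intro i
    have := hyx i
    have := hyy i
    have := hyz i
    simp only [l, Triple.dot]
    fun_prop
  let ρ : ℝ → ι → ℝ := fun t i => (l t i / r i) / (l t i₀ / r i₀)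
  have hl0 : ∀ t ∈ I, l t i₀ / r i₀ ≠ 0 := fun t ht => div_ne_zero (hl t ht i₀).1 (hr i₀).ne'
  have hsurj : ∀ t ∈ I, Function.Surjective ((l t i₀ / r i₀) • H t) := by
    intro t ht
    rw [← LinearMap.range_eq_top, LinearMap.range_smul _ _ (hl0 t ht), eq_top_iff,
      ← (hA.isVeeSystem t ht).span_eq_top, Submodule.span_le]
    rintro _ ⟨i, rfl⟩
    exact ⟨_, (hHy t ht i).symm⟩
  have hbij : ∀ t ∈ I, Function.Bijective ((l t i₀ / r i₀) • H t) := fun t ht =>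
    ⟨LinearMap.injective_iff_surjective.2 (hsurj t ht), hsurj t ht⟩
  let g : ℝ → (Dual ℝ V ≃ₗ[ℝ] Dual ℝ V) := fun t => if ht : t ∈ I then
    LinearEquiv.ofBijective ((l t i₀ / r i₀) • H t) (hbij t ht) else LinearEquiv.refl ℝ _
  have hgH : ∀ t ∈ I, ∀ f, g t f = (l t i₀ / r i₀) • H t f := by
    intro t ht f
    simp only [g, dif_pos ht]
    rfl
  have hg : ∀ t ∈ I, ∀ i, A t i = g t (ρ t i • α i) := by
    intro t ht i
    rw [hgH t ht, hHy t ht i, (hl t ht i).2, covec_smul, hαp, smul_smul, map_smul, map_smul,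
      smul_smul]
    congr 1
    have := (hl t ht i₀).1
    have := (hr i).ne'
    have := (hr i₀).ne'
    simp only [ρ]
    field_simp
  have hρ : ∀ t ∈ I, ρ t = 1 := by
    refine eq_one_of_continuousOn hα hli hlin i₀ isPreconnected_Ioo h0I (fun i => ?_) ?_
      (fun t ht => div_self (hl0 t ht)) fun t ht => ?_
    · exact ((hlc i).div_const _).div ((hlc i₀).div_const _) hl0
    · have hl' : ∀ i, l 0 i / r i = 1 / (r i₃ * κ) := by
        intro i
        have := (Triple.dot_self_pos (hpne i)).ne'
        have := (hr i).ne'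
        have := (hr i₃).ne'
        have : l 0 i = r i / (r i₃ * κ) := by
          simp only [l, hy0]
          rw [div_eq_iff (Triple.dot_self_pos (hpne i)).ne']
          simp only [Triple.dot, Triple.smul]; ring
        rw [this]
        field_simp
      funext i
      have := (hr i₃).ne'
      simp only [ρ, hl', Pi.one_apply]
      exact div_self (one_div_ne_zero (mul_ne_zero this hκ))
    · have := (hA.isVeeSystem t ht).map (g t).symm
      convert this using 2 with i
      rw [hg t ht i, LinearEquiv.symm_apply_apply]
  have hg' : ∀ t ∈ I, ∀ i, A t i = g t (α i) := by
    intro t ht i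
    rw [hg t ht i, hρ t ht]; simp
  refine ⟨g, fun f x => ?_, hg'⟩
  have hf : f = (f (b 0) / r i₀) • α i₀ + (f (b 1) / r i₁) • α i₁ + (f (b 2) / r i₂) • α i₂ := by
    have := (hr i₀).ne'
    have := (hr i₁).ne'
    have := (hr i₂).ne'
    apply coords_injective b
    simp only [hαp, h₀, h₁, h₂, smul_smul]
    simp [coords, covec, *]
  refine ContDiffOn.congr (f := fun t => (f (b 0) / r i₀) * A t i₀ x + (f (b 1) / r i₁) * A t i₁ x
    + (f (b 2) / r i₂) * A t i₂ x) ?_ fun t ht => ?_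
  · have := hA.contDiffOn i₀ x
    have := hA.contDiffOn i₁ x
    have := hA.contDiffOn i₂ x
    fun_prop
  · conv_lhs => rw [hf]
    simp [hg' t ht]

end Deformation

/-! ### The vee-conditions in coordinates -/

/-- A symmetric `3 × 3` matrix. -/
structure SymMatrix (R : Type*) where
  /-- Entry `(0, 0)`. -/
  xx : R
  /-- Entry `(0, 1)`. -/
  xy : R
  /-- Entry `(0, 2)`. -/
  xz : R
  /-- Entry `(1, 1)`. -/
  yy : R
  /-- Entry `(1, 2)`. -/
  yz : R
  /-- Entry `(2, 2)`. -/
  zz : R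

namespace SymMatrix

variable {R : Type*} [Add R] [Sub R] [Mul R]

/-- The adjugate matrix. -/
def adj (G : SymMatrix R) : SymMatrix R :=
  ⟨G.yy * G.zz - G.yz * G.yz, G.xz * G.yz - G.xy * G.zz, G.xy * G.yz - G.xz * G.yy,
    G.xx * G.zz - G.xz * G.xz, G.xy * G.xz - G.xx * G.yz, G.xx * G.yy - G.xy * G.xy⟩

/-- The product with a vector. -/
def mulVec (G : SymMatrix R) (u : Triple R) : Triple R :=
  ⟨G.xx * u.x + G.xy * u.y + G.xz * u.z, G.xy * u.x + G.yy * u.y + G.yz * u.z,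
    G.xz * u.x + G.yz * u.y + G.zz * u.z⟩

/-- The determinant. -/
def det (G : SymMatrix R) : R := G.xx * G.adj.xx + G.xy * G.adj.xy + G.xz * G.adj.xz

lemma mulVec_adj_mulVec (G : SymMatrix ℝ) (u : Triple ℝ) :
    G.mulVec (G.adj.mulVec u) = u.smul G.det := by
  ext <;> simp only [mulVec, adj, det, Triple.smul] <;> ring

lemma dot_mulVec_comm (G : SymMatrix ℝ) (u v : Triple ℝ) :
    u.dot (G.mulVec v) = v.dot (G.mulVec u) := by
  simp only [mulVec, Triple.dot]; ring

end SymMatrix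

section Coordinates

variable {V ι : Type*} [AddCommGroup V] [Module ℝ V] [Fintype ι] (b : Basis (Fin 3) ℝ V)

/-- The vector with given coordinates. -/
def vec (u : Triple ℝ) : V := u.x • b 0 + u.y • b 1 + u.z • b 2

lemma covec_vec (p u : Triple ℝ) : covec b p (vec b u) = p.dot u := by
  simp [vec, covec_apply_zero, covec_apply_one, covec_apply_two, Triple.dot, mul_comm]

/-- The Gram matrix of the form `∑ w i • p i ⊗ p i`. -/
def gram (w : ι → ℝ) (p : ι → Triple ℝ) : SymMatrix ℝ :=
  ⟨∑ i, w i * ((p i).x * (p i).x), ∑ i, w i * ((p i).x * (p i).y), ∑ i, w i * ((p i).x * (p i).z),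
    ∑ i, w i * ((p i).y * (p i).y), ∑ i, w i * ((p i).y * (p i).z), ∑ i, w i * ((p i).z * (p i).z)⟩

/-- The form on `V*` inverse to the Gram matrix, multiplied by the determinant of the latter. -/
def dualForm (G : SymMatrix ℝ) (p q : Triple ℝ) : ℝ := p.dot (G.adj.mulVec q)

/-- The covectors `√(w i) p i`, in coordinates: `r i ^ 2 = w i`, no two of the `p i` are
proportional, and the covectors span. -/
structure IsCoordinatisation (α : ι → Dual ℝ V) (p : ι → Triple ℝ) (w r : ι → ℝ) : Prop where
  pos : ∀ i, 0 < r i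
  sq : ∀ i, r i * r i = w i
  eq_smul : ∀ i, α i = r i • covec b (p i)
  cross_ne_zero : ∀ i j, i ≠ j → (p i).cross (p j) ≠ Triple.zero
  ne_zero : ∀ i, p i ≠ Triple.zero
  det_ne_zero : (gram w p).det ≠ 0
  span_eq_top : Submodule.span ℝ (Set.range α) = ⊤

variable {b} {α : ι → Dual ℝ V} {p : ι → Triple ℝ} {w r : ι → ℝ}

namespace IsCoordinatisation

variable (hc : IsCoordinatisation b α p w r)
include hc

lemma linearIndependent_pair {i j : ι} (hij : i ≠ j) : LinearIndependent ℝ ![α i, α j] := by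
  have := (linearIndependent_pair_covec b (hc.cross_ne_zero i j hij)).units_smul
    ![Units.mk0 _ (hc.pos i).ne', Units.mk0 _ (hc.pos j).ne']
  convert this using 1
  ext l : 1; fin_cases l <;> simp [hc.eq_smul, Units.smul_def]

lemma injective : Function.Injective α := by
  intro i j h
  by_contra hij
  have := (hc.linearIndependent_pair hij).injective (a₁ := 0) (a₂ := 1) (by simpa using h)
  simp at this

lemma canonicalMap_vec (u : Triple ℝ) :
    canonicalMap α (vec b u) = covec b ((gram w p).mulVec u) := by
  apply coords_injective b
  rw [canonicalMap_apply, coords_covec]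
  have h : ∀ (v : V), (∑ i, α i (vec b u) • α i) v
      = ∑ i, w i * ((p i).dot u * covec b (p i) v) := by
    intro v
    rw [LinearMap.sum_apply]
    refine Finset.sum_congr rfl fun i _ => ?_
    rw [hc.eq_smul, ← hc.sq]
    simp only [LinearMap.smul_apply, covec_vec, smul_eq_mul]; ring
  simp only [coords, h, covec_apply_zero, covec_apply_one, covec_apply_two]
  ext <;> simp only [SymMatrix.mulVec, gram, Triple.dot, Finset.sum_mul,
    ← Finset.sum_add_distrib] <;> exact Finset.sum_congr rfl fun i _ => by ring

lemma span_pair_eq {P : Submodule ℝ (Dual ℝ V)} (hP : finrank ℝ P = 2)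
    {i j : ι} (hij : i ≠ j) (hi : α i ∈ P) (hj : α j ∈ P) :
    Submodule.span ℝ {α i, α j} = P := by
  have : FiniteDimensional ℝ P := FiniteDimensional.of_finrank_pos (by omega)
  have hle : Submodule.span ℝ {α i, α j} ≤ P := by
    rw [Submodule.span_le]; rintro x (rfl | rfl) <;> assumption
  refine Submodule.eq_of_le_of_finrank_eq hle ?_
  have := finrank_span_eq_card (hc.linearIndependent_pair hij)
  have hr : Set.range ![α i, α j] = {α i, α j} := by ext x; simp [or_comm]
  rw [hP, ← hr]
  simpa using this

lemma finrank_span_pair {i j : ι} (hij : i ≠ j) :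
    finrank ℝ (Submodule.span ℝ {α i, α j}) = 2 := by
  have := finrank_span_eq_card (hc.linearIndependent_pair hij)
  have hr : Set.range ![α i, α j] = {α i, α j} := by ext x; simp [or_comm]
  rw [← hr]
  simpa using this

/-- The plane spanned by two covectors is given by their cross product. -/
lemma mem_plane_iff {P : Submodule ℝ (Dual ℝ V)} (hP : finrank ℝ P = 2)
    {i j : ι} (hij : i ≠ j) (hi : α i ∈ P) (hj : α j ∈ P) (k : ι) :
    α k ∈ P ↔ ((p i).cross (p j)).dot (p k) = 0 := by
  have hm : ∀ l, α l ∈ P ↔ covec b (p l) ∈ P := fun l => by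
    rw [hc.eq_smul, P.smul_mem_iff (hc.pos l).ne']
  constructor
  · intro hk
    rw [← hc.span_pair_eq hP hij hi hj, Submodule.mem_span_pair] at hk
    obtain ⟨s, t, h⟩ := hk
    rw [hc.eq_smul i, hc.eq_smul j, hc.eq_smul k, smul_smul, smul_smul] at h
    have hk' : p k = ⟨(r k)⁻¹ * (s * r i * (p i).x + t * r j * (p j).x),
        (r k)⁻¹ * (s * r i * (p i).y + t * r j * (p j).y),
        (r k)⁻¹ * (s * r i * (p i).z + t * r j * (p j).z)⟩ := by
      have hrk := (hc.pos k).ne'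
      have e0 := LinearMap.congr_fun h (b 0)
      have e1 := LinearMap.congr_fun h (b 1)
      have e2 := LinearMap.congr_fun h (b 2)
      simp only [LinearMap.add_apply, LinearMap.smul_apply, smul_eq_mul, covec_apply_zero,
        covec_apply_one, covec_apply_two] at e0 e1 e2
      ext <;> simp only
      · rw [e0]; field_simp
      · rw [e1]; field_simp
      · rw [e2]; field_simp
    rw [hk']
    simp only [Triple.dot, Triple.cross]; ring
  · intro hk
    have hnn : Triple.det (p i) (p j) ((p i).cross (p j)) ≠ 0 :=
      (Triple.dot_self_pos (hc.cross_ne_zero i j hij)).ne'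
    obtain ⟨e1, e2, e3⟩ := Triple.cramer hnn (p k)
    have h0 : Triple.det (p i) (p j) (p k) = 0 := hk
    rw [h0, zero_div, zero_mul, add_zero] at e1 e2 e3
    rw [hm] at hi hj ⊢
    have : covec b (p k) = (Triple.det (p k) (p j) ((p i).cross (p j)) /
        Triple.det (p i) (p j) ((p i).cross (p j))) • covec b (p i)
        + (Triple.det (p i) (p k) ((p i).cross (p j)) /
        Triple.det (p i) (p j) ((p i).cross (p j))) • covec b (p j) := by
      apply coords_injective b
      rw [coords_covec]
      simp only [coords, LinearMap.add_apply, LinearMap.smul_apply, smul_eq_mul, covec_apply_zero,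
        covec_apply_one, covec_apply_two]
      ext <;> simp only <;> linarith
    rw [this]
    exact P.add_mem (P.smul_mem _ hi) (P.smul_mem _ hj)

variable [FiniteDimensional ℝ V]

lemma vee_covec (q : Triple ℝ) : vee α (covec b q)
    = (gram w p).det⁻¹ • vec b ((gram w p).adj.mulVec q) := by
  apply vee_eq_of_canonicalMap_eq hc.span_eq_top
  rw [map_smul, hc.canonicalMap_vec, SymMatrix.mulVec_adj_mulVec, covec_smul, smul_smul,
    inv_mul_cancel₀ hc.det_ne_zero, one_smul]

lemma apply_vee (i j : ι) : α i (vee α (α j))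
    = r i * r j * dualForm (gram w p) (p i) (p j) * (gram w p).det⁻¹ := by
  rw [hc.eq_smul i, hc.eq_smul j, vee_smul hc.span_eq_top, hc.vee_covec]
  simp only [LinearMap.smul_apply, map_smul, covec_vec, smul_eq_mul, dualForm]
  ring

/-- The vee-conditions need to be checked only in the planes spanned by two of the covectors. -/
lemma isVeeSystem (h : ∀ i j, i ≠ j → Triple.cross
      ⟨∑ k, if ((p i).cross (p j)).dot (p k) = 0 then
          w k * dualForm (gram w p) (p k) (p i) * (p k).x else 0,
        ∑ k, if ((p i).cross (p j)).dot (p k) = 0 then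
          w k * dualForm (gram w p) (p k) (p i) * (p k).y else 0,
        ∑ k, if ((p i).cross (p j)).dot (p k) = 0 then
          w k * dualForm (gram w p) (p k) (p i) * (p k).z else 0⟩ (p i) = Triple.zero) :
    IsVeeSystem α := by
  refine ⟨hc.injective, hc.span_eq_top, fun P hP i hi => ?_⟩
  simp only [sum_smul_vee_eq_iff hc.span_eq_top]
  by_cases hj : ∃ j, i ≠ j ∧ α j ∈ P
  · obtain ⟨j, hij, hj⟩ := hj
    obtain ⟨s, hs⟩ := Triple.eq_smul_of_cross_eq_zero (hc.ne_zero i) (h i j hij)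
    simp only [Triple.smul, Triple.mk.injEq] at hs
    refine ⟨s * (gram w p).det⁻¹, ?_⟩
    apply coords_injective b
    have key : ∀ v, (∑ k with α k ∈ P, α k (vee α (α i)) • α k) v = r i * (gram w p).det⁻¹ *
        ∑ k, if ((p i).cross (p j)).dot (p k) = 0 then
          w k * dualForm (gram w p) (p k) (p i) * covec b (p k) v else 0 := by
      intro v
      simp only [hc.mem_plane_iff hP hij hi hj]
      rw [LinearMap.sum_apply, Finset.sum_filter, Finset.mul_sum]
      refine Finset.sum_congr rfl fun k _ => ?_
      split_ifs
      · rw [LinearMap.smul_apply, hc.apply_vee, ← hc.sq]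
        conv_lhs => rw [hc.eq_smul k]
        simp only [LinearMap.smul_apply, smul_eq_mul]; ring
      · simp
    simp only [coords, key]
    simp only [covec_apply_zero, covec_apply_one, covec_apply_two, hs.1, hs.2.1,
      hs.2.2, LinearMap.smul_apply, hc.eq_smul i, smul_eq_mul]
    ext <;> simp only <;> ring
  · have : (Finset.univ.filter fun k => α k ∈ P) = {i} := by
      ext k
      simp only [Finset.mem_filter, Finset.mem_univ, true_and, Finset.mem_singleton]
      constructor
      · intro hk
        by_contra hki
        exact hj ⟨k, fun h => hki h.symm, hk⟩
      · rintro rfl; exact hi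
    rw [this, Finset.sum_singleton]
    exact ⟨_, rfl⟩

/-- The linearised condition of a plane with just two covectors. -/
lemma sum_eq_zero_of_two {ξ : ι → ℝ} (hξ : LinearisedVeeConditions α ξ) {i j : ι} (hij : i ≠ j)
    (h2 : ∀ k, ((p i).cross (p j)).dot (p k) = 0 → k = i ∨ k = j) :
    ∑ k, w k * dualForm (gram w p) (p k) (p i) * dualForm (gram w p) (p k) (p j) * ξ k = 0 := by
  have hP := hc.finrank_span_pair hij
  have hi : α i ∈ Submodule.span ℝ {α i, α j} := Submodule.subset_span (by simp)
  have hj : α j ∈ Submodule.span ℝ {α i, α j} := Submodule.subset_span (by simp)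
  have h0 := hξ.two _ hP i j hij fun k => by
    constructor
    · intro hk
      exact h2 k ((hc.mem_plane_iff hP hij hi hj k).1 hk)
    · rintro (rfl | rfl) <;> assumption
  rw [weightedForm_top] at h0
  have hd := inv_ne_zero hc.det_ne_zero
  have hri := (hc.pos i).ne'
  have hrj := (hc.pos j).ne'
  have : (r i * r j * (gram w p).det⁻¹ * (gram w p).det⁻¹) * ∑ k, w k *
      dualForm (gram w p) (p k) (p i) * dualForm (gram w p) (p k) (p j) * ξ k = 0 := by
    rw [← h0, Finset.mul_sum]
    refine Finset.sum_congr rfl fun k _ => ?_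
    rw [hc.apply_vee, hc.apply_vee, ← hc.sq]; ring
  exact (mul_eq_zero.1 this).resolve_left
    (mul_ne_zero (mul_ne_zero (mul_ne_zero hri hrj) hd) hd)

/-- The linearised conditions of a plane with more than two covectors: the form
`d β(i,i) X^P - N X` is proportional to `β`, where `β` is the dual form, `d` the determinant of the Gram matrix and
`N / (d β(i,i))` the coefficient `ν` of the plane. -/
lemma exists_sum_eq_of_many {ξ : ι → ℝ} (hξ : LinearisedVeeConditions α ξ) {i j l : ι}
    (hij : i ≠ j) (hil : l ≠ i) (hjl : l ≠ j) (hl : ((p i).cross (p j)).dot (p l) = 0) :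
    ∃ c : ℝ, ∀ f h, (f = i ∨ f = j) → (h = i ∨ h = j) →
      ∑ k, w k * dualForm (gram w p) (p k) (p f) * dualForm (gram w p) (p k) (p h) *
        ((if ((p i).cross (p j)).dot (p k) = 0 then
            (gram w p).det * dualForm (gram w p) (p i) (p i) else 0)
          - ∑ m, if ((p i).cross (p j)).dot (p m) = 0 then
              w m * dualForm (gram w p) (p m) (p i) * dualForm (gram w p) (p m) (p i) else 0) * ξ k
      = c * dualForm (gram w p) (p f) (p h) := by
  set P := Submodule.span ℝ {α i, α j} with hPdef
  have hP : finrank ℝ P = 2 := hc.finrank_span_pair hij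
  have hi : α i ∈ P := Submodule.subset_span (by simp)
  have hj : α j ∈ P := Submodule.subset_span (by simp)
  have hlP : α l ∈ P := (hc.mem_plane_iff hP hij hi hj l).2 hl
  obtain ⟨ν, hν, c, hcc⟩ := hξ.many P hP
    ((Set.two_lt_ncard_iff (Set.toFinite _)).2 ⟨i, j, l, hi, hj, hlP, hij, hil.symm, hjl.symm⟩)
  set d := (gram w p).det with hd
  have hd0 : d ≠ 0 := hc.det_ne_zero
  have hri := (hc.pos i).ne'
  -- the coefficient `ν`
  have hN : (∑ m, if ((p i).cross (p j)).dot (p m) = 0 then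
      w m * dualForm (gram w p) (p m) (p i) * dualForm (gram w p) (p m) (p i) else 0)
      = ν * d * dualForm (gram w p) (p i) (p i) := by
    have h1 := hν i hi (vee α (α i))
    rw [weightedForm_eq_sum_ite, weightedForm_top] at h1
    simp only [Pi.one_apply, one_mul] at h1
    rw [sum_apply_vee_mul hc.span_eq_top, hc.apply_vee] at h1
    have h2 : (r i * r i * d⁻¹ * d⁻¹) * (∑ m, if ((p i).cross (p j)).dot (p m) = 0 then
      w m * dualForm (gram w p) (p m) (p i) * dualForm (gram w p) (p m) (p i) else 0)
      = (r i * r i * d⁻¹ * d⁻¹) * (ν * d * dualForm (gram w p) (p i) (p i)) := by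
      trans ν * (r i * r i * dualForm (gram w p) (p i) (p i) * d⁻¹)
      · rw [← h1, Finset.mul_sum]
        refine Finset.sum_congr rfl fun k _ => ?_
        rw [if_congr (hc.mem_plane_iff hP hij hi hj k) rfl rfl]
        split_ifs
        · rw [hc.apply_vee, ← hc.sq]; ring
        · simp
      · field_simp
    exact mul_left_cancel₀ (mul_ne_zero (mul_ne_zero (mul_ne_zero hri hri) (inv_ne_zero hd0))
      (inv_ne_zero hd0)) h2
  refine ⟨c * d * d * dualForm (gram w p) (p i) (p i), fun f h hf hh => ?_⟩
  have hfP : α f ∈ P := by rcases hf with rfl | rfl <;> assumption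
  have hhP : α h ∈ P := by rcases hh with rfl | rfl <;> assumption
  have h1 := hcc _ hfP _ hhP
  rw [weightedForm_eq_sum_ite, weightedForm_top, weightedForm_top] at h1
  simp only [Pi.one_apply, one_mul] at h1
  rw [sum_apply_vee_mul hc.span_eq_top, hc.apply_vee] at h1
  rw [hN]
  have hrf := (hc.pos f).ne'
  have hrh := (hc.pos h).ne'
  refine mul_left_cancel₀ (mul_ne_zero (mul_ne_zero (mul_ne_zero hrf hrh) (inv_ne_zero hd0))
      (inv_ne_zero hd0)) ?_
  trans d * dualForm (gram w p) (p i) (p i) *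
    (c * (r f * r h * dualForm (gram w p) (p f) (p h) * d⁻¹))
  · rw [← h1, Finset.mul_sum, Finset.mul_sum, ← Finset.sum_sub_distrib, Finset.mul_sum]
    refine Finset.sum_congr rfl fun k _ => ?_
    rw [if_congr (hc.mem_plane_iff hP hij hi hj k) rfl rfl, hc.apply_vee, hc.apply_vee, ← hc.sq]
    split_ifs <;> ring
  · field_simp

end IsCoordinatisation

end Coordinates

/-! ### Exact arithmetic with golden integers -/

/-- The number `re + im φ`, where `φ` is the golden ratio. -/
@[ext] structure GoldenInt where
  /-- The rational part. -/
  re : ℤ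
  /-- The coefficient of the golden ratio. -/
  im : ℤ

namespace GoldenInt

instance : Zero GoldenInt := ⟨⟨0, 0⟩⟩
instance : One GoldenInt := ⟨⟨1, 0⟩⟩
instance : Add GoldenInt := ⟨fun z w => ⟨z.re + w.re, z.im + w.im⟩⟩
instance : Neg GoldenInt := ⟨fun z => ⟨-z.re, -z.im⟩⟩
instance : Sub GoldenInt := ⟨fun z w => ⟨z.re - w.re, z.im - w.im⟩⟩
instance : Mul GoldenInt :=
  ⟨fun z w => ⟨z.re * w.re + z.im * w.im, z.re * w.im + z.im * w.re + z.im * w.im⟩⟩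

/-- Decides whether a golden integer is zero. -/
def isZero (z : GoldenInt) : Bool := z.re == 0 && z.im == 0

/-- Decides whether both coefficients are non-negative. -/
def isNonneg (z : GoldenInt) : Bool := decide (0 ≤ z.re) && decide (0 ≤ z.im)

/-- The real number represented by a golden integer. -/
def toReal (z : GoldenInt) : ℝ := z.re + z.im * Real.goldenRatio

@[simp] lemma toReal_zero : toReal 0 = 0 := by
  change ((0 : ℤ) : ℝ) + ((0 : ℤ) : ℝ) * _ = 0; simp
@[simp] lemma toReal_one : toReal 1 = 1 := by
  change ((1 : ℤ) : ℝ) + ((0 : ℤ) : ℝ) * _ = 1; simp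
@[simp] lemma toReal_add (z w : GoldenInt) : (z + w).toReal = z.toReal + w.toReal := by
  change ((z.re + w.re : ℤ) : ℝ) + ((z.im + w.im : ℤ) : ℝ) * _ = _
  simp only [toReal]; push_cast; ring
@[simp] lemma toReal_neg (z : GoldenInt) : (-z).toReal = -z.toReal := by
  change ((-z.re : ℤ) : ℝ) + ((-z.im : ℤ) : ℝ) * _ = _
  simp only [toReal]; push_cast; ring
@[simp] lemma toReal_sub (z w : GoldenInt) : (z - w).toReal = z.toReal - w.toReal := by
  change ((z.re - w.re : ℤ) : ℝ) + ((z.im - w.im : ℤ) : ℝ) * _ = _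
  simp only [toReal]; push_cast; ring
@[simp] lemma toReal_mul (z w : GoldenInt) : (z * w).toReal = z.toReal * w.toReal := by
  change ((z.re * w.re + z.im * w.im : ℤ) : ℝ)
    + ((z.re * w.im + z.im * w.re + z.im * w.im : ℤ) : ℝ) * _ = _
  simp only [toReal]; push_cast
  linear_combination (-(z.im : ℝ) * w.im) * Real.goldenRatio_sq

lemma isZero_iff {z : GoldenInt} : z.isZero = true ↔ z = 0 := by
  simp only [isZero, Bool.and_eq_true, beq_iff_eq, GoldenInt.ext_iff]
  exact Iff.rfl

lemma toReal_eq_zero_iff {z : GoldenInt} : z.toReal = 0 ↔ z.isZero = true := by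
  rw [isZero_iff]
  constructor
  · intro h
    have him : z.im = 0 := by
      by_contra him
      refine Real.goldenRatio_irrational ⟨-z.re / z.im, ?_⟩
      have : (z.im : ℝ) ≠ 0 := by exact_mod_cast him
      push_cast
      rw [div_eq_iff this]
      simp only [toReal] at h
      linarith
    have hre : z.re = 0 := by
      simp only [toReal, him, Int.cast_zero, zero_mul, add_zero] at h
      exact_mod_cast h
    exact GoldenInt.ext hre him
  · rintro rfl; exact toReal_zero

lemma toReal_injective : Function.Injective toReal := by
  intro z w h
  have : (z - w).toReal = 0 := by rw [toReal_sub, h, sub_self]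
  rw [toReal_eq_zero_iff, isZero_iff] at this
  have h1 : z.re - w.re = 0 := congrArg re this
  have h2 : z.im - w.im = 0 := congrArg im this
  exact GoldenInt.ext (by linarith) (by linarith)

lemma toReal_nonneg {z : GoldenInt} (h : z.isNonneg = true) : 0 ≤ z.toReal := by
  simp only [isNonneg, Bool.and_eq_true, decide_eq_true_eq] at h
  have h1 : (0 : ℝ) ≤ z.re := by exact_mod_cast h.1
  have h2 : (0 : ℝ) ≤ z.im := by exact_mod_cast h.2
  have := Real.goldenRatio_pos
  simp only [toReal]; positivity

end GoldenInt

namespace Triple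

/-- Decides whether a triple is zero. -/
def isZero (u : Triple GoldenInt) : Bool := u.x.isZero && (u.y.isZero && u.z.isZero)

/-- The real triple represented by a triple of golden integers. -/
def toReal (u : Triple GoldenInt) : Triple ℝ := ⟨u.x.toReal, u.y.toReal, u.z.toReal⟩

@[simp] lemma toReal_cross (u v : Triple GoldenInt) :
    (u.cross v).toReal = u.toReal.cross v.toReal := by
  simp [cross, toReal]

@[simp] lemma toReal_dot (u v : Triple GoldenInt) :
    (u.dot v).toReal = u.toReal.dot v.toReal := by
  simp [dot, toReal]

@[simp] lemma toReal_det (u v w : Triple GoldenInt) :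
    (u.det v w).toReal = u.toReal.det v.toReal w.toReal := by
  simp [det]

lemma toReal_eq_zero_iff {u : Triple GoldenInt} : u.toReal = zero ↔ u.isZero = true := by
  simp [isZero, toReal, zero, GoldenInt.toReal_eq_zero_iff]

end Triple

namespace SymMatrix

/-- The real matrix represented by a matrix of golden integers. -/
def toReal (G : SymMatrix GoldenInt) : SymMatrix ℝ :=
  ⟨G.xx.toReal, G.xy.toReal, G.xz.toReal, G.yy.toReal, G.yz.toReal, G.zz.toReal⟩

@[simp] lemma toReal_adj (G : SymMatrix GoldenInt) : G.adj.toReal = G.toReal.adj := by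
  simp [adj, toReal]

@[simp] lemma toReal_det (G : SymMatrix GoldenInt) : G.det.toReal = G.toReal.det := by
  simp [det, adj, toReal]

@[simp] lemma toReal_mulVec (G : SymMatrix GoldenInt) (u : Triple GoldenInt) :
    (G.mulVec u).toReal = G.toReal.mulVec u.toReal := by
  simp [mulVec, toReal, Triple.toReal]

end SymMatrix

/-! ### Checking the vee-conditions -/

/-- A vector with its weight: the pair `(p, w)` stands for the covector `√w p`. -/
abbrev WeightedPoint := Triple GoldenInt × GoldenInt

/-- The sum of the values of a function on a list. -/
def listSum {A : Type*} (f : A → GoldenInt) : List A → GoldenInt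
  | [] => 0
  | a :: l => f a + listSum f l

lemma toReal_listSum {A : Type*} (f : A → GoldenInt) (l : List A) :
    (listSum f l).toReal = ∑ k : Fin l.length, (f (l.get k)).toReal := by
  induction l with
  | nil => simp [listSum]
  | cons a l ih =>
    rw [listSum, GoldenInt.toReal_add, ih]
    exact (Fin.sum_univ_succ (n := l.length)
      (fun k => (f ((a :: l).get k)).toReal)).symm

lemma toReal_listSum_filter {A : Type*} (f : A → GoldenInt) (c : A → Bool) (l : List A) :
    (listSum f (l.filter c)).toReal
      = ∑ k : Fin l.length, if c (l.get k) = true then (f (l.get k)).toReal else 0 := by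
  have : listSum f (l.filter c) = listSum (fun a => if c a = true then f a else 0) l := by
    induction l with
    | nil => rfl
    | cons a l ih =>
      have h0 : ∀ z : GoldenInt, 0 + z = z := fun z =>
        GoldenInt.toReal_injective (by simp)
      by_cases h : c a = true
      · rw [List.filter_cons_of_pos h, listSum, listSum, ih, if_pos h]
      · rw [List.filter_cons_of_neg h, listSum, ih, if_neg h, h0]
  rw [this, toReal_listSum]
  refine Finset.sum_congr rfl fun k _ => ?_
  split_ifs <;> simp

/-- The Gram matrix of the covectors in a list. -/
def listGram (l : List WeightedPoint) : SymMatrix GoldenInt :=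
  ⟨listSum (fun q => q.2 * (q.1.x * q.1.x)) l, listSum (fun q => q.2 * (q.1.x * q.1.y)) l,
    listSum (fun q => q.2 * (q.1.x * q.1.z)) l, listSum (fun q => q.2 * (q.1.y * q.1.y)) l,
    listSum (fun q => q.2 * (q.1.y * q.1.z)) l, listSum (fun q => q.2 * (q.1.z * q.1.z)) l⟩

/-- Checks the vee-condition at the covector `a` for the list `s` of covectors in a plane; `A` is
the adjugate of the Gram matrix. -/
def veeCheckAt (A : SymMatrix GoldenInt) (a : Triple GoldenInt) (s : List WeightedPoint) : Bool :=
  let v := A.mulVec a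
  (Triple.cross ⟨listSum (fun k => k.2 * k.1.dot v * k.1.x) s,
    listSum (fun k => k.2 * k.1.dot v * k.1.y) s,
    listSum (fun k => k.2 * k.1.dot v * k.1.z) s⟩ a).isZero

/-- Checks the vee-conditions in the plane spanned by `a` and `b`, which must not be proportional.
-/
def veeCheckPair (l : List WeightedPoint) (A : SymMatrix GoldenInt) (a b : Triple GoldenInt) :
    Bool :=
  let n := a.cross b
  let s := l.filter fun k => (n.dot k.1).isZero
  !n.isZero && (veeCheckAt A a s && veeCheckAt A b s)

/-- Checks a relation for all the pairs in a list, in the order of the list. -/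
def pairwiseCheck {A : Type*} (f : A → A → Bool) : List A → Bool
  | [] => true
  | a :: l => l.all (f a) && pairwiseCheck f l

lemma pairwise_of_pairwiseCheck {A : Type*} {f : A → A → Bool} {l : List A}
    (h : pairwiseCheck f l = true) : l.Pairwise fun a b => f a b = true := by
  induction l with
  | nil => exact List.Pairwise.nil
  | cons a l ih =>
    simp only [pairwiseCheck, Bool.and_eq_true, List.all_eq_true] at h
    exact List.Pairwise.cons h.1 (ih h.2)

/-- Checks that the covectors form a vee-system, no two of them being proportional. -/
def veeCheck (l : List WeightedPoint) : Bool :=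
  let G := listGram l
  let A := G.adj
  !G.det.isZero && (l.all (fun q => q.2.isNonneg && (!q.2.isZero && !q.1.isZero)) &&
    pairwiseCheck (fun a b => veeCheckPair l A a.1 b.1) l)

section Certificates

variable {ι : Type*} (l : List WeightedPoint) (e : ι ≃ Fin l.length)

/-- The points of a list, as an indexed family of real vectors. -/
def points (i : ι) : Triple ℝ := (l.get (e i)).1.toReal

/-- The weights of a list, as an indexed family of real numbers. -/
def weights (i : ι) : ℝ := (l.get (e i)).2.toReal

lemma gram_eq [Fintype ι] : gram (weights l e) (points l e) = (listGram l).toReal := by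
  simp only [gram, listGram, SymMatrix.toReal, toReal_listSum, GoldenInt.toReal_mul]
  simp only [← Equiv.sum_comp e]
  rfl

lemma sum_points_eq [Fintype ι] (c : WeightedPoint → Bool) (f : WeightedPoint → GoldenInt) :
    ∑ i, (if c (l.get (e i)) = true then (f (l.get (e i))).toReal else 0)
      = (listSum f (l.filter c)).toReal := by
  rw [toReal_listSum_filter, ← Equiv.sum_comp e]

lemma dot_points_eq_zero_iff (n : Triple GoldenInt) (k : ι) :
    n.toReal.dot (points l e k) = 0 ↔ (n.dot (l.get (e k)).1).isZero = true := by
  rw [points, ← Triple.toReal_dot, GoldenInt.toReal_eq_zero_iff]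

lemma dualForm_points [Fintype ι] (i j : ι) :
    dualForm (gram (weights l e) (points l e)) (points l e i) (points l e j) =
      ((l.get (e i)).1.dot ((listGram l).adj.mulVec (l.get (e j)).1)).toReal := by
  rw [gram_eq]
  simp [dualForm, points]

variable {l} {V : Type*} [AddCommGroup V] [Module ℝ V]

lemma exists_veeCheckPair (h : veeCheck l = true) {i j : ι} (hij : i ≠ j) :
    veeCheckPair l (listGram l).adj (l.get (e i)).1 (l.get (e j)).1 = true ∨
      veeCheckPair l (listGram l).adj (l.get (e j)).1 (l.get (e i)).1 = true := by
  simp only [veeCheck, Bool.and_eq_true] at h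
  have hp := List.pairwise_iff_get.1 (pairwise_of_pairwiseCheck h.2.2)
  rcases lt_or_gt_of_ne (fun h' => hij (e.injective h') : e i ≠ e j) with hlt | hlt
  · exact Or.inl (hp _ _ hlt)
  · exact Or.inr (hp _ _ hlt)

lemma veeCheck_weights_pos (h : veeCheck l = true) (i : ι) : 0 < weights l e i := by
  simp only [veeCheck, Bool.and_eq_true, List.all_eq_true, Bool.not_eq_true'] at h
  have := h.2.1 (l.get (e i)) (List.get_mem _ _)
  refine lt_of_le_of_ne (GoldenInt.toReal_nonneg this.1) fun h0 => ?_
  have := GoldenInt.toReal_eq_zero_iff.1 h0.symm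
  simp_all

lemma veeCheck_points_ne_zero (h : veeCheck l = true) (i : ι) : points l e i ≠ Triple.zero := by
  simp only [veeCheck, Bool.and_eq_true, List.all_eq_true, Bool.not_eq_true'] at h
  have := h.2.1 (l.get (e i)) (List.get_mem _ _)
  intro h0
  have := Triple.toReal_eq_zero_iff.1 h0
  simp_all

lemma veeCheck_cross_ne_zero (h : veeCheck l = true) {i j : ι} (hij : i ≠ j) :
    (points l e i).cross (points l e j) ≠ Triple.zero := by
  have key : ∀ i j : ι, veeCheckPair l (listGram l).adj (l.get (e i)).1 (l.get (e j)).1 = true →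
      (points l e i).cross (points l e j) ≠ Triple.zero := by
    intro i j h h0
    simp only [veeCheckPair, Bool.and_eq_true, Bool.not_eq_true'] at h
    rw [points, points, ← Triple.toReal_cross, Triple.toReal_eq_zero_iff, h.1] at h0
    simp at h0
  rcases exists_veeCheckPair e h hij with h' | h'
  · exact key i j h'
  · intro h0
    refine key j i h' ?_
    simp only [Triple.cross, Triple.zero, Triple.mk.injEq] at h0 ⊢
    refine ⟨?_, ?_, ?_⟩ <;> linarith [h0.1, h0.2.1, h0.2.2]

variable {b : Basis (Fin 3) ℝ V} {α : ι → Dual ℝ V}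

lemma isCoordinatisation_of_veeCheck [Fintype ι] (h : veeCheck l = true)
    (hα : ∀ i, α i = Real.sqrt (weights l e i) • covec b (points l e i))
    {i₀ i₁ i₂ : ι} (h₀ : points l e i₀ = ⟨1, 0, 0⟩) (h₁ : points l e i₁ = ⟨0, 1, 0⟩)
    (h₂ : points l e i₂ = ⟨0, 0, 1⟩) :
    IsCoordinatisation b α (points l e) (weights l e) fun i => Real.sqrt (weights l e i) where
  pos i := Real.sqrt_pos.2 (veeCheck_weights_pos e h i)
  sq i := Real.mul_self_sqrt (veeCheck_weights_pos e h i).le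
  eq_smul := hα
  cross_ne_zero _ _ hij := veeCheck_cross_ne_zero e h hij
  ne_zero := veeCheck_points_ne_zero e h
  det_ne_zero := by
    rw [gram_eq, ← SymMatrix.toReal_det, Ne, GoldenInt.toReal_eq_zero_iff]
    simp only [veeCheck, Bool.and_eq_true, Bool.not_eq_true'] at h
    simp [h.1]
  span_eq_top := by
    rw [eq_top_iff]
    intro f _
    have hs : ∀ i, covec b (points l e i) ∈ Submodule.span ℝ (Set.range α) := by
      intro i
      have hpos := (Real.sqrt_pos.2 (veeCheck_weights_pos e h i)).ne'
      have : covec b (points l e i) = (Real.sqrt (weights l e i))⁻¹ • α i := by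
        rw [hα, smul_smul, inv_mul_cancel₀ hpos, one_smul]
      rw [this]
      exact Submodule.smul_mem _ _ (Submodule.subset_span ⟨i, rfl⟩)
    have hf : f = f (b 0) • covec b (points l e i₀) + f (b 1) • covec b (points l e i₁)
        + f (b 2) • covec b (points l e i₂) := by
      apply coords_injective b
      rw [h₀, h₁, h₂]
      simp [coords, covec]
    rw [hf]
    exact add_mem (add_mem (Submodule.smul_mem _ _ (hs _)) (Submodule.smul_mem _ _ (hs _)))
      (Submodule.smul_mem _ _ (hs _))

lemma isVeeSystem_of_veeCheck [Fintype ι] [FiniteDimensional ℝ V] (h : veeCheck l = true)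
    {r : ι → ℝ} (hc : IsCoordinatisation b α (points l e) (weights l e) r) : IsVeeSystem α := by
  refine hc.isVeeSystem fun i j hij => ?_
  simp only [dualForm_points]
  -- the condition at `a` for the normal vector `n`
  have key : ∀ (n : Triple GoldenInt) (i : ι), veeCheckAt (listGram l).adj (l.get (e i)).1
      (l.filter fun k => (n.dot k.1).isZero) = true → Triple.cross
      ⟨∑ k, if n.toReal.dot (points l e k) = 0 then weights l e k *
          ((l.get (e k)).1.dot ((listGram l).adj.mulVec (l.get (e i)).1)).toReal *
          (points l e k).x else 0,
        ∑ k, if n.toReal.dot (points l e k) = 0 then weights l e k *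
          ((l.get (e k)).1.dot ((listGram l).adj.mulVec (l.get (e i)).1)).toReal *
          (points l e k).y else 0,
        ∑ k, if n.toReal.dot (points l e k) = 0 then weights l e k *
          ((l.get (e k)).1.dot ((listGram l).adj.mulVec (l.get (e i)).1)).toReal *
          (points l e k).z else 0⟩ (points l e i) = Triple.zero := by
    intro n i hv
    rw [veeCheckAt, ← Triple.toReal_eq_zero_iff, Triple.toReal_cross] at hv
    rw [← hv]
    simp only [dot_points_eq_zero_iff]
    congr 1
    simp only [Triple.toReal, ← sum_points_eq l e, GoldenInt.toReal_mul]
    rfl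
  rcases exists_veeCheckPair e h hij with h' | h'
  · simp only [veeCheckPair, Bool.and_eq_true] at h'
    have := key _ i h'.2.1
    simp only [Triple.toReal_cross] at this
    exact this
  · simp only [veeCheckPair, Bool.and_eq_true] at h'
    have := key _ i h'.2.2
    simp only [Triple.toReal_cross] at this
    have hsw : ∀ k, ((points l e i).cross (points l e j)).dot (points l e k) = 0 ↔
        ((l.get (e j)).1.toReal.cross (l.get (e i)).1.toReal).dot (points l e k) = 0 := by
      intro k
      have : ((points l e i).cross (points l e j)).dot (points l e k) =
        -((l.get (e j)).1.toReal.cross (l.get (e i)).1.toReal).dot (points l e k) := by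
        simp only [Triple.cross, Triple.dot, points]; ring
      rw [this, neg_eq_zero]
    simpa only [hsw] using this

end Certificates

/-! ### Solving the linearised vee-conditions modulo a prime -/

namespace GoldenInt

instance : CommRing GoldenInt where
  add_assoc _ _ _ := toReal_injective (by simp only [toReal_add]; ring)
  zero_add _ := toReal_injective (by simp)
  add_zero _ := toReal_injective (by simp)
  add_comm _ _ := toReal_injective (by simp only [toReal_add]; ring)
  left_distrib _ _ _ := toReal_injective (by simp only [toReal_add, toReal_mul]; ring)
  right_distrib _ _ _ := toReal_injective (by simp only [toReal_add, toReal_mul]; ring)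
  zero_mul _ := toReal_injective (by simp)
  mul_zero _ := toReal_injective (by simp)
  mul_assoc _ _ _ := toReal_injective (by simp only [toReal_mul]; ring)
  one_mul _ := toReal_injective (by simp)
  mul_one _ := toReal_injective (by simp)
  mul_comm _ _ := toReal_injective (by simp only [toReal_mul]; ring)
  neg_add_cancel _ := toReal_injective (by simp)
  sub_eq_add_neg _ _ := toReal_injective (by simp only [toReal_sub, toReal_add, toReal_neg]; ring)
  nsmul := nsmulRec
  zsmul := zsmulRec

/-- The embedding of the golden integers into the reals. -/
def toRealHom : GoldenInt →+* ℝ where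
  toFun := toReal
  map_zero' := toReal_zero
  map_one' := toReal_one
  map_add' := toReal_add
  map_mul' := toReal_mul

/-- The reduction of the golden integers modulo a prime `p`, given a solution `g` of `g² = g + 1`
modulo `p`. -/
def reduceHom (p : ℕ) (g : ℤ) (hg : (g : ZMod p) * g = g + 1) : GoldenInt →+* ZMod p where
  toFun z := z.re + z.im * g
  map_zero' := by change (((0 : ℤ) : ZMod p) + ((0 : ℤ) : ZMod p) * g) = 0; simp
  map_one' := by change (((1 : ℤ) : ZMod p) + ((0 : ℤ) : ZMod p) * g) = 1; simp
  map_add' z w := by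
    change (((z.re + w.re : ℤ) : ZMod p) + ((z.im + w.im : ℤ) : ZMod p) * g) = _
    push_cast; ring
  map_mul' z w := by
    change (((z.re * w.re + z.im * w.im : ℤ) : ZMod p)
      + ((z.re * w.im + z.im * w.re + z.im * w.im : ℤ) : ZMod p) * g) = _
    push_cast
    linear_combination (-(z.im : ZMod p) * w.im) * hg

/-- A representative of the reduction modulo `p`. -/
def reduceMod (p g : ℤ) (z : GoldenInt) : ℤ := (z.re + z.im * g) % p

end GoldenInt

/-- The combination `h s - k r` of two rows modulo `p`. -/
def combineRows (p h k : ℤ) : List ℤ → List ℤ → List ℤ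
  | x :: r, y :: s => (h * y - k * x) % p :: combineRows p h k r s
  | [], s => s.map fun y => (h * y) % p
  | r, [] => r.map fun x => (-k * x) % p

/-- Splits off the first row whose first entry is not zero modulo `p`. -/
def splitPivot (p : ℤ) : List (List ℤ) → Option (List ℤ × List (List ℤ))
  | [] => none
  | r :: rows => if r.headD 0 % p == 0 then
      (splitPivot p rows).map fun q => (q.1, r :: q.2) else some (r, rows)

/-- Gaussian elimination modulo `p`, column by column, for rows with `m` columns: decides whether
only the zero vector is annihilated by all the rows. -/
def eliminate (p : ℤ) : ℕ → List (List ℤ) → Bool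
  | 0, _ => true
  | m + 1, rows =>
    match splitPivot p rows with
    | none => false
    | some (r, rest) =>
      eliminate p m (rest.map fun s => combineRows p (r.headD 0) (s.headD 0) r.tail s.tail)

section Elimination

variable {p : ℕ}

lemma getD_map_of_apply_eq {A B : Type*} (f : A → B) (a : A) (b : B) (h : f a = b)
    (l : List A) (j : ℕ) : (l.map f).getD j b = f (l.getD j a) := by
  subst h
  induction l generalizing j with
  | nil => simp
  | cons x l ih => cases j with
    | zero => simp
    | succ j => simp

lemma cast_getD_combineRows (h k : ℤ) (r s : List ℤ) (j : ℕ) :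
    (((combineRows p h k r s).getD j 0 : ℤ) : ZMod p)
      = h * ((s.getD j 0 : ℤ) : ZMod p) - k * ((r.getD j 0 : ℤ) : ZMod p) := by
  induction r generalizing s j with
  | nil =>
    rw [combineRows, getD_map_of_apply_eq _ 0 0 (by simp)]
    simp [ZMod.intCast_mod]
  | cons x r ih =>
    cases s with
    | nil =>
      rw [combineRows, getD_map_of_apply_eq _ 0 0 (by simp)]
      · simp [ZMod.intCast_mod]
      · simp
    | cons y s =>
      rw [combineRows]
      cases j with
      | zero => simp [ZMod.intCast_mod]
      | succ j => simpa using ih s j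

lemma splitPivot_eq_some {rows rest : List (List ℤ)} {r : List ℤ}
    (h : splitPivot p rows = some (r, rest)) :
    r.headD 0 % p ≠ 0 ∧ r ∈ rows ∧ ∀ s ∈ rest, s ∈ rows := by
  induction rows generalizing rest with
  | nil => simp [splitPivot] at h
  | cons t rows ih =>
    rw [splitPivot] at h
    split_ifs at h with h0
    · simp only [Option.map_eq_some_iff, Prod.mk.injEq] at h
      obtain ⟨⟨r', rest'⟩, h1, rfl, rfl⟩ := h
      obtain ⟨h2, h3, h4⟩ := ih h1
      refine ⟨h2, List.mem_cons_of_mem _ h3, fun s hs => ?_⟩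
      rcases List.mem_cons.1 hs with rfl | hs
      · exact List.mem_cons_self
      · exact List.mem_cons_of_mem _ (h4 s hs)
    · simp only [Option.some.injEq, Prod.mk.injEq] at h
      obtain ⟨rfl, rfl⟩ := h
      exact ⟨by simpa using h0, List.mem_cons_self, fun s hs => List.mem_cons_of_mem _ hs⟩

lemma sum_getD_succ {m : ℕ} (r : List ℤ) (v : Fin (m + 1) → ZMod p) :
    ∑ j : Fin (m + 1), ((r.getD j 0 : ℤ) : ZMod p) * v j = ((r.headD 0 : ℤ) : ZMod p) * v 0
      + ∑ j : Fin m, ((r.tail.getD j 0 : ℤ) : ZMod p) * v j.succ := by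
  rw [Fin.sum_univ_succ]
  cases r <;> simp

variable [Fact p.Prime]

lemma eq_zero_of_eliminate {m : ℕ} {rows : List (List ℤ)} (h : eliminate p m rows = true)
    (v : Fin m → ZMod p) (hv : ∀ r ∈ rows, ∑ j : Fin m, ((r.getD j 0 : ℤ) : ZMod p) * v j = 0) :
    v = 0 := by
  induction m generalizing rows with
  | zero => exact Subsingleton.elim _ _
  | succ m ih =>
    rw [eliminate] at h
    split at h
    · simp at h
    · next r rest hsp =>
      obtain ⟨h1, h2, h3⟩ := splitPivot_eq_some hsp
      have hr := hv r h2
      rw [sum_getD_succ] at hr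
      have htail : (fun j : Fin m => v j.succ) = 0 := by
        refine ih h _ fun t ht => ?_
        obtain ⟨s, hs, rfl⟩ := List.mem_map.1 ht
        have hs' := hv s (h3 s hs)
        rw [sum_getD_succ] at hs'
        simp only [cast_getD_combineRows, sub_mul, Finset.sum_sub_distrib, mul_assoc,
          ← Finset.mul_sum]
        linear_combination ((r.headD 0 : ℤ) : ZMod p) * hs' - ((s.headD 0 : ℤ) : ZMod p) * hr
      have htail' : ∀ j : Fin m, v j.succ = 0 := fun j => congrFun htail j
      have h0 : v 0 = 0 := by
        simp only [htail', mul_zero, Finset.sum_const_zero, add_zero] at hr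
        refine (mul_eq_zero.1 hr).resolve_left fun h0 => h1 ?_
        rw [ZMod.intCast_zmod_eq_zero_iff_dvd] at h0
        exact Int.emod_eq_zero_of_dvd h0
      funext j
      refine Fin.cases h0 (fun j => htail' j) j

/-- A square system of linear equations over the golden integers which has only the zero solution
modulo a prime has only the zero solution over the reals: its determinant does not vanish. -/
lemma eq_zero_of_eliminate_reduceMod {g : ℤ} (hg : (g : ZMod p) * g = g + 1) {m : ℕ}
    {rows : List (List GoldenInt)} (hm : rows.length = m)
    (h : eliminate p m (rows.map fun r => r.map (GoldenInt.reduceMod p g)) = true)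
    (v : Fin m → ℝ) (hv : ∀ r ∈ rows, ∑ j : Fin m, (r.getD j 0).toReal * v j = 0) : v = 0 := by
  subst hm
  let M : Matrix (Fin rows.length) (Fin rows.length) GoldenInt :=
    Matrix.of fun i j => (rows.get i).getD j 0
  have hp : (M.map (GoldenInt.reduceHom p g hg)).det ≠ 0 := by
    intro hdet
    obtain ⟨u, hu, hMu⟩ := Matrix.exists_mulVec_eq_zero_iff.2 hdet
    refine hu (eq_zero_of_eliminate h u fun r hr => ?_)
    obtain ⟨s, hs, rfl⟩ := List.mem_map.1 hr
    obtain ⟨i, rfl⟩ := List.mem_iff_get.1 hs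
    have := congrFun hMu i
    simp only [Matrix.mulVec, dotProduct, Pi.zero_apply] at this
    rw [← this]
    refine Finset.sum_congr rfl fun j _ => ?_
    rw [getD_map_of_apply_eq _ (0 : GoldenInt) 0 (by
      change ((0 : ℤ) + (0 : ℤ) * g) % p = 0; simp)]
    simp [GoldenInt.reduceMod, GoldenInt.reduceHom, M, ZMod.intCast_mod]
  have hM : M.det ≠ 0 := by
    intro h0
    apply hp
    have := RingHom.map_det (GoldenInt.reduceHom p g hg) M
    rw [h0, map_zero] at this
    exact this.symm
  have hR : (M.map GoldenInt.toRealHom).det ≠ 0 := by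
    have := RingHom.map_det GoldenInt.toRealHom M
    rw [RingHom.mapMatrix_apply] at this
    rw [← this]
    intro h0
    exact hM (GoldenInt.toReal_injective (h0.trans GoldenInt.toReal_zero.symm))
  by_contra hv0
  refine hR (Matrix.exists_mulVec_eq_zero_iff.1 ⟨v, hv0, ?_⟩)
  funext i
  exact hv _ (List.get_mem rows i)

end Elimination

/-- The linearised vee-condition, as a row of coefficients, of the plane spanned by `a` and `b` if
there are no further covectors in the plane. -/
def twoRow (l : List WeightedPoint) (A : SymMatrix GoldenInt) (a b : Triple GoldenInt) :
    List GoldenInt :=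
  let n := a.cross b
  if !n.isZero && l.all fun k => !(n.dot k.1).isZero || ((k.1.cross a).isZero ||
      (k.1.cross b).isZero) then
    let u := A.mulVec a
    let v := A.mulVec b
    l.map fun k => k.2 * k.1.dot u * k.1.dot v
  else []

/-- One of the linearised vee-conditions, as a row of coefficients, of the plane spanned by `a` and
`b` if there are further covectors in the plane: the values of the two forms, the one of which is a
multiple of the other, are compared at the pairs `(f, h)` and `(f', h')`. -/
def manyRow (l : List WeightedPoint) (A : SymMatrix GoldenInt) (d : GoldenInt)
    (a b f h f' h' : Triple GoldenInt) : List GoldenInt :=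
  let n := a.cross b
  if !n.isZero && l.any fun k => (n.dot k.1).isZero && (!(k.1.cross a).isZero &&
      !(k.1.cross b).isZero) then
    let u := A.mulVec a
    let N := listSum (fun k => k.2 * k.1.dot u * k.1.dot u)
      (l.filter fun k => (n.dot k.1).isZero)
    let D := d * a.dot u
    let uf := A.mulVec f
    let uh := A.mulVec h
    let uf' := A.mulVec f'
    let uh' := A.mulVec h'
    let x := f.dot uh
    let x' := f'.dot uh'
    l.map fun k => k.2 * ((if (n.dot k.1).isZero then D else 0) - N) *
      (k.1.dot uf * k.1.dot uh * x' - k.1.dot uf' * k.1.dot uh' * x)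
  else []

/-- The row of coefficients of a linearised vee-condition of the plane spanned by the covectors
with numbers `i` and `j`: the condition for planes with just two covectors if `t = 0`, and
otherwise one of those for planes with more, `t` selecting the two pairs of covectors at which the
forms are compared. The row is empty, hence void, if the number of covectors in the plane does not
fit. -/
def linearRow (l : List WeightedPoint) (A : SymMatrix GoldenInt) (d : GoldenInt)
    (i j t : ℕ) : List GoldenInt :=
  match l[i]?, l[j]? with
  | some a, some b =>
    match t with
    | 0 => twoRow l A a.1 b.1
    | 1 => manyRow l A d a.1 b.1 a.1 a.1 a.1 b.1
    | 2 => manyRow l A d a.1 b.1 b.1 b.1 a.1 b.1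
    | _ => manyRow l A d a.1 b.1 a.1 a.1 b.1 b.1
  | _, _ => []

/-- Checks, modulo the prime `p`, that the selected linearised vee-conditions have only the
constant solutions. There is one condition fewer than unknowns; that the rows have sum zero allows
to subtract the first unknown from all of them and to drop its column. -/
def linearCheck (l : List WeightedPoint) (p g : ℤ) (sel : List (ℕ × ℕ × ℕ)) : Bool :=
  let G := listGram l
  let A := G.adj
  let d := G.det
  let rows := sel.map fun s => linearRow l A d s.1 s.2.1 s.2.2
  rows.length + 1 == l.length && (rows.all (fun r => (listSum id r).isZero) &&
    eliminate p rows.length ((rows.map List.tail).map fun r => r.map (GoldenInt.reduceMod p g)))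

section Certificates

variable {ι : Type*} [Fintype ι] {l : List WeightedPoint} (e : ι ≃ Fin l.length)
  {V : Type*} [AddCommGroup V] [Module ℝ V] [FiniteDimensional ℝ V]
  {b : Basis (Fin 3) ℝ V} {α : ι → Dual ℝ V} {r ξ : ι → ℝ}

lemma twoRow_sound (hc : IsCoordinatisation b α (points l e) (weights l e) r)
    (hξ : LinearisedVeeConditions α ξ) (i j : ι) :
    twoRow l (listGram l).adj (l.get (e i)).1 (l.get (e j)).1 = [] ∨
    ∃ F : WeightedPoint → GoldenInt,
      twoRow l (listGram l).adj (l.get (e i)).1 (l.get (e j)).1 = l.map F ∧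
      ∑ k, (F (l.get (e k))).toReal * ξ k = 0 := by
  rw [twoRow]
  split_ifs with h
  · refine Or.inr ⟨_, rfl, ?_⟩
    simp only [Bool.and_eq_true, Bool.not_eq_true', List.all_eq_true, Bool.or_eq_true] at h
    have hij : i ≠ j := by
      rintro rfl
      have : (((l.get (e i)).1.cross (l.get (e i)).1)).isZero = true := by
        rw [← Triple.toReal_eq_zero_iff, Triple.toReal_cross]
        ext <;> simp only [Triple.cross, Triple.zero] <;> ring
      simp_all
    have := hc.sum_eq_zero_of_two hξ hij fun k hk => by
      have h1 := h.2 (l.get (e k)) (List.get_mem _ _)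
      have h2 : (((l.get (e i)).1.cross (l.get (e j)).1).dot (l.get (e k)).1).isZero = true := by
        rw [← dot_points_eq_zero_iff, Triple.toReal_cross]; exact hk
      simp only [← Triple.toReal_eq_zero_iff, Triple.toReal_cross] at h1
      rcases h1 with h1 | h1 | h1
      · rw [h1] at h2
        exact absurd h2 Bool.false_ne_true
      · exact Or.inl (by_contra fun hne => hc.cross_ne_zero k i hne h1)
      · exact Or.inr (by_contra fun hne => hc.cross_ne_zero k j hne h1)
    rw [← this]
    refine Finset.sum_congr rfl fun k _ => ?_
    rw [dualForm_points, dualForm_points, GoldenInt.toReal_mul, GoldenInt.toReal_mul]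
    rfl
  · exact Or.inl rfl

lemma manyRow_sound (hc : IsCoordinatisation b α (points l e) (weights l e) r)
    (hξ : LinearisedVeeConditions α ξ) (i j f h f' h' : ι) (hf : f = i ∨ f = j)
    (hh : h = i ∨ h = j) (hf' : f' = i ∨ f' = j) (hh' : h' = i ∨ h' = j) :
    manyRow l (listGram l).adj (listGram l).det (l.get (e i)).1 (l.get (e j)).1 (l.get (e f)).1
      (l.get (e h)).1 (l.get (e f')).1 (l.get (e h')).1 = [] ∨
    ∃ F : WeightedPoint → GoldenInt,
      manyRow l (listGram l).adj (listGram l).det (l.get (e i)).1 (l.get (e j)).1 (l.get (e f)).1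
        (l.get (e h)).1 (l.get (e f')).1 (l.get (e h')).1 = l.map F ∧
      ∑ k, (F (l.get (e k))).toReal * ξ k = 0 := by
  rw [manyRow]
  split_ifs with hn
  · refine Or.inr ⟨_, rfl, ?_⟩
    simp only [Bool.and_eq_true, Bool.not_eq_true', List.any_eq_true] at hn
    have hij : i ≠ j := by
      rintro rfl
      have : (((l.get (e i)).1.cross (l.get (e i)).1)).isZero = true := by
        rw [← Triple.toReal_eq_zero_iff, Triple.toReal_cross]
        ext <;> simp only [Triple.cross, Triple.zero] <;> ring
      simp_all
    obtain ⟨m, hm, hm0, hmi, hmj⟩ := hn.2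
    obtain ⟨m, rfl⟩ := List.mem_iff_get.1 hm
    obtain ⟨m, rfl⟩ := e.surjective m
    have hself : ∀ u : Triple GoldenInt, (u.cross u).isZero = true := by
      intro u
      rw [← Triple.toReal_eq_zero_iff, Triple.toReal_cross]
      ext <;> simp only [Triple.cross, Triple.zero] <;> ring
    have hmi' : m ≠ i := by rintro rfl; simp [hself] at hmi
    have hmj' : m ≠ j := by rintro rfl; simp [hself] at hmj
    have hiff : ∀ k, ((points l e i).cross (points l e j)).dot (points l e k) = 0 ↔
        (((l.get (e i)).1.cross (l.get (e j)).1).dot (l.get (e k)).1).isZero = true := by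
      intro k
      rw [← dot_points_eq_zero_iff, Triple.toReal_cross]; rfl
    obtain ⟨c, hcc⟩ := hc.exists_sum_eq_of_many hξ hij hmi' hmj' ((hiff m).2 hm0)
    have h1 := hcc f h hf hh
    have h2 := hcc f' h' hf' hh'
    simp only [hiff, dualForm_points] at h1 h2
    have hN : (∑ m, if (((l.get (e i)).1.cross (l.get (e j)).1).dot (l.get (e m)).1).isZero = true
        then weights l e m *
          ((l.get (e m)).1.dot ((listGram l).adj.mulVec (l.get (e i)).1)).toReal *
          ((l.get (e m)).1.dot ((listGram l).adj.mulVec (l.get (e i)).1)).toReal else 0)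
        = (listSum (fun k => k.2 * k.1.dot ((listGram l).adj.mulVec (l.get (e i)).1) *
          k.1.dot ((listGram l).adj.mulVec (l.get (e i)).1))
          (l.filter fun k => (((l.get (e i)).1.cross (l.get (e j)).1).dot k.1).isZero)).toReal := by
      rw [← sum_points_eq l e]
      simp only [GoldenInt.toReal_mul]
      rfl
    rw [hN, gram_eq] at h1 h2
    -- the unknown factor of proportionality is eliminated
    have key := congrArg₂ (fun x y => x * ((l.get (e f')).1.dot
      ((listGram l).adj.mulVec (l.get (e h')).1)).toReal
      - y * ((l.get (e f)).1.dot ((listGram l).adj.mulVec (l.get (e h)).1)).toReal) h1 h2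
    rw [Finset.sum_mul, Finset.sum_mul, ← Finset.sum_sub_distrib] at key
    trans c * ((l.get (e f)).1.dot ((listGram l).adj.mulVec (l.get (e h)).1)).toReal *
      ((l.get (e f')).1.dot ((listGram l).adj.mulVec (l.get (e h')).1)).toReal -
      c * ((l.get (e f')).1.dot ((listGram l).adj.mulVec (l.get (e h')).1)).toReal *
      ((l.get (e f)).1.dot ((listGram l).adj.mulVec (l.get (e h)).1)).toReal
    · rw [← key]
      refine Finset.sum_congr rfl fun k _ => ?_
      have hD : (if (((l.get (e i)).1.cross (l.get (e j)).1).dot (l.get (e k)).1).isZero = true then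
          (listGram l).det * (l.get (e i)).1.dot ((listGram l).adj.mulVec (l.get (e i)).1)
          else 0).toReal = if (((l.get (e i)).1.cross (l.get (e j)).1).dot (l.get (e k)).1).isZero
            = true then (listGram l).toReal.det *
            ((l.get (e i)).1.dot ((listGram l).adj.mulVec (l.get (e i)).1)).toReal else 0 := by
        split_ifs
        · rw [GoldenInt.toReal_mul, SymMatrix.toReal_det]
        · exact GoldenInt.toReal_zero
      simp only [GoldenInt.toReal_mul, GoldenInt.toReal_sub, hD]
      simp only [weights]
      ring
    · ring
  · exact Or.inl rfl

lemma linearRow_sound (hc : IsCoordinatisation b α (points l e) (weights l e) r)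
    (hξ : LinearisedVeeConditions α ξ) (i j t : ℕ) :
    linearRow l (listGram l).adj (listGram l).det i j t = [] ∨
    ∃ F : WeightedPoint → GoldenInt,
      linearRow l (listGram l).adj (listGram l).det i j t = l.map F ∧
      ∑ k, (F (l.get (e k))).toReal * ξ k = 0 := by
  rw [linearRow]
  split
  · next x y hx hy =>
    obtain ⟨hi, rfl⟩ := List.getElem?_eq_some_iff.1 hx
    obtain ⟨hj, rfl⟩ := List.getElem?_eq_some_iff.1 hy
    obtain ⟨i', hi'⟩ := e.surjective ⟨i, hi⟩
    obtain ⟨j', hj'⟩ := e.surjective ⟨j, hj⟩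
    have h1 : l[i] = l.get (e i') := by rw [hi']; rfl
    have h2 : l[j] = l.get (e j') := by rw [hj']; rfl
    rw [h1, h2]
    split
    · exact twoRow_sound e hc hξ i' j'
    all_goals exact manyRow_sound e hc hξ i' j' _ _ _ _ (by simp) (by simp) (by simp) (by simp)
  · exact Or.inl rfl

/-- The certificate for the linearised vee-conditions: the differences of the unknowns solve a
square system which is invertible modulo `p`. -/
theorem eq_const_of_linearCheck {p : ℕ} [Fact p.Prime] {g : ℤ} (hg : (g : ZMod p) * g = g + 1)
    {sel : List (ℕ × ℕ × ℕ)} (h : linearCheck l p g sel = true)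
    (hc : IsCoordinatisation b α (points l e) (weights l e) r)
    (hξ : LinearisedVeeConditions α ξ) : ∃ c, ∀ i, ξ i = c := by
  simp only [linearCheck, Bool.and_eq_true, beq_iff_eq] at h
  set rows := sel.map fun s => linearRow l (listGram l).adj (listGram l).det s.1 s.2.1 s.2.2
    with hrows
  obtain ⟨hlen, hzero, helim⟩ := h
  set m := rows.length with hm
  let ζ : Fin (m + 1) → ℝ := fun k => ξ (e.symm (Fin.cast hlen k))
  have hrow : ∀ s ∈ rows, ∑ k : Fin (m + 1), (s.getD k 0).toReal * ζ k = 0 := by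
    intro s hs
    obtain ⟨q, _, rfl⟩ := List.mem_map.1 hs
    rcases linearRow_sound e hc hξ q.1 q.2.1 q.2.2 with h | ⟨F, h, hF⟩
    · simp [h]
    · simp only [h]
      rw [← hF, ← Equiv.sum_comp (e.symm), ← Equiv.sum_comp (finCongr hlen)]
      refine Finset.sum_congr rfl fun k _ => ?_
      have hk : (k : ℕ) < l.length := by rw [← hlen]; exact k.2
      have : (l.map F).getD k 0 = F (l.get (e (e.symm (finCongr hlen k)))) := by
        rw [List.getD_eq_getElem _ _ (by simpa using hk)]
        simp
      rw [this]
      rfl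
  have hrow1 : ∀ s ∈ rows, ∑ k : Fin (m + 1), (s.getD k 0).toReal = 0 := by
    intro s hs
    have h0 := List.all_eq_true.1 hzero s hs
    rw [← GoldenInt.toReal_eq_zero_iff, toReal_listSum] at h0
    obtain ⟨q, _, rfl⟩ := List.mem_map.1 hs
    rcases linearRow_sound e hc hξ q.1 q.2.1 q.2.2 with h | ⟨F, h, hF⟩
    · simp [h]
    · have hl : (linearRow l (listGram l).adj (listGram l).det q.1 q.2.1 q.2.2).length = m + 1 := by
        rw [h, List.length_map, hlen]
      rw [← h0, ← Equiv.sum_comp (finCongr hl.symm)]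
      refine Finset.sum_congr rfl fun k _ => ?_
      rw [List.getD_eq_getElem _ _ (by rw [hl]; exact k.2)]
      rfl
  -- the differences with the first unknown solve a square system
  have hdiff : (fun k : Fin m => ζ k.succ - ζ 0) = 0 := by
    refine eq_zero_of_eliminate_reduceMod hg (by rw [List.length_map]) helim _ fun s hs => ?_
    obtain ⟨s, hs', rfl⟩ := List.mem_map.1 hs
    have h1 := hrow s hs'
    have h2 := hrow1 s hs'
    rw [Fin.sum_univ_succ] at h1 h2
    have h3 : ∀ k : ℕ, s.tail.getD k 0 = s.getD (k + 1) 0 := by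
      intro k; cases s <;> simp
    simp only [h3, mul_sub, Finset.sum_sub_distrib, ← Finset.sum_mul]
    simp only [Fin.val_succ, Fin.val_zero] at h1 h2
    linear_combination h1 - ζ 0 * h2
  refine ⟨ζ 0, fun i => ?_⟩
  have hall : ∀ k : Fin (m + 1), ζ k = ζ 0 := by
    intro k
    refine Fin.cases rfl (fun k => ?_) k
    have := congrFun hdiff k
    simpa [sub_eq_zero] using this
  have := hall (Fin.cast hlen.symm (e i))
  rw [← this]
  simp [ζ]

end Certificates

/-! ### Projective rigidity by successive intersections of lines -/

namespace Triple

lemma Par.refl (u : Triple ℝ) : Par u u := ⟨1, one_ne_zero, by simp [smul]⟩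

lemma Par.det_eq_zero_iff {u u' v v' w w' : Triple ℝ} (hu : Par u u') (hv : Par v v')
    (hw : Par w w') : det u v w = 0 ↔ det u' v' w' = 0 := by
  obtain ⟨r, hr, rfl⟩ := hu
  obtain ⟨s, hs, rfl⟩ := hv
  obtain ⟨t, ht, rfl⟩ := hw
  rw [det_smul]
  simp [hr, hs, ht]

end Triple

/-- The point with number `k` of a list. -/
def pointAt (l : List WeightedPoint) (k : ℕ) : Triple GoldenInt :=
  (l.getD k (⟨0, 0, 0⟩, 0)).1

/-- Checks that all points of a list arise from the known ones by the construction steps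
`(k, (a, b), (c, d))`: the line of the point `k` is the intersection of the plane of `a` and `b` with the
plane of `c` and `d`. -/
def stepsCheck (l : List WeightedPoint) : List ℕ → List (ℕ × (ℕ × ℕ) × (ℕ × ℕ)) → Bool
  | known, [] => (List.range l.length).all known.contains
  | known, (k, (a, b), (c, d)) :: s =>
    let m := (pointAt l a).cross (pointAt l b)
    let n := (pointAt l c).cross (pointAt l d)
    known.contains a && (known.contains b && (known.contains c && (known.contains d &&
      (decide (k < l.length) && ((m.dot (pointAt l k)).isZero && ((n.dot (pointAt l k)).isZero &&
      (!(m.cross n).isZero && stepsCheck l (k :: known) s)))))))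

section Steps

variable {ι : Type*} {l : List WeightedPoint} (e : ι ≃ Fin l.length)

lemma toReal_pointAt (i : ι) : (pointAt l (e i)).toReal = points l e i := by
  rw [pointAt, List.getD_eq_getElem _ _ (e i).2]
  rfl

lemma par_of_stepsCheck {q : ι → Triple ℝ} (hp : ∀ i, points l e i ≠ Triple.zero)
    (hq : ∀ i, q i ≠ Triple.zero)
    (hdet : ∀ i j k, Triple.det (q i) (q j) (q k) = 0 ↔
      Triple.det (points l e i) (points l e j) (points l e k) = 0)
    {known : List ℕ} {steps : List (ℕ × (ℕ × ℕ) × (ℕ × ℕ))}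
    (h : stepsCheck l known steps = true)
    (hknown : ∀ k ∈ known, ∃ i, (e i : ℕ) = k ∧ (q i).Par (points l e i)) (i : ι) :
    (q i).Par (points l e i) := by
  induction steps generalizing known with
  | nil =>
    simp only [stepsCheck, List.all_eq_true, List.contains_iff_mem] at h
    obtain ⟨j, hj, hpar⟩ := hknown (e i) (h _ (List.mem_range.2 (e i).2))
    obtain rfl : j = i := e.injective (Fin.ext hj)
    exact hpar
  | cons s steps ih =>
    obtain ⟨k, ⟨a, b⟩, c, d⟩ := s
    simp only [stepsCheck, Bool.and_eq_true, List.contains_iff_mem, decide_eq_true_eq,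
      Bool.not_eq_true'] at h
    obtain ⟨ha, hb, hc, hd, hk, hm, hn, hmn, hrest⟩ := h
    refine ih hrest fun k' hk' => ?_
    rcases List.mem_cons.1 hk' with rfl | hk'
    · obtain ⟨a, rfl, pa⟩ := hknown a ha
      obtain ⟨b, rfl, pb⟩ := hknown b hb
      obtain ⟨c, rfl, pc⟩ := hknown c hc
      obtain ⟨d, rfl, pd⟩ := hknown d hd
      obtain ⟨i, hi⟩ := e.surjective ⟨k', hk⟩
      have hi' : (e i : ℕ) = k' := by rw [hi]
      refine ⟨i, hi', ?_⟩
      rw [← hi'] at hm hn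
      rw [← GoldenInt.toReal_eq_zero_iff, Triple.toReal_dot, Triple.toReal_cross, toReal_pointAt,
        toReal_pointAt, toReal_pointAt] at hm hn
      have hmn' : ((points l e a).cross (points l e b)).cross
          ((points l e c).cross (points l e d)) ≠ Triple.zero := by
        intro h0
        rw [← toReal_pointAt, ← toReal_pointAt, ← toReal_pointAt, ← toReal_pointAt,
          ← Triple.toReal_cross, ← Triple.toReal_cross, ← Triple.toReal_cross,
          Triple.toReal_eq_zero_iff, hmn] at h0
        exact Bool.false_ne_true h0
      refine Triple.par_of_dot_eq_zero hmn' (hq i) (hp i) ?_ ?_ hm hn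
      · exact (Triple.Par.det_eq_zero_iff pa pb (Triple.Par.refl _)).1 ((hdet a b i).2 hm)
      · exact (Triple.Par.det_eq_zero_iff pc pd (Triple.Par.refl _)).1 ((hdet c d i).2 hn)
    · exact hknown k' hk'

lemma isProjectivelyRigid_of_stepsCheck (hp : ∀ i, points l e i ≠ Triple.zero) {i₀ i₁ i₂ i₃ : ι}
    {steps : List (ℕ × (ℕ × ℕ) × (ℕ × ℕ))}
    (h : stepsCheck l [(e i₀ : ℕ), e i₁, e i₂, e i₃] steps = true) :
    IsProjectivelyRigid (points l e) i₀ i₁ i₂ i₃ := by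
  intro ε _ q hq t ht
  refine par_of_stepsCheck e hp (hq.ne_zero t ht) (hq.det_eq_zero_iff t ht) h fun k hk => ?_
  obtain ⟨h0, h1, h2, h3⟩ := hq.frame t ht
  simp only [List.mem_cons, List.not_mem_nil, or_false] at hk
  rcases hk with rfl | rfl | rfl | rfl
  exacts [⟨_, rfl, h0⟩, ⟨_, rfl, h1⟩, ⟨_, rfl, h2⟩, ⟨_, rfl, h3⟩]

end Steps

/-! ### The golden configuration -/

section Golden

variable {ι : Type*} {p : ι → Triple ℝ}

/-- The incidences of a configuration of nine points of the projective plane, which make the point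
`x` divide the line through `a` and `d` in a ratio related to the golden one. -/
structure IsGoldenConfiguration (p : ι → Triple ℝ) (a b c d e f x y z : ι) : Prop where
  abe : Triple.det (p a) (p b) (p e) = 0
  cde : Triple.det (p c) (p d) (p e) = 0
  adf : Triple.det (p a) (p d) (p f) = 0
  bcf : Triple.det (p b) (p c) (p f) = 0
  adx : Triple.det (p a) (p d) (p x) = 0
  cxy : Triple.det (p c) (p x) (p y) = 0
  efy : Triple.det (p e) (p f) (p y) = 0
  ayz : Triple.det (p a) (p y) (p z) = 0
  bdz : Triple.det (p b) (p d) (p z) = 0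
  xez : Triple.det (p x) (p e) (p z) = 0
  abx : Triple.det (p a) (p b) (p x) ≠ 0

/-- In the projective frame `a, b, c, d` the point `x` of a golden configuration is `(s, 1, 1)` with
`s² - 3 s + 1 = 0`. -/
lemma IsGoldenConfiguration.quadratic {a b c d e f x y z : ι}
    (h : IsGoldenConfiguration p a b c d e f x y z) (hne : ∀ i, p i ≠ Triple.zero)
    (ha : (p a).Par ⟨1, 0, 0⟩) (hb : (p b).Par ⟨0, 1, 0⟩) (hc : (p c).Par ⟨0, 0, 1⟩)
    (hd : (p d).Par ⟨1, 1, 1⟩) :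
    (p x).y ≠ 0 ∧ (p x).z = (p x).y ∧ (2 * ((p x).x / (p x).y) - 3) ^ 2 = 5 := by
  have rf := Triple.Par.refl
  have hzx : (p x).z = (p x).y := by
    have := (Triple.Par.det_eq_zero_iff ha hd (rf _)).1 h.adx
    simp only [Triple.det, Triple.dot, Triple.cross] at this
    linarith
  have hyx : (p x).y ≠ 0 := by
    intro h0
    refine h.abx ((Triple.Par.det_eq_zero_iff ha hb (rf _)).2 ?_)
    simp only [Triple.det, Triple.dot, Triple.cross]
    rw [hzx, h0]; ring
  have he : (p e).Par ⟨1, 1, 0⟩ := by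
    have h1 := (Triple.Par.det_eq_zero_iff ha hb (rf _)).1 h.abe
    have h2 := (Triple.Par.det_eq_zero_iff hc hd (rf _)).1 h.cde
    simp only [Triple.det, Triple.dot, Triple.cross] at h1 h2
    refine ⟨(p e).x, fun h0 => hne e ?_, ?_⟩
    · ext <;> simp only [Triple.zero] <;> linarith
    · ext <;> simp only [Triple.smul] <;> linarith
  have hf : (p f).Par ⟨0, 1, 1⟩ := by
    have h1 := (Triple.Par.det_eq_zero_iff ha hd (rf _)).1 h.adf
    have h2 := (Triple.Par.det_eq_zero_iff hb hc (rf _)).1 h.bcf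
    simp only [Triple.det, Triple.dot, Triple.cross] at h1 h2
    refine ⟨(p f).y, fun h0 => hne f ?_, ?_⟩
    · ext <;> simp only [Triple.zero] <;> linarith
    · ext <;> simp only [Triple.smul] <;> linarith
  have h1 := (Triple.Par.det_eq_zero_iff hc (rf (p x)) (rf (p y))).1 h.cxy
  have h2 := (Triple.Par.det_eq_zero_iff he hf (rf (p y))).1 h.efy
  have h3 := (Triple.Par.det_eq_zero_iff hb hd (rf (p z))).1 h.bdz
  have h4 := (Triple.Par.det_eq_zero_iff ha (rf (p y)) (rf (p z))).1 h.ayz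
  have h5 := (Triple.Par.det_eq_zero_iff (rf (p x)) he (rf (p z))).1 h.xez
  simp only [Triple.det, Triple.dot, Triple.cross] at h1 h2 h3 h4 h5
  rw [hzx] at h1 h5
  have hzz : (p z).z = (p z).x := by linarith
  have hwy : (p y).z = (p y).y - (p y).x := by linarith
  rw [hzz] at h4 h5
  rw [hwy] at h4
  have hxz : (p z).x ≠ 0 := by
    intro h0
    have : (p x).y * (p z).y = 0 := by rw [h0] at h5; linarith
    have := (mul_eq_zero.1 this).resolve_left hyx
    exact hne z (Triple.ext h0 this (hzz.trans h0))
  have hyy : (p y).y ≠ 0 := by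
    intro h0
    have : (p x).y * (p y).x = 0 := by rw [h0] at h1; linarith
    have := (mul_eq_zero.1 this).resolve_left hyx
    exact hne y (Triple.ext this h0 (by rw [hwy, h0, this, sub_zero]; rfl))
  have hq : (p x).y ^ 2 = ((p x).y - (p x).x) * (2 * (p x).y - (p x).x) := by
    have : (p y).y * (p z).x * ((p x).y ^ 2 -
        ((p x).y - (p x).x) * (2 * (p x).y - (p x).x)) = 0 := by
      linear_combination (p x).y ^ 2 * h4 + (p x).y * ((p y).y - (p y).x) * h5
        + (2 * (p x).y - (p x).x) * (p z).x * h1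
    have := (mul_eq_zero.1 this).resolve_left (mul_ne_zero hyy hxz)
    linarith
  refine ⟨hyx, hzx, ?_⟩
  field_simp
  linear_combination -4 * hq

/-- A framed motion keeps the point `x` of a golden configuration, as its coordinate satisfies a
quadratic equation and depends continuously on the parameter. -/
lemma IsFramedMotion.par_of_isGoldenConfiguration {a b c d e f x y z : ι} {ε : ℝ} (hε : 0 < ε)
    {q : ℝ → ι → Triple ℝ} (hq : IsFramedMotion p a b c d (Set.Ioo (-ε) ε) q)
    (hp : IsGoldenConfiguration p a b c d e f x y z)
    (ha : p a = ⟨1, 0, 0⟩) (hb : p b = ⟨0, 1, 0⟩) (hc : p c = ⟨0, 0, 1⟩)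
    {κ : ℝ} (hκ : κ ≠ 0) (hd : p d = ⟨κ, κ, κ⟩) {t : ℝ} (ht : t ∈ Set.Ioo (-ε) ε) :
    (q t x).Par (p x) := by
  have h0 : (0 : ℝ) ∈ Set.Ioo (-ε) ε := ⟨by linarith, hε⟩
  have hdp : (p d).Par ⟨1, 1, 1⟩ := ⟨κ, hκ, by simp [hd, Triple.smul]⟩
  have key : ∀ t ∈ Set.Ioo (-ε) ε, (q t x).y ≠ 0 ∧ (q t x).z = (q t x).y ∧
      (2 * ((q t x).x / (q t x).y) - 3) ^ 2 = 5 := by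
    intro t ht
    have hD := hq.det_eq_zero_iff t ht
    obtain ⟨f0, f1, f2, f3⟩ := hq.frame t ht
    rw [ha] at f0
    rw [hb] at f1
    rw [hc] at f2
    exact IsGoldenConfiguration.quadratic
      ⟨(hD _ _ _).2 hp.abe, (hD _ _ _).2 hp.cde, (hD _ _ _).2 hp.adf, (hD _ _ _).2 hp.bcf,
        (hD _ _ _).2 hp.adx, (hD _ _ _).2 hp.cxy, (hD _ _ _).2 hp.efy, (hD _ _ _).2 hp.ayz,
        (hD _ _ _).2 hp.bdz, (hD _ _ _).2 hp.xez, fun h => hp.abx ((hD _ _ _).1 h)⟩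
      (hq.ne_zero t ht) f0 f1 f2 (f3.trans hdp)
  have hcont : ContinuousOn (fun t => 2 * ((q t x).x / (q t x).y) - 3) (Set.Ioo (-ε) ε) :=
    (((hq.continuousOn_x x).div (hq.continuousOn_y x) fun t ht => (key t ht).1).const_mul
      2).sub continuousOn_const
  have h5 : (Real.sqrt 5) ^ 2 = 5 := Real.sq_sqrt (by norm_num)
  have h50 : Real.sqrt 5 ≠ 0 := by positivity
  have hconst : (q t x).x / (q t x).y = (q 0 x).x / (q 0 x).y := by
    rcases isPreconnected_Ioo.eq_or_eq_neg_of_sq_eq hcont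
      (continuousOn_const (c := Real.sqrt 5)) (fun t ht => by
        simp only [Pi.pow_apply]; rw [(key t ht).2.2, h5]) (fun _ => h50) with h | h
    · have h1 := h ht
      have h2 := h h0
      simp only at h1 h2
      linarith
    · have h1 := h ht
      have h2 := h h0
      simp only [Pi.neg_apply] at h1 h2
      linarith
  refine Triple.Par.trans ?_ (hq.initial x)
  obtain ⟨hy, hz, -⟩ := key t ht
  obtain ⟨hy0, hz0, -⟩ := key 0 h0
  refine ⟨(q t x).y / (q 0 x).y, div_ne_zero hy hy0, ?_⟩
  rw [div_eq_div_iff hy hy0] at hconst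
  ext <;> simp only [Triple.smul]
  · field_simp; linarith
  · field_simp
  · rw [hz, hz0]; field_simp

/-- Checks that the points with the given numbers form a golden configuration. -/
def goldenCheck (l : List WeightedPoint) (a b c d e f x y z : ℕ) : Bool :=
  let P := pointAt l
  [(a, b, e), (c, d, e), (a, d, f), (b, c, f), (a, d, x), (c, x, y), (e, f, y), (a, y, z),
    (b, d, z), (x, e, z)].all (fun t => ((P t.1).det (P t.2.1) (P t.2.2)).isZero) &&
    !((P a).det (P b) (P x)).isZero

variable {l : List WeightedPoint} (E : ι ≃ Fin l.length)

lemma isGoldenConfiguration_of_goldenCheck {a b c d e f x y z : ι}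
    (h : goldenCheck l (E a) (E b) (E c) (E d) (E e) (E f) (E x) (E y) (E z) = true) :
    IsGoldenConfiguration (points l E) a b c d e f x y z := by
  simp only [goldenCheck, List.all_cons, List.all_nil, Bool.and_true, Bool.and_eq_true,
    Bool.not_eq_true', ← GoldenInt.toReal_eq_zero_iff, Triple.toReal_det, toReal_pointAt] at h
  obtain ⟨⟨h1, h2, h3, h4, h5, h6, h7, h8, h9, h10⟩, h11⟩ := h
  refine ⟨h1, h2, h3, h4, h5, h6, h7, h8, h9, h10, fun h0 => ?_⟩
  simp only [← toReal_pointAt, ← Triple.toReal_det, GoldenInt.toReal_eq_zero_iff, h11] at h0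
  exact Bool.false_ne_true h0

lemma isProjectivelyRigid_of_goldenCheck (hp : ∀ i, points l E i ≠ Triple.zero)
    {a b c d e f x y z : ι}
    (hg : goldenCheck l (E a) (E b) (E c) (E d) (E e) (E f) (E x) (E y) (E z) = true)
    (ha : points l E a = ⟨1, 0, 0⟩) (hb : points l E b = ⟨0, 1, 0⟩)
    (hc : points l E c = ⟨0, 0, 1⟩) {κ : ℝ} (hκ : κ ≠ 0) (hd : points l E d = ⟨κ, κ, κ⟩)
    {steps : List (ℕ × (ℕ × ℕ) × (ℕ × ℕ))}
    (h : stepsCheck l [(E a : ℕ), E b, E c, E d, E x] steps = true) :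
    IsProjectivelyRigid (points l E) a b c d := by
  intro ε hε q hq t ht
  have hx := hq.par_of_isGoldenConfiguration hε (isGoldenConfiguration_of_goldenCheck E hg)
    ha hb hc hκ hd ht
  refine par_of_stepsCheck E hp (hq.ne_zero t ht) (hq.det_eq_zero_iff t ht) h fun k hk => ?_
  obtain ⟨h0, h1, h2, h3⟩ := hq.frame t ht
  simp only [List.mem_cons, List.not_mem_nil, or_false] at hk
  rcases hk with rfl | rfl | rfl | rfl | rfl
  exacts [⟨_, rfl, h0⟩, ⟨_, rfl, h1⟩, ⟨_, rfl, h2⟩, ⟨_, rfl, h3⟩, ⟨_, rfl, hx⟩]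

end Golden

/-! ### Rigidity from a finite certificate -/

section Rigid

variable {V : Type} [AddCommGroup V] [Module ℝ V] (b : Basis (Fin 3) ℝ V)

/-- The set of covectors `√w p` for the entries `(p, w)` of a list. -/
def listSystem (l : List WeightedPoint) : Set (Dual ℝ V) :=
  {α | ∃ q ∈ l, α = Real.sqrt q.2.toReal • covec b q.1.toReal}

/-- The points with numbers `0, 1, 2, m` are the standard projective frame, with the unit point
possibly scaled. -/
structure IsFramed (l : List WeightedPoint) (m : ℕ) : Prop where
  zero : pointAt l 0 = ⟨⟨1, 0⟩, ⟨0, 0⟩, ⟨0, 0⟩⟩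
  one : pointAt l 1 = ⟨⟨0, 0⟩, ⟨1, 0⟩, ⟨0, 0⟩⟩
  two : pointAt l 2 = ⟨⟨0, 0⟩, ⟨0, 0⟩, ⟨1, 0⟩⟩
  unit : ∃ κ : GoldenInt, κ.isZero = false ∧ pointAt l m = ⟨κ, κ, κ⟩
  lt : 2 < l.length ∧ m < l.length

lemma IsFramed.points_eq {l : List WeightedPoint} {m : ℕ} (h : IsFramed l m) {ι : Type*}
    (e : ι ≃ Fin l.length) {i₀ i₁ i₂ i₃ : ι} (h₀ : (e i₀ : ℕ) = 0) (h₁ : (e i₁ : ℕ) = 1)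
    (h₂ : (e i₂ : ℕ) = 2) (h₃ : (e i₃ : ℕ) = m) :
    points l e i₀ = ⟨1, 0, 0⟩ ∧ points l e i₁ = ⟨0, 1, 0⟩ ∧ points l e i₂ = ⟨0, 0, 1⟩ ∧
      ∃ κ : ℝ, κ ≠ 0 ∧ points l e i₃ = ⟨κ, κ, κ⟩ := by
  obtain ⟨κ, hκ, hu⟩ := h.unit
  have z : GoldenInt.toReal ⟨0, 0⟩ = 0 := GoldenInt.toReal_zero
  have o : GoldenInt.toReal ⟨1, 0⟩ = 1 := GoldenInt.toReal_one
  refine ⟨?_, ?_, ?_, κ.toReal, fun h0 => ?_, ?_⟩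
  · rw [← toReal_pointAt, h₀, h.zero]; simp [Triple.toReal, z, o]
  · rw [← toReal_pointAt, h₁, h.one]; simp [Triple.toReal, z, o]
  · rw [← toReal_pointAt, h₂, h.two]; simp [Triple.toReal, z, o]
  · rw [GoldenInt.toReal_eq_zero_iff, hκ] at h0; exact Bool.false_ne_true h0
  · rw [← toReal_pointAt, h₃, hu]; rfl

/-- A list of covectors that passes the checks is a rigid vee-system. -/
theorem isRigidVeeSystem_listSystem {l : List WeightedPoint} {m : ℕ} (hf : IsFramed l m)
    (hv : veeCheck l = true) {p : ℕ} [Fact p.Prime] {g : ℤ} (hg : (g : ZMod p) * g = g + 1)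
    {sel : List (ℕ × ℕ × ℕ)} (hlin : linearCheck l p g sel = true)
    (hproj : ∀ (ι : Type) (e : ι ≃ Fin l.length) (i₀ i₁ i₂ i₃ : ι), (e i₀ : ℕ) = 0 →
      (e i₁ : ℕ) = 1 → (e i₂ : ℕ) = 2 → (e i₃ : ℕ) = m →
      IsProjectivelyRigid (points l e) i₀ i₁ i₂ i₃) :
    IsRigidVeeSystem (listSystem b l) := by
  have : FiniteDimensional ℝ V := b.finiteDimensional_of_finite
  let a : Fin l.length → Dual ℝ V := fun k =>
    Real.sqrt (l.get k).2.toReal • covec b (l.get k).1.toReal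
  have hrange : Set.range a = listSystem b l := by
    ext α
    constructor
    · rintro ⟨k, rfl⟩
      exact ⟨_, List.get_mem l k, rfl⟩
    · rintro ⟨q, hq, rfl⟩
      obtain ⟨k, rfl⟩ := List.mem_iff_get.1 hq
      exact ⟨k, rfl⟩
  have hframe : ∀ {ι : Type} (e : ι ≃ Fin l.length), ∃ i₀ i₁ i₂ i₃ : ι, (e i₀ : ℕ) = 0 ∧
      (e i₁ : ℕ) = 1 ∧ (e i₂ : ℕ) = 2 ∧ (e i₃ : ℕ) = m := by
    intro ι e
    have := hf.lt
    exact ⟨e.symm ⟨0, by omega⟩, e.symm ⟨1, by omega⟩, e.symm ⟨2, by omega⟩,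
      e.symm ⟨m, by omega⟩, by simp, by simp, by simp, by simp⟩
  -- the covectors are distinct, so that the set of covectors may be indexed by their numbers
  have hinj : Function.Injective a := by
    let e := Equiv.refl (Fin l.length)
    obtain ⟨i₀, i₁, i₂, i₃, e0, e1, e2, e3⟩ := hframe e
    obtain ⟨f0, f1, f2, _⟩ := hf.points_eq e e0 e1 e2 e3
    exact (isCoordinatisation_of_veeCheck e hv (b := b) (α := a) (fun i => rfl) f0 f1 f2).injective
  let F : Finset (Dual ℝ V) := (Set.finite_range a).toFinset
  have hF : (F : Set (Dual ℝ V)) = listSystem b l := by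
    rw [← hrange]; exact Set.Finite.coe_toFinset _
  let e' : Fin l.length ≃ F := Equiv.ofBijective
    (fun k => ⟨a k, (Set.Finite.mem_toFinset _).2 ⟨k, rfl⟩⟩) ⟨fun i j hij =>
      hinj (congrArg Subtype.val hij), fun x => by
      obtain ⟨k, hk⟩ := (Set.Finite.mem_toFinset _).1 x.2
      exact ⟨k, Subtype.ext hk⟩⟩
  let e := e'.symm
  have hα : ∀ i : F, (i : Dual ℝ V) = Real.sqrt (weights l e i) • covec b (points l e i) := by
    intro i
    have : (e' (e i) : Dual ℝ V) = i := by simp [e]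
    rw [← this]
    rfl
  obtain ⟨i₀, i₁, i₂, i₃, e0, e1, e2, e3⟩ := hframe e
  obtain ⟨f0, f1, f2, κ, hκ, f3⟩ := hf.points_eq e e0 e1 e2 e3
  have hc := isCoordinatisation_of_veeCheck e hv hα f0 f1 f2
  have hvee := isVeeSystem_of_veeCheck e hv hc
  have hlin' : ∀ ξ : F → ℝ, LinearisedVeeConditions (fun α : F => (α : Dual ℝ V)) ξ →
      ∃ c : ℝ, ∀ i, ξ i = c := fun ξ hξ => eq_const_of_linearCheck e hg hlin hc hξ
  refine ⟨F, hF, hvee, fun k ε hε A hA => ?_, hlin'⟩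
  exact isTrivialDeformation_of_rigid b hvee hlin' hc.pos hα hc.cross_ne_zero f0 f1 f2 hκ f3
    (hproj _ e _ _ _ _ e0 e1 e2 e3) hε hA

/-- Rigidity when all the points are constructed from the frame by intersecting lines; `sel`
selects the linearised vee-conditions to be solved, `steps` is the construction. -/
lemma isRigidVeeSystem_of_stepsCheck {l : List WeightedPoint} {m : ℕ} (hf : IsFramed l m)
    (hv : veeCheck l = true) {p : ℕ} [Fact p.Prime] {g : ℤ} (hg : (g : ZMod p) * g = g + 1)
    {sel : List (ℕ × ℕ × ℕ)} (hlin : linearCheck l p g sel = true)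
    {steps : List (ℕ × (ℕ × ℕ) × (ℕ × ℕ))} (hs : stepsCheck l [0, 1, 2, m] steps = true) :
    IsRigidVeeSystem (listSystem b l) := by
  refine isRigidVeeSystem_listSystem b hf hv hg hlin fun ι e i₀ i₁ i₂ i₃ h₀ h₁ h₂ h₃ => ?_
  refine isProjectivelyRigid_of_stepsCheck e (veeCheck_points_ne_zero e hv) (steps := steps) ?_
  rw [h₀, h₁, h₂, h₃]; exact hs

/-- Rigidity when all the points are constructed by intersecting lines from the frame and the point
`x` of a golden configuration. -/
lemma isRigidVeeSystem_of_goldenCheck {l : List WeightedPoint} {m e f x y z : ℕ}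
    (hf : IsFramed l m) (hv : veeCheck l = true) {p : ℕ} [Fact p.Prime] {g : ℤ}
    (hg : (g : ZMod p) * g = g + 1) {sel : List (ℕ × ℕ × ℕ)} (hlin : linearCheck l p g sel = true)
    (hlt : e < l.length ∧ f < l.length ∧ x < l.length ∧ y < l.length ∧ z < l.length)
    (hgold : goldenCheck l 0 1 2 m e f x y z = true)
    {steps : List (ℕ × (ℕ × ℕ) × (ℕ × ℕ))} (hs : stepsCheck l [0, 1, 2, m, x] steps = true) :
    IsRigidVeeSystem (listSystem b l) := by
  refine isRigidVeeSystem_listSystem b hf hv hg hlin fun ι E i₀ i₁ i₂ i₃ h₀ h₁ h₂ h₃ => ?_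
  obtain ⟨he, hf', hx, hy, hz⟩ := hlt
  obtain ⟨f0, f1, f2, κ, hκ, f3⟩ := hf.points_eq E h₀ h₁ h₂ h₃
  refine isProjectivelyRigid_of_goldenCheck E (veeCheck_points_ne_zero E hv) (e := E.symm ⟨e, he⟩)
    (f := E.symm ⟨f, hf'⟩) (x := E.symm ⟨x, hx⟩) (y := E.symm ⟨y, hy⟩) (z := E.symm ⟨z, hz⟩)
    ?_ f0 f1 f2 hκ f3 (steps := steps) ?_
  · simpa [h₀, h₁, h₂, h₃] using hgold
  · simpa [h₀, h₁, h₂, h₃] using hs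

end Rigid

/-! ### Positive roots -/

/-- The number `2 ⟨a, b⟩ = -2 cos (π / m)` for simple roots `a`, `b` with the entry `m` of the
Coxeter matrix, for the values `m = 1, 2, 3, 5`. -/
def cartanEntry : ℕ → GoldenInt
  | 1 => ⟨2, 0⟩
  | 3 => ⟨-1, 0⟩
  | 5 => ⟨0, -1⟩
  | _ => ⟨0, 0⟩

lemma toReal_cartanEntry {m : ℕ} (h : m = 1 ∨ m = 2 ∨ m = 3 ∨ m = 5) :
    (cartanEntry m).toReal = 2 * -Real.cos (Real.pi / m) := by
  rcases h with rfl | rfl | rfl | rfl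
  · simp [cartanEntry, GoldenInt.toReal]
  · simp [cartanEntry, GoldenInt.toReal]
  · simp [cartanEntry, GoldenInt.toReal]
  · have : Real.cos (Real.pi / ((5 : ℕ) : ℝ)) = (1 + Real.sqrt 5) / 4 := by
      rw [← Real.cos_pi_div_five]; norm_num
    rw [this]
    simp only [cartanEntry, GoldenInt.toReal, Real.goldenRatio]
    push_cast; ring

/-- The scalar product of two lists of coordinates. -/
def dotList : List GoldenInt → List GoldenInt → GoldenInt
  | x :: r, y :: s => x * y + dotList r s
  | _, _ => 0

lemma toReal_dotList {n : ℕ} (r s : List GoldenInt) (hr : r.length = n) :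
    (dotList r s).toReal = ∑ j : Fin n, (r.getD j 0).toReal * (s.getD j 0).toReal := by
  induction r generalizing n s with
  | nil => subst hr; simp [dotList]
  | cons x r ih =>
    subst hr
    cases s with
    | nil => simp [dotList]
    | cons y s =>
      rw [dotList, GoldenInt.toReal_add, GoldenInt.toReal_mul, ih s rfl]
      exact (Fin.sum_univ_succ (n := r.length) (fun j =>
        ((x :: r).getD j 0).toReal * ((y :: s).getD j 0).toReal)).symm

/-- Decides whether two lists of golden integers are equal. -/
def listEq : List GoldenInt → List GoldenInt → Bool
  | [], [] => true
  | x :: r, y :: s => (x.re == y.re && x.im == y.im) && listEq r s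
  | _, _ => false

lemma listEq_iff {r s : List GoldenInt} : listEq r s = true ↔ r = s := by
  induction r generalizing s with
  | nil => cases s <;> simp [listEq]
  | cons x r ih => cases s <;> simp [listEq, ih, GoldenInt.ext_iff]

section Roots

variable {n : ℕ}

/-- The vector of `ℝⁿ` with the given list of coordinates. -/
def vecOf (n : ℕ) (x : List GoldenInt) : Fin n → ℝ := fun i => (x.getD i 0).toReal

/-- The list of coordinates of a simple root. -/
def simpleList (n : ℕ) (i : Fin n) : List GoldenInt :=
  (List.finRange n).map fun j => if j.1 == i.1 then ⟨1, 0⟩ else ⟨0, 0⟩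

/-- The rows of the matrix of the numbers `2 ⟨a_i, a_j⟩`. -/
def cartanRow (M : CoxeterMatrix (Fin n)) (i : Fin n) : List GoldenInt :=
  (List.finRange n).map fun j => cartanEntry (M j i)

/-- The simple reflections, on lists of coordinates. -/
def reflectList (M : CoxeterMatrix (Fin n)) (i : Fin n) (x : List GoldenInt) : List GoldenInt :=
  x.set i (x.getD i 0 - dotList (cartanRow M i) x)

/-- Checks that each of the vectors in the second list is a simple root or is mapped by some simple
reflection to the first list or to a preceding vector. -/
def reachCheck (M : CoxeterMatrix (Fin n)) : List (List GoldenInt) → List (List GoldenInt) → Bool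
  | _, [] => true
  | seen, x :: rest => ((List.finRange n).any (fun i => listEq x (simpleList n i)) ||
      (List.finRange n).any fun i => let y := reflectList M i x; seen.any fun z => listEq y z) &&
      reachCheck M (x :: seen) rest

/-- Checks that a list consists of the positive roots, each occurring once. -/
def rootsCheck (M : CoxeterMatrix (Fin n)) (L : List (List GoldenInt)) : Bool :=
  ((List.finRange n).all fun i => (List.finRange n).all fun j =>
    M i j == 1 || M i j == 2 || M i j == 3 || M i j == 5) &&
  ((List.finRange n).all (fun i => L.any fun z => listEq (simpleList n i) z) &&
  (L.all (fun x => x.length == n && (x.all GoldenInt.isNonneg && x.any fun z => !z.isZero)) &&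
  (pairwiseCheck (fun x y => !listEq x y) L &&
  (reachCheck M [] L &&
  L.all fun x => (List.finRange n).all fun i =>
    let y := reflectList M i x
    (L.any fun z => listEq y z) || (let y' := y.map fun z => -z; L.any fun z => listEq y' z)))))

variable {M : CoxeterMatrix (Fin n)}

lemma coxeterForm_single (x : Fin n → ℝ) (i : Fin n) :
    coxeterForm M x (Pi.single i 1) = ∑ j, x j * -Real.cos (Real.pi / M j i) := by
  rw [coxeterForm]
  refine Finset.sum_congr rfl fun j _ => ?_
  rw [Finset.sum_eq_single i]
  · simp
  · intro k _ hk; simp [Pi.single_eq_of_ne hk]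
  · simp

lemma simpleReflection_neg (i : Fin n) (x : Fin n → ℝ) :
    simpleReflection M i (-x) = -simpleReflection M i x := by
  have : coxeterForm M (-x) (Pi.single i 1) = -coxeterForm M x (Pi.single i 1) := by
    simp [coxeterForm_single]
  rw [simpleReflection, simpleReflection, this]
  module

lemma simpleReflection_simpleReflection (i : Fin n) (x : Fin n → ℝ) :
    simpleReflection M i (simpleReflection M i x) = x := by
  have h : coxeterForm M (simpleReflection M i x) (Pi.single i 1)
      = -coxeterForm M x (Pi.single i 1) := by
    conv_lhs => rw [coxeterForm_single, simpleReflection]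
    simp only [Pi.sub_apply, Pi.smul_apply, smul_eq_mul, sub_mul, Finset.sum_sub_distrib]
    rw [← coxeterForm_single, Finset.sum_eq_single i]
    · simp; ring
    · intro k _ hk; simp [Pi.single_eq_of_ne hk]
    · simp
  rw [simpleReflection, h]
  conv_lhs => rw [simpleReflection]
  module

lemma vecOf_simpleList (i : Fin n) : vecOf n (simpleList n i) = Pi.single i 1 := by
  funext j
  rw [vecOf, simpleList, List.getD_eq_getElem _ _ (by simp)]
  simp only [List.getElem_map, List.getElem_finRange, Fin.val_cast, beq_iff_eq]
  by_cases h : j = i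
  · subst h; simp [GoldenInt.toReal]
  · have : (j : ℕ) ≠ i := fun h' => h (Fin.ext h')
    simp [h, this, GoldenInt.toReal]

lemma vecOf_reflectList (hM : ∀ i j, M i j = 1 ∨ M i j = 2 ∨ M i j = 3 ∨ M i j = 5)
    {x : List GoldenInt} (hx : x.length = n) (i : Fin n) :
    vecOf n (reflectList M i x) = simpleReflection M i (vecOf n x) := by
  have hdot : (dotList (cartanRow M i) x).toReal
      = 2 * coxeterForm M (vecOf n x) (Pi.single i 1) := by
    rw [toReal_dotList _ _ (n := n) (by simp [cartanRow]), coxeterForm_single, Finset.mul_sum]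
    refine Finset.sum_congr rfl fun j _ => ?_
    rw [cartanRow, List.getD_eq_getElem _ _ (by simp)]
    simp only [List.getElem_map, List.getElem_finRange, Fin.cast_mk, Fin.eta]
    rw [toReal_cartanEntry (hM j i), vecOf]
    ring
  funext j
  rw [simpleReflection, ← hdot]
  simp only [vecOf, reflectList, Pi.sub_apply, Pi.smul_apply, smul_eq_mul]
  have hj : (j : ℕ) < x.length := hx ▸ j.2
  rw [List.getD_eq_getElem _ _ (by simpa using hj), List.getElem_set]
  by_cases h : i = j
  · subst h; simp
  · have : (i : ℕ) ≠ j := fun h' => h (Fin.ext h')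
    simp [this, Pi.single_eq_of_ne (fun h' : j = i => h h'.symm), List.getElem?_eq_getElem hj]

lemma vecOf_map_neg (x : List GoldenInt) : vecOf n (x.map fun z => -z) = -vecOf n x := by
  funext i
  simp only [vecOf, Pi.neg_apply]
  rw [getD_map_of_apply_eq (fun z : GoldenInt => -z) 0 0 (GoldenInt.toReal_injective (by simp)),
    GoldenInt.toReal_neg]

lemma vecOf_injOn {x y : List GoldenInt} (hx : x.length = n) (hy : y.length = n)
    (h : vecOf n x = vecOf n y) : x = y := by
  refine List.ext_getElem (hx.trans hy.symm) fun i h1 h2 => ?_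
  have := congrFun h ⟨i, hx ▸ h1⟩
  simp only [vecOf] at this
  rw [List.getD_eq_getElem _ _ h1, List.getD_eq_getElem _ _ h2] at this
  exact GoldenInt.toReal_injective this

lemma isRoot_of_reachCheck (hM : ∀ i j, M i j = 1 ∨ M i j = 2 ∨ M i j = 3 ∨ M i j = 5)
    {seen rest : List (List GoldenInt)} (hlen : ∀ x ∈ rest, x.length = n)
    (h : reachCheck M seen rest = true) (hs : ∀ x ∈ seen, IsRoot M (vecOf n x)) :
    ∀ x ∈ rest, IsRoot M (vecOf n x) := by
  induction rest generalizing seen with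
  | nil => simp
  | cons x rest ih =>
    simp only [reachCheck, Bool.and_eq_true, Bool.or_eq_true, List.any_eq_true, listEq_iff] at h
    have hx : IsRoot M (vecOf n x) := by
      rcases h.1 with ⟨i, _, rfl⟩ | ⟨i, _, z, hz, hxz⟩
      · rw [vecOf_simpleList]; exact IsRoot.simple i
      · have := IsRoot.reflect i _ (hs z hz)
        rwa [← hxz, vecOf_reflectList hM (hlen x List.mem_cons_self),
          simpleReflection_simpleReflection] at this
    intro y hy
    rcases List.mem_cons.1 hy with rfl | hy
    · exact hx
    · refine ih (fun z hz => hlen z (List.mem_cons_of_mem _ hz)) h.2 (fun z hz => ?_) y hy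
      rcases List.mem_cons.1 hz with rfl | hz
      · exact hx
      · exact hs z hz

/-- The list of roots is complete since, together with the negative roots, it is closed under the
simple reflections. -/
lemma positiveRoots_eq_of_rootsCheck {L : List (List GoldenInt)} (h : rootsCheck M L = true) :
    positiveRoots M = {v | ∃ x ∈ L, v = vecOf n x} ∧ (∀ x ∈ L, x.length = n) ∧ L.Nodup ∧
      ∀ x ∈ L, ∀ i, 0 ≤ vecOf n x i := by
  simp only [rootsCheck, Bool.and_eq_true, List.all_eq_true, List.any_eq_true, Bool.or_eq_true,
    beq_iff_eq, listEq_iff, List.mem_finRange, forall_true_left, Bool.not_eq_true'] at h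
  obtain ⟨hM, hsimple, hpos, hpair, hreach, hclosed⟩ := h
  have hM' : ∀ i j, M i j = 1 ∨ M i j = 2 ∨ M i j = 3 ∨ M i j = 5 := fun i j => by
    have := hM i j; tauto
  have hlen : ∀ x ∈ L, x.length = n := fun x hx => (hpos x hx).1
  have hnn : ∀ x ∈ L, ∀ i, 0 ≤ vecOf n x i := by
    intro x hx i
    have hi : (i : ℕ) < x.length := hlen x hx ▸ i.2
    rw [vecOf, List.getD_eq_getElem _ _ hi]
    exact GoldenInt.toReal_nonneg ((hpos x hx).2.1 _ (List.getElem_mem hi))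
  have hne : ∀ x ∈ L, vecOf n x ≠ 0 := by
    intro x hx h0
    obtain ⟨z, hz, hz0⟩ := (hpos x hx).2.2
    obtain ⟨k, rfl⟩ := List.mem_iff_get.1 hz
    have := congrFun h0 ⟨k, hlen x hx ▸ k.2⟩
    simp only [vecOf, Pi.zero_apply] at this
    rw [List.getD_eq_getElem _ _ k.2, GoldenInt.toReal_eq_zero_iff] at this
    have h1 : (x.get k).isZero = true := this
    rw [h1] at hz0
    exact Bool.false_ne_true hz0.symm
  refine ⟨?_, hlen, ?_, hnn⟩
  · have hall : ∀ v, IsRoot M v → ∃ x ∈ L, v = vecOf n x ∨ v = -vecOf n x := by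
      intro v hv
      have hstep : ∀ x ∈ L, ∀ i, ∃ z ∈ L, simpleReflection M i (vecOf n x) = vecOf n z ∨
          simpleReflection M i (vecOf n x) = -vecOf n z := by
        intro x hx i
        rw [← vecOf_reflectList hM' (hlen x hx)]
        rcases hclosed x hx i with ⟨z, hz, hxz⟩ | ⟨z, hz, hxz⟩
        · exact ⟨z, hz, Or.inl (by rw [hxz])⟩
        · exact ⟨z, hz, Or.inr (by rw [← hxz, vecOf_map_neg, neg_neg])⟩
      induction hv with
      | simple i =>
        obtain ⟨z, hz, hiz⟩ := hsimple i
        exact ⟨z, hz, Or.inl (by rw [← hiz, vecOf_simpleList])⟩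
      | reflect i v _ ih =>
        obtain ⟨x, hx, rfl | rfl⟩ := ih
        · exact hstep x hx i
        · obtain ⟨z, hz, h1 | h1⟩ := hstep x hx i
          · exact ⟨z, hz, Or.inr (by rw [simpleReflection_neg, h1])⟩
          · exact ⟨z, hz, Or.inl (by rw [simpleReflection_neg, h1, neg_neg])⟩
    ext v
    constructor
    · rintro ⟨hv, hv0⟩
      obtain ⟨x, hx, rfl | rfl⟩ := hall v hv
      · exact ⟨x, hx, rfl⟩
      · refine absurd (funext fun i => ?_) (hne x hx)
        have h1 := hv0 i
        have h2 := hnn x hx i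
        simp only [Pi.neg_apply, Pi.zero_apply] at h1 ⊢
        linarith
    · rintro ⟨x, hx, rfl⟩
      exact ⟨isRoot_of_reachCheck hM' hlen hreach (by simp) x hx, fun i => hnn x hx i⟩
  · have := pairwise_of_pairwiseCheck hpair
    refine this.imp fun {x y} hxy hxy' => ?_
    rw [listEq_iff.2 hxy'] at hxy
    exact Bool.false_ne_true hxy

end Roots

/-! ### Restrictions of Coxeter configurations -/

section Restriction

variable {n : ℕ} {J : Finset (Fin n)} {K : Fin 3 → Fin n}

/-- If `K` enumerates the complement of `J`, the coordinates with indices `K k` identify the fixed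
space with `ℝ³`. -/
def fixedSpaceEquiv (hK : ∀ i, i ∉ J ↔ ∃ k, K k = i) (hinj : Function.Injective K) :
    fixedSpace J ≃ₗ[ℝ] (Fin 3 → ℝ) where
  toFun x k := x.1 (K k)
  map_add' _ _ := rfl
  map_smul' _ _ := rfl
  invFun y := ⟨fun i => ∑ k, if K k = i then y k else 0, fun j hj =>
    Finset.sum_eq_zero fun k _ => if_neg fun h => (hK j).2 ⟨k, h⟩ hj⟩
  left_inv x := by
    refine Subtype.ext (funext fun i => ?_)
    by_cases hi : i ∈ J
    · refine Eq.trans (b := (0 : ℝ)) ?_ (x.2 i hi).symm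
      change (∑ k, if K k = i then x.1 (K k) else 0) = 0
      exact Finset.sum_eq_zero fun k _ => if_neg fun h => (hK i).2 ⟨k, h⟩ hi
    · obtain ⟨k, rfl⟩ := (hK i).1 hi
      simp [hinj.eq_iff]
  right_inv y := by
    funext k
    simp [hinj.eq_iff]

/-- The basis of the fixed space given by these coordinates. -/
def fixedSpaceBasis (hK : ∀ i, i ∉ J ↔ ∃ k, K k = i) (hinj : Function.Injective K) :
    Basis (Fin 3) ℝ (fixedSpace J) :=
  Basis.ofEquivFun (fixedSpaceEquiv hK hinj)

lemma restrictRoot_eq_covec (hK : ∀ i, i ∉ J ↔ ∃ k, K k = i) (hinj : Function.Injective K)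
    (a : Fin n → ℝ) : restrictRoot J a
      = covec (fixedSpaceBasis hK hinj) ⟨a (K 0), a (K 1), a (K 2)⟩ := by
  ext x
  have h1 : restrictRoot J a x = ∑ i, a i * x.1 i := by
    simp [restrictRoot, LinearMap.domRestrict_apply]
  have h2 : ∀ k, (fixedSpaceBasis hK hinj).coord k x = x.1 (K k) := fun k => by
    rw [Basis.coord_apply, fixedSpaceBasis, Basis.ofEquivFun_repr_apply]; rfl
  have h3 : ∑ k, a (K k) * x.1 (K k) = ∑ i, a i * x.1 i := by
    refine Finset.sum_of_injOn K hinj.injOn (fun _ _ => Finset.mem_coe.2 (Finset.mem_univ _)) ?_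
      fun _ _ => rfl
    intro i _ hi
    have : i ∈ J := by
      by_contra h
      obtain ⟨k, rfl⟩ := (hK i).1 h
      exact hi ⟨k, by simp, rfl⟩
    rw [x.2 i this, mul_zero]
  rw [h1, ← h3, Fin.sum_univ_three]
  simp only [covec, LinearMap.add_apply, LinearMap.smul_apply, h2, smul_eq_mul]

lemma sum_mul_covec_mul_covec {V : Type*} [AddCommGroup V] [Module ℝ V] (b : Basis (Fin 3) ℝ V)
    (m : List WeightedPoint) (u v : V) :
    (m.map fun q => q.2.toReal * (covec b q.1.toReal u * covec b q.1.toReal v)).sum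
      = Triple.dot ((listGram m).toReal.mulVec ⟨b.coord 0 u, b.coord 1 u, b.coord 2 u⟩)
        ⟨b.coord 0 v, b.coord 1 v, b.coord 2 v⟩ := by
  induction m with
  | nil => simp [listGram, listSum, SymMatrix.toReal, SymMatrix.mulVec, Triple.dot]
  | cons q m ih =>
    rw [List.map_cons, List.sum_cons, ih]
    simp only [listGram, listSum, SymMatrix.toReal, SymMatrix.mulVec, Triple.dot, Triple.toReal,
      covec, LinearMap.add_apply, LinearMap.smul_apply, smul_eq_mul, GoldenInt.toReal_add,
      GoldenInt.toReal_mul]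
    ring

/-- The restriction of a covector that is given by a list of coordinates. -/
def restrictList (K : Fin 3 → Fin n) (x : List GoldenInt) : Triple GoldenInt :=
  ⟨x.getD (K 0) 0, x.getD (K 1) 0, x.getD (K 2) 0⟩

/-- Decides whether two matrices are equal. -/
def SymMatrix.beqGolden (G H : SymMatrix GoldenInt) : Bool :=
  (G.xx - H.xx).isZero && ((G.xy - H.xy).isZero && ((G.xz - H.xz).isZero &&
    ((G.yy - H.yy).isZero && ((G.yz - H.yz).isZero && (G.zz - H.zz).isZero))))

lemma SymMatrix.toReal_eq_of_beqGolden {G H : SymMatrix GoldenInt} (h : G.beqGolden H = true) :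
    G.toReal = H.toReal := by
  simp only [beqGolden, Bool.and_eq_true, ← GoldenInt.toReal_eq_zero_iff, GoldenInt.toReal_sub,
    sub_eq_zero] at h
  obtain ⟨h1, h2, h3, h4, h5, h6⟩ := h
  simp only [SymMatrix.toReal, h1, h2, h3, h4, h5, h6]

/-- Checks that the merged restrictions of the covectors in `L` are the weighted points in `l`. -/
def restrictionCheck (K : Fin 3 → Fin n) (L : List (List GoldenInt)) (l : List WeightedPoint) :
    Bool :=
  let R := L.map (restrictList K)
  R.all (fun r => r.isZero || l.any fun q => (r.cross q.1).isZero) &&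
  l.all fun q => (q.2.isNonneg && (!q.2.isZero && !q.1.isZero)) &&
    (R.any (fun r => (r.x - q.1.x).isZero && ((r.y - q.1.y).isZero && (r.z - q.1.z).isZero)) &&
    (listGram ((R.filter fun r => (r.cross q.1).isZero).map fun r => (r, 1))).beqGolden
      (listGram [q]))

variable {M : CoxeterMatrix (Fin n)} {L : List (List GoldenInt)} {l : List WeightedPoint}

lemma covec_mem_span_singleton_iff {V : Type*} [AddCommGroup V] [Module ℝ V]
    (b : Basis (Fin 3) ℝ V) {p q : Triple ℝ} (hq : q ≠ Triple.zero) {t : ℝ} (ht : t ≠ 0) :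
    covec b p ∈ Submodule.span ℝ {t • covec b q} ↔ p.cross q = Triple.zero := by
  rw [Submodule.mem_span_singleton]
  constructor
  · rintro ⟨c, hc⟩
    rw [smul_smul, ← covec_smul] at hc
    refine Triple.cross_eq_zero_of_eq_smul (s := c * t) ?_
    rw [← coords_covec b p, ← hc, coords_covec]
  · intro h
    obtain ⟨s, hs⟩ := Triple.eq_smul_of_cross_eq_zero hq h
    exact ⟨s / t, by rw [smul_smul, div_mul_cancel₀ _ ht, ← covec_smul, ← hs]⟩

/-- In the coordinates of the fixed space, the restriction of a Coxeter configuration is the listed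
system: on each line the weight is the squared length factor `c²` of the merged covector `c p`. -/
theorem coxeterRestriction_eq_listSystem (hroots : rootsCheck M L = true)
    (hK : ∀ i, i ∉ J ↔ ∃ k, K k = i) (hinj : Function.Injective K)
    (h : restrictionCheck K L l = true) :
    coxeterRestriction M J = listSystem (fixedSpaceBasis hK hinj) l := by
  obtain ⟨hpos, hlen, hnodup, hnn⟩ := positiveRoots_eq_of_rootsCheck hroots
  set b := fixedSpaceBasis hK hinj with hb
  have hres : ∀ x, restrictRoot J (vecOf n x) = covec b (restrictList K x).toReal := fun x =>
    restrictRoot_eq_covec hK hinj _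
  simp only [restrictionCheck, Bool.and_eq_true, List.all_eq_true, List.any_eq_true,
    Bool.or_eq_true, Bool.not_eq_true', List.mem_map, forall_exists_index, and_imp,
    forall_apply_eq_imp_iff₂, exists_exists_and_eq_and] at h
  obtain ⟨hR, hl⟩ := h
  have hrnn : ∀ x ∈ L, 0 ≤ (restrictList K x).toReal.x ∧ 0 ≤ (restrictList K x).toReal.y ∧
      0 ≤ (restrictList K x).toReal.z := fun x hx => ⟨hnn x hx _, hnn x hx _, hnn x hx _⟩
  have hq0 : ∀ q ∈ l, q.1.toReal ≠ Triple.zero := fun q hq h0 => by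
    have := (hl q hq).1.2.2
    rw [Triple.toReal_eq_zero_iff.1 h0] at this
    simp at this
  have hw : ∀ q ∈ l, 0 < q.2.toReal := fun q hq => by
    have := (hl q hq).1
    refine lt_of_le_of_ne (GoldenInt.toReal_nonneg this.1) fun h0 => ?_
    have h1 := GoldenInt.toReal_eq_zero_iff.1 h0.symm
    rw [this.2.1] at h1
    exact Bool.false_ne_true h1
  have hpt : ∀ q ∈ l, ∃ x ∈ L, (restrictList K x).toReal = q.1.toReal := fun q hq => by
    obtain ⟨x, hx, h1, h2, h3⟩ := (hl q hq).2.1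
    rw [← GoldenInt.toReal_eq_zero_iff, GoldenInt.toReal_sub, sub_eq_zero] at h1 h2 h3
    exact ⟨x, hx, by simp only [Triple.toReal, h1, h2, h3]⟩
  -- the sum over the restrictions on the line of a listed point
  have hsum : ∀ q ∈ l, ∀ t : ℝ, t ≠ 0 → ∀ u v,
      ∑ᶠ a ∈ {a | a ∈ positiveRoots M ∧
        restrictRoot J a ∈ Submodule.span ℝ {t • covec b q.1.toReal}},
        restrictRoot J a u * restrictRoot J a v
      = q.2.toReal * (covec b q.1.toReal u * covec b q.1.toReal v) := by
    intro q hq t ht u v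
    let s := L.filter fun x => ((restrictList K x).cross q.1).isZero
    have hset : {a | a ∈ positiveRoots M ∧
        restrictRoot J a ∈ Submodule.span ℝ {t • covec b q.1.toReal}}
        = vecOf n '' (s.toFinset : Set (List GoldenInt)) := by
      ext a
      simp only [hpos, Set.mem_ofPred_eq, Set.mem_image, List.coe_toFinset, s, List.mem_filter]
      constructor
      · rintro ⟨⟨x, hx, rfl⟩, hs⟩
        rw [hres, covec_mem_span_singleton_iff b (hq0 q hq) ht, ← Triple.toReal_cross,
          Triple.toReal_eq_zero_iff] at hs
        exact ⟨x, ⟨hx, hs⟩, rfl⟩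
      · rintro ⟨x, ⟨hx, hs⟩, rfl⟩
        refine ⟨⟨x, hx, rfl⟩, ?_⟩
        rw [hres, covec_mem_span_singleton_iff b (hq0 q hq) ht, ← Triple.toReal_cross,
          Triple.toReal_eq_zero_iff]
        exact hs
    have hinjOn : Set.InjOn (vecOf n) (s.toFinset : Set (List GoldenInt)) := by
      intro x hx y hy hxy
      simp only [List.coe_toFinset, s, List.mem_filter, Set.mem_ofPred_eq] at hx hy
      exact vecOf_injOn (hlen x hx.1) (hlen y hy.1) hxy
    rw [hset, finsum_mem_image hinjOn, finsum_mem_coe_finset,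
      List.sum_toFinset _ (hnodup.filter _)]
    have h1 := sum_mul_covec_mul_covec b
      (((L.map (restrictList K)).filter fun r => (r.cross q.1).isZero).map fun r => (r, 1)) u v
    rw [SymMatrix.toReal_eq_of_beqGolden (hl q hq).2.2, ← sum_mul_covec_mul_covec,
      List.filter_map] at h1
    simp only [List.map_map, List.map_cons, List.map_nil, List.sum_cons, List.sum_nil,
      add_zero] at h1
    rw [← h1]
    congr 1
    refine List.map_congr_left fun x _ => ?_
    simp [hres]
  ext α
  constructor
  · rintro ⟨hα, ⟨a, ha, c, hc, rfl⟩, hform⟩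
    rw [hpos] at ha
    obtain ⟨x, hx, rfl⟩ := ha
    rw [hres] at hα hform ⊢
    have hx0 : (restrictList K x).toReal ≠ Triple.zero := fun h0 => hα (by
      rw [(covec_eq_zero_iff b).2 h0, smul_zero])
    obtain ⟨q, hq, hqx⟩ := (hR x hx).resolve_left fun h0 =>
      hx0 (Triple.toReal_eq_zero_iff.2 h0)
    rw [← Triple.toReal_eq_zero_iff, Triple.toReal_cross] at hqx
    obtain ⟨s, hs⟩ := Triple.eq_smul_of_cross_eq_zero (hq0 q hq) hqx
    -- both vectors are non-negative, hence so is the factor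
    have hs0 : 0 < s := by
      obtain ⟨y, hy, hyq⟩ := hpt q hq
      have hy' := hrnn y hy
      have hx' := hrnn x hx
      rw [hyq] at hy'
      by_contra hneg
      push Not at hneg
      refine hx0 ?_
      rw [hs] at hx' ⊢
      simp only [Triple.smul, Triple.zero, Triple.mk.injEq] at hx' ⊢
      exact ⟨le_antisymm (mul_nonpos_of_nonpos_of_nonneg hneg hy'.1) hx'.1,
        le_antisymm (mul_nonpos_of_nonpos_of_nonneg hneg hy'.2.1) hx'.2.1,
        le_antisymm (mul_nonpos_of_nonpos_of_nonneg hneg hy'.2.2) hx'.2.2⟩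
    have hαq : c • covec b (restrictList K x).toReal = (c * s) • covec b q.1.toReal := by
      rw [hs, covec_smul, smul_smul]
    rw [hαq] at hform ⊢
    refine ⟨q, hq, ?_⟩
    have hne : covec b q.1.toReal ≠ 0 := fun h0 => hq0 q hq ((covec_eq_zero_iff b).1 h0)
    obtain ⟨u, hu⟩ : ∃ u, covec b q.1.toReal u ≠ 0 := by
      by_contra hcon
      push Not at hcon
      exact hne (LinearMap.ext hcon)
    have h1 := hform u u
    rw [hsum q hq _ (mul_pos hc hs0).ne'] at h1
    simp only [LinearMap.smul_apply, smul_eq_mul] at h1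
    have h2 : q.2.toReal = (c * s) * (c * s) := by
      refine mul_right_cancel₀ (mul_ne_zero hu hu) ?_
      rw [← h1]; ring
    rw [h2, Real.sqrt_mul_self (mul_pos hc hs0).le]
  · rintro ⟨q, hq, rfl⟩
    have hsq := Real.sqrt_pos.2 (hw q hq)
    refine ⟨smul_ne_zero hsq.ne' fun h0 => hq0 q hq ((covec_eq_zero_iff b).1 h0), ?_, ?_⟩
    · obtain ⟨x, hx, hxq⟩ := hpt q hq
      exact ⟨vecOf n x, by rw [hpos]; exact ⟨x, hx, rfl⟩, _, hsq, by rw [hres, hxq]⟩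
    · intro u v
      rw [hsum q hq _ hsq.ne']
      simp only [LinearMap.smul_apply, smul_eq_mul]
      rw [mul_mul_mul_comm, Real.mul_self_sqrt (hw q hq).le]

end Restriction

/-! ### The positive roots of the exceptional types -/

/-- The list of the `n` lowest decimal digits, beginning with the lowest one. -/
def digits : ℕ → ℕ → List GoldenInt
  | 0, _ => []
  | n + 1, k => ⟨((k % 10 : ℕ) : ℤ), 0⟩ :: digits n (k / 10)

/-- The `n` golden integers whose two coefficients are pairs of successive decimal digits, beginning
with the lowest ones. -/
def goldenDigits : ℕ → ℕ → List GoldenInt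
  | 0, _ => []
  | n + 1, k => ⟨((k % 10 : ℕ) : ℤ), ((k / 10 % 10 : ℕ) : ℤ)⟩ :: goldenDigits n (k / 100)

/-- The positive roots of type `E₇`. -/
def rootsE₇ : List (List GoldenInt) :=
  List.map (digits 7)
    [1, 10, 100, 1000, 10000, 100000, 1000000, 101, 1010, 1100, 11000, 110000, 1100000, 1101,
     1110, 11010, 11100, 111000, 1110000, 1111, 11101, 11110, 111010, 111100, 1111000, 11111,
     111101, 12110, 111110, 1111010, 1111100, 12111, 111111, 1111101, 112110, 1111110, 12211,
     112111, 1111111, 122110, 1112110, 112211, 122111, 1112111, 1122110, 122211, 1112211,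
     1122111, 1222110, 123211, 1122211, 1222111, 123221, 1123211, 1222211, 1123221, 1223211,
     1223221, 1233211, 1233221, 1234221, 1234321, 1234322]

lemma rootsCheck_E₇ : rootsCheck CoxeterMatrix.E₇ rootsE₇ = true := by
  decide +kernel

/-- The positive roots of type `E₈`. -/
def rootsE₈ : List (List GoldenInt) :=
  List.map (digits 8)
    [1, 10, 100, 1000, 10000, 100000, 1000000, 10000000, 101, 1010, 1100, 11000, 110000, 1100000,
     11000000, 1101, 1110, 11010, 11100, 111000, 1110000, 11100000, 1111, 11101, 11110, 111010,
     111100, 1111000, 11110000, 11111, 111101, 12110, 111110, 1111010, 1111100, 11111000, 12111,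
     111111, 1111101, 112110, 1111110, 11111010, 11111100, 12211, 112111, 1111111, 11111101,
     122110, 1112110, 11111110, 112211, 122111, 1112111, 11111111, 1122110, 11112110, 122211,
     1112211, 1122111, 11112111, 1222110, 11122110, 123211, 1122211, 11112211, 1222111, 11122111,
     11222110, 123221, 1123211, 1222211, 11122211, 11222111, 12222110, 1123221, 1223211,
     11123211, 11222211, 12222111, 1223221, 11123221, 1233211, 11223211, 12222211, 1233221,
     11223221, 11233211, 12223211, 1234221, 11233221, 12223221, 12233211, 1234321, 11234221,
     12233221, 12333211, 1234322, 11234321, 12234221, 12333221, 11234322, 12234321, 12334221,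
     12234322, 12334321, 12344221, 12334322, 12344321, 12344322, 12345321, 12345322, 12345331,
     12345332, 12345422, 12345432, 12346432, 12356432, 12456432, 13456432, 23456432]

lemma rootsCheck_E₈ : rootsCheck CoxeterMatrix.E₈ rootsE₈ = true := by
  decide +kernel

/-- The positive roots of type `H₃`. -/
def rootsH₃ : List (List GoldenInt) :=
  List.map (goldenDigits 3)
    [1, 100, 10000, 101, 100100, 11000, 101000, 100101, 11010, 101010, 101101, 101110, 111101,
     111110, 112010]

lemma rootsCheck_H₃ : rootsCheck CoxeterMatrix.H₃ rootsH₃ = true := by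
  decide +kernel

/-- The positive roots of type `H₄`. -/
def rootsH₄ : List (List GoldenInt) :=
  List.map (goldenDigits 4)
    [1, 100, 10000, 1000000, 101, 10100, 10010000, 1100000, 10101, 10100000, 10010100, 1101000,
     10010101, 10101000, 10110100, 1101010, 10111000, 10110101, 11110100, 10101010, 11111000,
     11110101, 10111010, 11201000, 10111101, 10111110, 11111010, 11111101, 11201010, 11111110,
     11211101, 11202010, 11211110, 11212010, 21211101, 21211110, 21221101, 21212010, 21221110,
     21221201, 21312010, 21222110, 21221211, 21312110, 22312010, 21222111, 21312111, 22312110,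
     22312111, 22322110, 31322110, 22322111, 31322111, 22322211, 31322211, 31332211, 32332211,
     32422211, 32423111, 32423120]

lemma rootsCheck_H₄ : rootsCheck CoxeterMatrix.H₄ rootsH₄ = true := by
  decide +kernel

/-! ### The eight systems -/

instance fact_prime_1009 : Fact (Nat.Prime 1009) := ⟨by norm_num⟩

/-- Modulo `1009` the golden ratio may be taken to be `383`. -/
lemma golden_reduction : (((383 : ℤ) : ZMod 1009)) * ((383 : ℤ) : ZMod 1009)
    = ((383 : ℤ) : ZMod 1009) + 1 := by
  decide +kernel

/-- The points and weights of `E₇A₁A₁A₂`. -/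
def pointsE₇A₁A₁A₂ : List WeightedPoint :=
  [(⟨⟨1, 0⟩, ⟨0, 0⟩, ⟨0, 0⟩⟩, ⟨2, 0⟩), (⟨⟨0, 0⟩, ⟨1, 0⟩, ⟨0, 0⟩⟩, ⟨6, 0⟩),
   (⟨⟨0, 0⟩, ⟨0, 0⟩, ⟨1, 0⟩⟩, ⟨3, 0⟩), (⟨⟨1, 0⟩, ⟨1, 0⟩, ⟨0, 0⟩⟩, ⟨24, 0⟩),
   (⟨⟨0, 0⟩, ⟨1, 0⟩, ⟨1, 0⟩⟩, ⟨2, 0⟩), (⟨⟨1, 0⟩, ⟨2, 0⟩, ⟨0, 0⟩⟩, ⟨6, 0⟩),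
   (⟨⟨1, 0⟩, ⟨1, 0⟩, ⟨1, 0⟩⟩, ⟨4, 0⟩), (⟨⟨1, 0⟩, ⟨2, 0⟩, ⟨1, 0⟩⟩, ⟨6, 0⟩),
   (⟨⟨2, 0⟩, ⟨2, 0⟩, ⟨1, 0⟩⟩, ⟨3, 0⟩), (⟨⟨2, 0⟩, ⟨3, 0⟩, ⟨0, 0⟩⟩, ⟨2, 0⟩),
   (⟨⟨2, 0⟩, ⟨3, 0⟩, ⟨1, 0⟩⟩, ⟨6, 0⟩), (⟨⟨2, 0⟩, ⟨4, 0⟩, ⟨1, 0⟩⟩, ⟨1, 0⟩),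
   (⟨⟨3, 0⟩, ⟨4, 0⟩, ⟨1, 0⟩⟩, ⟨2, 0⟩)]

lemma isRigidVeeSystem_E₇A₁A₁A₂ : IsRigidVeeSystem E₇A₁A₁A₂ := by
  rw [E₇A₁A₁A₂, coxeterRestriction_eq_listSystem rootsCheck_E₇ (K := ![2, 3, 6])
    (by decide) (by decide) (l := pointsE₇A₁A₁A₂) (by decide +kernel)]
  exact isRigidVeeSystem_of_stepsCheck _ (l := pointsE₇A₁A₁A₂) (m := 6)
    ⟨rfl, rfl, rfl, ⟨⟨1, 0⟩, rfl, rfl⟩, by decide⟩ (by decide +kernel) golden_reduction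
    (sel :=
      [(0, 2, 0), (0, 10, 0), (1, 12, 0), (2, 12, 0), (4, 5, 0), (0, 4, 1), (0, 4, 2), (0, 7, 1),
       (0, 7, 2), (0, 11, 2), (1, 2, 1), (1, 2, 2)])
    (by decide +kernel)
    (steps :=
      [(3, (0, 1), (2, 6)), (4, (0, 6), (1, 2)), (7, (1, 6), (3, 4)), (8, (0, 7), (2, 6)),
       (10, (1, 8), (3, 4)), (11, (1, 8), (2, 7)), (12, (0, 11), (3, 4)), (5, (0, 1), (2, 7)),
       (9, (0, 1), (2, 10))])
    (by decide +kernel)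

/-- The points and weights of `E₈A₂A₃`. -/
def pointsE₈A₂A₃ : List WeightedPoint :=
  [(⟨⟨1, 0⟩, ⟨0, 0⟩, ⟨0, 0⟩⟩, ⟨1, 0⟩), (⟨⟨0, 0⟩, ⟨1, 0⟩, ⟨0, 0⟩⟩, ⟨12, 0⟩),
   (⟨⟨0, 0⟩, ⟨0, 0⟩, ⟨1, 0⟩⟩, ⟨4, 0⟩), (⟨⟨1, 0⟩, ⟨1, 0⟩, ⟨0, 0⟩⟩, ⟨12, 0⟩),
   (⟨⟨0, 0⟩, ⟨1, 0⟩, ⟨1, 0⟩⟩, ⟨3, 0⟩), (⟨⟨1, 0⟩, ⟨2, 0⟩, ⟨0, 0⟩⟩, ⟨30, 0⟩),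
   (⟨⟨1, 0⟩, ⟨1, 0⟩, ⟨1, 0⟩⟩, ⟨3, 0⟩), (⟨⟨1, 0⟩, ⟨2, 0⟩, ⟨1, 0⟩⟩, ⟨12, 0⟩),
   (⟨⟨1, 0⟩, ⟨3, 0⟩, ⟨0, 0⟩⟩, ⟨4, 0⟩), (⟨⟨2, 0⟩, ⟨3, 0⟩, ⟨0, 0⟩⟩, ⟨4, 0⟩),
   (⟨⟨1, 0⟩, ⟨3, 0⟩, ⟨1, 0⟩⟩, ⟨6, 0⟩), (⟨⟨2, 0⟩, ⟨3, 0⟩, ⟨1, 0⟩⟩, ⟨6, 0⟩),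
   (⟨⟨2, 0⟩, ⟨4, 0⟩, ⟨1, 0⟩⟩, ⟨12, 0⟩), (⟨⟨2, 0⟩, ⟨5, 0⟩, ⟨1, 0⟩⟩, ⟨3, 0⟩),
   (⟨⟨3, 0⟩, ⟨5, 0⟩, ⟨1, 0⟩⟩, ⟨3, 0⟩), (⟨⟨3, 0⟩, ⟨6, 0⟩, ⟨1, 0⟩⟩, ⟨4, 0⟩),
   (⟨⟨3, 0⟩, ⟨6, 0⟩, ⟨2, 0⟩⟩, ⟨1, 0⟩)]

lemma isRigidVeeSystem_E₈A₂A₃ : IsRigidVeeSystem E₈A₂A₃ := by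
  rw [E₈A₂A₃, coxeterRestriction_eq_listSystem rootsCheck_E₈ (K := ![1, 3, 7])
    (by decide) (by decide) (l := pointsE₈A₂A₃) (by decide +kernel)]
  exact isRigidVeeSystem_of_stepsCheck _ (l := pointsE₈A₂A₃) (m := 6)
    ⟨rfl, rfl, rfl, ⟨⟨1, 0⟩, rfl, rfl⟩, by decide⟩ (by decide +kernel) golden_reduction
    (sel :=
      [(0, 2, 0), (0, 7, 0), (1, 16, 0), (2, 13, 0), (4, 8, 0), (0, 4, 1), (0, 4, 2), (0, 13, 1),
       (0, 13, 2), (1, 2, 1), (1, 2, 2), (1, 14, 1), (2, 3, 1), (2, 8, 1), (2, 8, 2), (4, 9, 1)])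
    (by decide +kernel)
    (steps :=
      [(3, (0, 1), (2, 6)), (4, (0, 6), (1, 2)), (7, (1, 6), (3, 4)), (5, (0, 1), (2, 7)),
       (10, (1, 6), (4, 5)), (11, (0, 10), (3, 4)), (12, (1, 11), (2, 7)), (13, (1, 11), (4, 5)),
       (14, (0, 13), (3, 10)), (15, (1, 14), (2, 7)), (16, (0, 10), (2, 7)),
       (8, (0, 1), (2, 10)), (9, (0, 1), (2, 11))])
    (by decide +kernel)

/-- The points and weights of `E₈A₂A₂A₁`. -/
def pointsE₈A₂A₂A₁ : List WeightedPoint :=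
  [(⟨⟨1, 0⟩, ⟨0, 0⟩, ⟨0, 0⟩⟩, ⟨1, 0⟩), (⟨⟨0, 0⟩, ⟨1, 0⟩, ⟨0, 0⟩⟩, ⟨9, 0⟩),
   (⟨⟨0, 0⟩, ⟨0, 0⟩, ⟨1, 0⟩⟩, ⟨6, 0⟩), (⟨⟨1, 0⟩, ⟨1, 0⟩, ⟨0, 0⟩⟩, ⟨9, 0⟩),
   (⟨⟨0, 0⟩, ⟨1, 0⟩, ⟨1, 0⟩⟩, ⟨6, 0⟩), (⟨⟨1, 0⟩, ⟨2, 0⟩, ⟨0, 0⟩⟩, ⟨9, 0⟩),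
   (⟨⟨1, 0⟩, ⟨1, 0⟩, ⟨1, 0⟩⟩, ⟨6, 0⟩), (⟨⟨1, 0⟩, ⟨2, 0⟩, ⟨1, 0⟩⟩, ⟨72, 0⟩),
   (⟨⟨1, 0⟩, ⟨3, 0⟩, ⟨0, 0⟩⟩, ⟨1, 0⟩), (⟨⟨2, 0⟩, ⟨3, 0⟩, ⟨0, 0⟩⟩, ⟨1, 0⟩),
   (⟨⟨1, 0⟩, ⟨3, 0⟩, ⟨1, 0⟩⟩, ⟨6, 0⟩), (⟨⟨1, 0⟩, ⟨2, 0⟩, ⟨2, 0⟩⟩, ⟨3, 0⟩),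
   (⟨⟨2, 0⟩, ⟨3, 0⟩, ⟨1, 0⟩⟩, ⟨6, 0⟩), (⟨⟨1, 0⟩, ⟨3, 0⟩, ⟨2, 0⟩⟩, ⟨3, 0⟩),
   (⟨⟨2, 0⟩, ⟨4, 0⟩, ⟨1, 0⟩⟩, ⟨6, 0⟩), (⟨⟨2, 0⟩, ⟨3, 0⟩, ⟨2, 0⟩⟩, ⟨3, 0⟩),
   (⟨⟨2, 0⟩, ⟨5, 0⟩, ⟨2, 0⟩⟩, ⟨3, 0⟩), (⟨⟨3, 0⟩, ⟨5, 0⟩, ⟨2, 0⟩⟩, ⟨3, 0⟩),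
   (⟨⟨3, 0⟩, ⟨6, 0⟩, ⟨2, 0⟩⟩, ⟨3, 0⟩)]

lemma isRigidVeeSystem_E₈A₂A₂A₁ : IsRigidVeeSystem E₈A₂A₂A₁ := by
  rw [E₈A₂A₂A₁, coxeterRestriction_eq_listSystem rootsCheck_E₈ (K := ![1, 3, 6])
    (by decide) (by decide) (l := pointsE₈A₂A₂A₁) (by decide +kernel)]
  exact isRigidVeeSystem_of_stepsCheck _ (l := pointsE₈A₂A₂A₁) (m := 6)
    ⟨rfl, rfl, rfl, ⟨⟨1, 0⟩, rfl, rfl⟩, by decide⟩ (by decide +kernel) golden_reduction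
    (sel :=
      [(0, 2, 0), (0, 7, 0), (2, 16, 0), (4, 8, 0), (4, 15, 0), (0, 13, 1), (0, 13, 2),
       (0, 16, 1), (0, 16, 2), (1, 2, 1), (1, 2, 2), (1, 11, 1), (1, 11, 2), (1, 12, 1),
       (1, 12, 2), (2, 3, 1), (2, 3, 2), (4, 5, 1)])
    (by decide +kernel)
    (steps :=
      [(3, (0, 1), (2, 6)), (4, (0, 6), (1, 2)), (7, (1, 6), (3, 4)), (11, (0, 6), (2, 7)),
       (13, (1, 11), (3, 4)), (15, (0, 13), (1, 6)), (5, (0, 1), (2, 7)), (8, (0, 1), (2, 13)),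
       (9, (0, 1), (2, 15)), (10, (1, 6), (2, 13)), (12, (0, 10), (2, 15)),
       (14, (1, 12), (2, 7)), (16, (1, 6), (4, 9)), (17, (0, 16), (3, 4)),
       (18, (0, 10), (1, 17))])
    (by decide +kernel)

/-- The points and weights of `E₈A₁A₁A₁A₂`. -/
def pointsE₈A₁A₁A₁A₂ : List WeightedPoint :=
  [(⟨⟨1, 0⟩, ⟨0, 0⟩, ⟨0, 0⟩⟩, ⟨2, 0⟩), (⟨⟨0, 0⟩, ⟨1, 0⟩, ⟨0, 0⟩⟩, ⟨6, 0⟩),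
   (⟨⟨0, 0⟩, ⟨0, 0⟩, ⟨1, 0⟩⟩, ⟨6, 0⟩), (⟨⟨1, 0⟩, ⟨1, 0⟩, ⟨0, 0⟩⟩, ⟨24, 0⟩),
   (⟨⟨0, 0⟩, ⟨1, 0⟩, ⟨1, 0⟩⟩, ⟨4, 0⟩), (⟨⟨1, 0⟩, ⟨2, 0⟩, ⟨0, 0⟩⟩, ⟨6, 0⟩),
   (⟨⟨1, 0⟩, ⟨1, 0⟩, ⟨1, 0⟩⟩, ⟨12, 0⟩), (⟨⟨1, 0⟩, ⟨2, 0⟩, ⟨1, 0⟩⟩, ⟨24, 0⟩),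
   (⟨⟨2, 0⟩, ⟨2, 0⟩, ⟨1, 0⟩⟩, ⟨6, 0⟩), (⟨⟨2, 0⟩, ⟨3, 0⟩, ⟨0, 0⟩⟩, ⟨2, 0⟩),
   (⟨⟨1, 0⟩, ⟨2, 0⟩, ⟨2, 0⟩⟩, ⟨2, 0⟩), (⟨⟨2, 0⟩, ⟨3, 0⟩, ⟨1, 0⟩⟩, ⟨24, 0⟩),
   (⟨⟨2, 0⟩, ⟨3, 0⟩, ⟨2, 0⟩⟩, ⟨6, 0⟩), (⟨⟨2, 0⟩, ⟨4, 0⟩, ⟨1, 0⟩⟩, ⟨2, 0⟩),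
   (⟨⟨3, 0⟩, ⟨4, 0⟩, ⟨1, 0⟩⟩, ⟨4, 0⟩), (⟨⟨3, 0⟩, ⟨4, 0⟩, ⟨2, 0⟩⟩, ⟨6, 0⟩),
   (⟨⟨3, 0⟩, ⟨5, 0⟩, ⟨2, 0⟩⟩, ⟨4, 0⟩), (⟨⟨4, 0⟩, ⟨5, 0⟩, ⟨2, 0⟩⟩, ⟨2, 0⟩),
   (⟨⟨4, 0⟩, ⟨6, 0⟩, ⟨3, 0⟩⟩, ⟨2, 0⟩)]

lemma isRigidVeeSystem_E₈A₁A₁A₁A₂ : IsRigidVeeSystem E₈A₁A₁A₁A₂ := by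
  rw [E₈A₁A₁A₁A₂, coxeterRestriction_eq_listSystem rootsCheck_E₈ (K := ![2, 3, 6])
    (by decide) (by decide) (l := pointsE₈A₁A₁A₁A₂) (by decide +kernel)]
  exact isRigidVeeSystem_of_stepsCheck _ (l := pointsE₈A₁A₁A₁A₂) (m := 6)
    ⟨rfl, rfl, rfl, ⟨⟨1, 0⟩, rfl, rfl⟩, by decide⟩ (by decide +kernel) golden_reduction
    (sel :=
      [(0, 2, 0), (0, 11, 0), (1, 10, 0), (1, 14, 0), (2, 16, 0), (0, 13, 1), (0, 13, 2),
       (0, 16, 1), (0, 16, 2), (1, 2, 1), (1, 2, 2), (1, 15, 1), (1, 15, 2), (4, 8, 1),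
       (4, 8, 2), (4, 9, 1), (4, 17, 1), (0, 4, 1)])
    (by decide +kernel)
    (steps :=
      [(3, (0, 1), (2, 6)), (4, (0, 6), (1, 2)), (7, (1, 6), (3, 4)), (8, (0, 7), (2, 6)),
       (10, (0, 6), (2, 7)), (11, (1, 8), (3, 4)), (12, (1, 6), (2, 11)), (13, (1, 8), (2, 7)),
       (14, (0, 13), (3, 4)), (15, (0, 7), (2, 14)), (16, (1, 15), (3, 4)),
       (17, (0, 16), (1, 8)), (18, (0, 7), (2, 11)), (5, (0, 1), (2, 7)), (9, (0, 1), (2, 11))])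
    (by decide +kernel)

/-- The points and weights of `E₈A₁A₁A₃`. -/
def pointsE₈A₁A₁A₃ : List WeightedPoint :=
  [(⟨⟨1, 0⟩, ⟨0, 0⟩, ⟨0, 0⟩⟩, ⟨2, 0⟩), (⟨⟨0, 0⟩, ⟨1, 0⟩, ⟨0, 0⟩⟩, ⟨8, 0⟩),
   (⟨⟨0, 0⟩, ⟨0, 0⟩, ⟨1, 0⟩⟩, ⟨4, 0⟩), (⟨⟨1, 0⟩, ⟨1, 0⟩, ⟨0, 0⟩⟩, ⟨40, 0⟩),
   (⟨⟨0, 0⟩, ⟨1, 0⟩, ⟨1, 0⟩⟩, ⟨2, 0⟩), (⟨⟨1, 0⟩, ⟨2, 0⟩, ⟨0, 0⟩⟩, ⟨16, 0⟩),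
   (⟨⟨1, 0⟩, ⟨1, 0⟩, ⟨1, 0⟩⟩, ⟨4, 0⟩), (⟨⟨1, 0⟩, ⟨2, 0⟩, ⟨1, 0⟩⟩, ⟨8, 0⟩),
   (⟨⟨2, 0⟩, ⟨3, 0⟩, ⟨0, 0⟩⟩, ⟨8, 0⟩), (⟨⟨2, 0⟩, ⟨2, 0⟩, ⟨1, 0⟩⟩, ⟨4, 0⟩),
   (⟨⟨2, 0⟩, ⟨3, 0⟩, ⟨1, 0⟩⟩, ⟨16, 0⟩), (⟨⟨3, 0⟩, ⟨4, 0⟩, ⟨0, 0⟩⟩, ⟨2, 0⟩),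
   (⟨⟨2, 0⟩, ⟨4, 0⟩, ⟨1, 0⟩⟩, ⟨4, 0⟩), (⟨⟨3, 0⟩, ⟨4, 0⟩, ⟨1, 0⟩⟩, ⟨8, 0⟩),
   (⟨⟨3, 0⟩, ⟨5, 0⟩, ⟨1, 0⟩⟩, ⟨4, 0⟩), (⟨⟨4, 0⟩, ⟨5, 0⟩, ⟨1, 0⟩⟩, ⟨2, 0⟩),
   (⟨⟨4, 0⟩, ⟨6, 0⟩, ⟨1, 0⟩⟩, ⟨4, 0⟩)]

lemma isRigidVeeSystem_E₈A₁A₁A₃ : IsRigidVeeSystem E₈A₁A₁A₃ := by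
  rw [E₈A₁A₁A₃, coxeterRestriction_eq_listSystem rootsCheck_E₈ (K := ![2, 3, 7])
    (by decide) (by decide) (l := pointsE₈A₁A₁A₃) (by decide +kernel)]
  exact isRigidVeeSystem_of_stepsCheck _ (l := pointsE₈A₁A₁A₃) (m := 6)
    ⟨rfl, rfl, rfl, ⟨⟨1, 0⟩, rfl, rfl⟩, by decide⟩ (by decide +kernel) golden_reduction
    (sel :=
      [(0, 2, 0), (0, 10, 0), (2, 14, 0), (4, 5, 0), (4, 9, 0), (0, 4, 1), (0, 4, 2), (0, 7, 1),
       (0, 7, 2), (0, 12, 1), (0, 12, 2), (0, 14, 2), (1, 2, 1), (1, 2, 2), (2, 11, 1),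
       (1, 9, 2)])
    (by decide +kernel)
    (steps :=
      [(3, (0, 1), (2, 6)), (4, (0, 6), (1, 2)), (7, (1, 6), (3, 4)), (9, (0, 7), (2, 6)),
       (10, (1, 9), (3, 4)), (12, (1, 9), (2, 7)), (13, (0, 12), (3, 4)), (14, (1, 13), (3, 12)),
       (15, (0, 14), (3, 4)), (16, (1, 15), (2, 10)), (5, (0, 1), (2, 7)), (8, (0, 1), (2, 10)),
       (11, (0, 1), (2, 13))])
    (by decide +kernel)

/-- The points and weights of `E₈A₁A₄`. -/
def pointsE₈A₁A₄ : List WeightedPoint :=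
  [(⟨⟨1, 0⟩, ⟨0, 0⟩, ⟨0, 0⟩⟩, ⟨1, 0⟩), (⟨⟨0, 0⟩, ⟨1, 0⟩, ⟨0, 0⟩⟩, ⟨2, 0⟩),
   (⟨⟨0, 0⟩, ⟨0, 0⟩, ⟨1, 0⟩⟩, ⟨5, 0⟩), (⟨⟨1, 0⟩, ⟨0, 0⟩, ⟨1, 0⟩⟩, ⟨5, 0⟩),
   (⟨⟨0, 0⟩, ⟨1, 0⟩, ⟨1, 0⟩⟩, ⟨10, 0⟩), (⟨⟨1, 0⟩, ⟨1, 0⟩, ⟨1, 0⟩⟩, ⟨10, 0⟩),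
   (⟨⟨1, 0⟩, ⟨1, 0⟩, ⟨2, 0⟩⟩, ⟨40, 0⟩), (⟨⟨1, 0⟩, ⟨2, 0⟩, ⟨2, 0⟩⟩, ⟨10, 0⟩),
   (⟨⟨1, 0⟩, ⟨2, 0⟩, ⟨3, 0⟩⟩, ⟨10, 0⟩), (⟨⟨2, 0⟩, ⟨2, 0⟩, ⟨3, 0⟩⟩, ⟨10, 0⟩),
   (⟨⟨2, 0⟩, ⟨3, 0⟩, ⟨4, 0⟩⟩, ⟨10, 0⟩), (⟨⟨2, 0⟩, ⟨3, 0⟩, ⟨5, 0⟩⟩, ⟨2, 0⟩),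
   (⟨⟨3, 0⟩, ⟨3, 0⟩, ⟨5, 0⟩⟩, ⟨2, 0⟩), (⟨⟨2, 0⟩, ⟨4, 0⟩, ⟨5, 0⟩⟩, ⟨1, 0⟩),
   (⟨⟨3, 0⟩, ⟨4, 0⟩, ⟨5, 0⟩⟩, ⟨1, 0⟩), (⟨⟨3, 0⟩, ⟨4, 0⟩, ⟨6, 0⟩⟩, ⟨5, 0⟩)]

lemma isRigidVeeSystem_E₈A₁A₄ : IsRigidVeeSystem E₈A₁A₄ := by
  rw [E₈A₁A₄, coxeterRestriction_eq_listSystem rootsCheck_E₈ (K := ![1, 2, 3])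
    (by decide) (by decide) (l := pointsE₈A₁A₄) (by decide +kernel)]
  exact isRigidVeeSystem_of_stepsCheck _ (l := pointsE₈A₁A₄) (m := 5)
    ⟨rfl, rfl, rfl, ⟨⟨1, 0⟩, rfl, rfl⟩, by decide⟩ (by decide +kernel) golden_reduction
    (sel :=
      [(0, 1, 0), (0, 6, 0), (1, 8, 0), (4, 14, 0), (6, 13, 0), (0, 2, 1), (0, 2, 2), (0, 11, 1),
       (0, 11, 2), (0, 13, 1), (0, 13, 2), (1, 2, 1), (1, 2, 2), (2, 10, 1), (0, 4, 2)])
    (by decide +kernel)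
    (steps :=
      [(3, (0, 2), (1, 5)), (4, (0, 5), (1, 2)), (6, (2, 5), (3, 4)), (7, (0, 5), (1, 6)),
       (8, (2, 7), (3, 4)), (9, (0, 8), (2, 5)), (10, (1, 6), (4, 9)), (11, (2, 10), (3, 4)),
       (12, (0, 11), (2, 5)), (13, (1, 11), (2, 7)), (14, (0, 13), (1, 12)),
       (15, (0, 8), (1, 6))])
    (by decide +kernel)

/-- The points and weights of `H₄A₁`. -/
def pointsH₄A₁ : List WeightedPoint :=
  [(⟨⟨1, 0⟩, ⟨0, 0⟩, ⟨0, 0⟩⟩, ⟨2, 0⟩), (⟨⟨0, 0⟩, ⟨1, 0⟩, ⟨0, 0⟩⟩, ⟨1, 0⟩),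
   (⟨⟨0, 0⟩, ⟨0, 0⟩, ⟨1, 0⟩⟩, ⟨1, 0⟩), (⟨⟨1, 0⟩, ⟨1, 0⟩, ⟨0, 0⟩⟩, ⟨2, 0⟩),
   (⟨⟨0, 0⟩, ⟨1, 0⟩, ⟨0, 1⟩⟩, ⟨1, 0⟩), (⟨⟨0, 0⟩, ⟨0, 1⟩, ⟨1, 0⟩⟩, ⟨1, 0⟩),
   (⟨⟨0, 0⟩, ⟨0, 1⟩, ⟨0, 1⟩⟩, ⟨1, 0⟩), (⟨⟨1, 0⟩, ⟨1, 0⟩, ⟨0, 1⟩⟩, ⟨2, 0⟩),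
   (⟨⟨0, 1⟩, ⟨0, 1⟩, ⟨1, 0⟩⟩, ⟨4, 2⟩), (⟨⟨0, 1⟩, ⟨0, 1⟩, ⟨0, 1⟩⟩, ⟨4, 2⟩),
   (⟨⟨1, 0⟩, ⟨1, 1⟩, ⟨0, 1⟩⟩, ⟨2, 0⟩), (⟨⟨0, 1⟩, ⟨1, 1⟩, ⟨0, 1⟩⟩, ⟨4, 2⟩),
   (⟨⟨1, 0⟩, ⟨1, 1⟩, ⟨1, 1⟩⟩, ⟨2, 0⟩), (⟨⟨0, 1⟩, ⟨1, 1⟩, ⟨1, 1⟩⟩, ⟨4, 2⟩),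
   (⟨⟨0, 1⟩, ⟨0, 2⟩, ⟨1, 1⟩⟩, ⟨4, 2⟩), (⟨⟨0, 2⟩, ⟨0, 2⟩, ⟨1, 1⟩⟩, ⟨1, 0⟩),
   (⟨⟨0, 2⟩, ⟨1, 2⟩, ⟨1, 1⟩⟩, ⟨1, 0⟩), (⟨⟨0, 2⟩, ⟨1, 2⟩, ⟨1, 2⟩⟩, ⟨1, 0⟩),
   (⟨⟨2, 1⟩, ⟨2, 2⟩, ⟨1, 2⟩⟩, ⟨4, 2⟩), (⟨⟨0, 2⟩, ⟨1, 3⟩, ⟨1, 2⟩⟩, ⟨1, 0⟩),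
   (⟨⟨1, 2⟩, ⟨2, 2⟩, ⟨1, 2⟩⟩, ⟨2, 0⟩), (⟨⟨1, 2⟩, ⟨1, 3⟩, ⟨1, 2⟩⟩, ⟨2, 0⟩),
   (⟨⟨0, 2⟩, ⟨1, 3⟩, ⟨2, 2⟩⟩, ⟨1, 0⟩), (⟨⟨1, 2⟩, ⟨1, 3⟩, ⟨2, 2⟩⟩, ⟨2, 0⟩),
   (⟨⟨1, 2⟩, ⟨2, 3⟩, ⟨2, 2⟩⟩, ⟨2, 0⟩), (⟨⟨1, 2⟩, ⟨2, 3⟩, ⟨1, 3⟩⟩, ⟨2, 0⟩),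
   (⟨⟨2, 2⟩, ⟨2, 3⟩, ⟨2, 2⟩⟩, ⟨1, 0⟩), (⟨⟨2, 2⟩, ⟨2, 3⟩, ⟨1, 3⟩⟩, ⟨1, 0⟩),
   (⟨⟨2, 2⟩, ⟨3, 3⟩, ⟨1, 3⟩⟩, ⟨1, 0⟩), (⟨⟨2, 2⟩, ⟨3, 3⟩, ⟨2, 3⟩⟩, ⟨1, 0⟩),
   (⟨⟨2, 2⟩, ⟨2, 4⟩, ⟨2, 3⟩⟩, ⟨1, 0⟩)]

lemma isRigidVeeSystem_H₄A₁ : IsRigidVeeSystem H₄A₁ := by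
  rw [H₄A₁, coxeterRestriction_eq_listSystem rootsCheck_H₄ (K := ![1, 2, 3])
    (by decide) (by decide) (l := pointsH₄A₁) (by decide +kernel)]
  exact isRigidVeeSystem_of_goldenCheck _ (l := pointsH₄A₁) (m := 9) (e := 3) (f := 6) (x := 12)
    (y := 10) (z := 11) ⟨rfl, rfl, rfl, ⟨⟨0, 1⟩, rfl, rfl⟩, by decide⟩
    (by decide +kernel) golden_reduction
    (sel :=
      [(0, 2, 0), (0, 28, 0), (1, 8, 0), (1, 12, 0), (2, 14, 0), (0, 1, 1), (0, 1, 2), (0, 4, 1),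
       (0, 4, 2), (0, 19, 1), (0, 19, 2), (0, 22, 1), (0, 22, 2), (0, 24, 1), (0, 24, 2),
       (0, 25, 1), (0, 25, 2), (1, 15, 1), (1, 15, 2), (1, 27, 1), (2, 10, 1), (2, 10, 2),
       (2, 19, 2), (2, 28, 1), (3, 6, 1), (3, 17, 1), (3, 17, 2), (5, 7, 2), (5, 27, 1),
       (0, 5, 1)])
    (by decide +kernel) (by decide) (by decide +kernel)
    (steps :=
      [(3, (0, 1), (2, 9)), (4, (1, 2), (12, 3)), (6, (0, 9), (1, 2)), (7, (0, 4), (2, 9)),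
       (10, (1, 7), (2, 12)), (11, (0, 10), (1, 9)), (13, (0, 9), (1, 7)), (14, (1, 7), (12, 3)),
       (15, (0, 14), (2, 9)), (16, (0, 10), (1, 15)), (17, (0, 9), (2, 16)),
       (18, (0, 14), (3, 13)), (19, (1, 17), (12, 3)), (20, (0, 14), (1, 9)),
       (21, (0, 19), (1, 9)), (22, (1, 7), (2, 19)), (23, (0, 22), (2, 21)),
       (24, (1, 23), (2, 11)), (25, (2, 11), (4, 21)), (26, (0, 24), (1, 9)),
       (27, (0, 25), (2, 16)), (28, (1, 27), (3, 25)), (29, (1, 17), (2, 28)),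
       (30, (0, 14), (1, 17)), (5, (0, 10), (1, 2)), (8, (0, 10), (2, 9))])
    (by decide +kernel)

/-- The points and weights of `H₃`. -/
def pointsH₃ : List WeightedPoint :=
  [(⟨⟨1, 0⟩, ⟨0, 0⟩, ⟨0, 0⟩⟩, ⟨1, 0⟩), (⟨⟨0, 0⟩, ⟨1, 0⟩, ⟨0, 0⟩⟩, ⟨1, 0⟩),
   (⟨⟨0, 0⟩, ⟨0, 0⟩, ⟨1, 0⟩⟩, ⟨1, 0⟩), (⟨⟨1, 0⟩, ⟨1, 0⟩, ⟨0, 0⟩⟩, ⟨1, 0⟩),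
   (⟨⟨0, 0⟩, ⟨1, 0⟩, ⟨0, 1⟩⟩, ⟨1, 0⟩), (⟨⟨0, 0⟩, ⟨0, 1⟩, ⟨1, 0⟩⟩, ⟨1, 0⟩),
   (⟨⟨0, 0⟩, ⟨0, 1⟩, ⟨0, 1⟩⟩, ⟨1, 0⟩), (⟨⟨1, 0⟩, ⟨1, 0⟩, ⟨0, 1⟩⟩, ⟨1, 0⟩),
   (⟨⟨0, 1⟩, ⟨0, 1⟩, ⟨1, 0⟩⟩, ⟨1, 0⟩), (⟨⟨0, 1⟩, ⟨0, 1⟩, ⟨0, 1⟩⟩, ⟨1, 0⟩),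
   (⟨⟨1, 0⟩, ⟨1, 1⟩, ⟨0, 1⟩⟩, ⟨1, 0⟩), (⟨⟨0, 1⟩, ⟨1, 1⟩, ⟨0, 1⟩⟩, ⟨1, 0⟩),
   (⟨⟨1, 0⟩, ⟨1, 1⟩, ⟨1, 1⟩⟩, ⟨1, 0⟩), (⟨⟨0, 1⟩, ⟨1, 1⟩, ⟨1, 1⟩⟩, ⟨1, 0⟩),
   (⟨⟨0, 1⟩, ⟨0, 2⟩, ⟨1, 1⟩⟩, ⟨1, 0⟩)]

lemma isRigidVeeSystem_H₃ : IsRigidVeeSystem H₃ := by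
  rw [H₃, coxeterRestriction_eq_listSystem rootsCheck_H₃ (K := ![0, 1, 2])
    (by decide) (by decide) (l := pointsH₃) (by decide +kernel)]
  exact isRigidVeeSystem_of_goldenCheck _ (l := pointsH₃) (m := 9) (e := 3) (f := 6) (x := 12)
    (y := 10) (z := 11) ⟨rfl, rfl, rfl, ⟨⟨0, 1⟩, rfl, rfl⟩, by decide⟩
    (by decide +kernel) golden_reduction
    (sel :=
      [(0, 2, 0), (0, 14, 0), (1, 8, 0), (1, 12, 0), (2, 14, 0), (0, 1, 1), (0, 1, 2), (0, 4, 1),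
       (0, 4, 2), (1, 9, 1), (1, 9, 2), (2, 10, 1), (2, 10, 2), (2, 11, 1)])
    (by decide +kernel) (by decide) (by decide +kernel)
    (steps :=
      [(3, (0, 1), (2, 9)), (4, (1, 2), (12, 3)), (6, (0, 9), (1, 2)), (7, (0, 4), (2, 9)),
       (10, (1, 7), (2, 12)), (11, (0, 10), (1, 9)), (13, (0, 9), (1, 7)), (14, (1, 7), (12, 3)),
       (5, (0, 10), (1, 2)), (8, (0, 10), (2, 9))])
    (by decide +kernel)

end VeeSystem

end

theorem mainTheorem1 :
    VeeSystem.IsRigidVeeSystem VeeSystem.E₇A₁A₁A₂ ∧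
    VeeSystem.IsRigidVeeSystem VeeSystem.E₈A₂A₃ ∧
    VeeSystem.IsRigidVeeSystem VeeSystem.E₈A₂A₂A₁ ∧
    VeeSystem.IsRigidVeeSystem VeeSystem.E₈A₁A₁A₁A₂ ∧
    VeeSystem.IsRigidVeeSystem VeeSystem.E₈A₁A₁A₃ ∧
    VeeSystem.IsRigidVeeSystem VeeSystem.E₈A₁A₄ ∧
    VeeSystem.IsRigidVeeSystem VeeSystem.H₄A₁ ∧
    VeeSystem.IsRigidVeeSystem VeeSystem.H₃ := by
  exact ⟨VeeSystem.isRigidVeeSystem_E₇A₁A₁A₂, VeeSystem.isRigidVeeSystem_E₈A₂A₃,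
    VeeSystem.isRigidVeeSystem_E₈A₂A₂A₁, VeeSystem.isRigidVeeSystem_E₈A₁A₁A₁A₂,
    VeeSystem.isRigidVeeSystem_E₈A₁A₁A₃, VeeSystem.isRigidVeeSystem_E₈A₁A₄,
    VeeSystem.isRigidVeeSystem_H₄A₁, VeeSystem.isRigidVeeSystem_H₃⟩
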